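/- Conventions. A partial field is a set $P$ with distinguished elements $0,1$, a commutative multiplication for which $P\setminus\{0\}$ is an abelian group with identity $1$ and $0\cdot p=0$ for all $p$, and a partially defined addition satisfying: $p+0=p$; every $p$ has a unique additive inverse $-p$; addition is commutative (if $p+q$ is defined, so is $q+p$, and they are equal); for $p\neq 0$, $p(q+r)$ is defined if and only if $pq+pr$ is, and then they are equal; and the associative law. Here an association of a finite multiset $S$ of elements of $P$ is a binary tree whose leaves are labelled by the elements of $S$ (with multiplicity) and in which each inner node is labelled by the sum of the labels of its two children, all these sums being defined; a pre-association is the same except that the sum at the root need not be defined. The associative law says: if $S$ has an association with root label $r$, then in every pre-association of $S$ the sum of the labels of the two children of the root is defined and equals $r$. A sum $p_1+\dots+p_n$ is defined, with value $r$, if for some finite multiset $Z=\{z_1,-z_1,\dots,z_k,-z_k\}$ the multiset $\{p_1,\dots,p_n\}\cup Z$ has an association with root label $r$. In particular every field is a partial field. A matrix over $P$ is a $P$-matrix if the determinant $\sum_\sigma \operatorname{sgn}(\sigma)\prod_i a_{i\sigma(i)}$ of each of its square submatrices is defined. A (finite) matroid $M$ with ground set $E$ is representable over $P$ (or $P$-representable)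 if for some $r$ there is an $r\times E$ $P$-matrix $A$ of rank $r$ (i.e. with a nonzero $r \times r$ subdeterminant) such that the bases of $M$ are exactly the sets $B\subseteq E$ with $|B|=r$ for which the submatrix of $A$ with column set $B$ has nonzero determinant. For a commutative ring $R\neq 0$ and a set $S$ of units of $R$, $\mathbb{P}(R,S)$ is the partial field with underlying set $\langle S\cup\{-1\}\rangle\cup\{0\}$ (where $\langle\cdot\rangle$ denotes the generated subgroup of the unit group of $R$), whose multiplication and addition are the restrictions of those of $R$; $p+q$ is defined if and only if the sum in $R$ lies in this set. For partial fields $P_1,P_2$, the direct product $P_1\otimes P_2$ is the partial field on $\{(p_1,p_2)\in P_1\times P_2 : p_1\neq 0 \Leftrightarrow p_2\neq 0\}$ with componentwise operations, where $(p_1,p_2)+(q_1,q_2)$ is defined if and only if $p_1+q_1$ and $p_2+q_2$ are both defined and are either both zero or both nonzero. Theorem (Whittle). Let $M$ be a matroid, let $\zeta\in\mathbb{C}$ be a primitive sixth root of unity, and let $\mathbb{Y}=\mathbb{P}(\mathbb{C},\{2,\zeta\})$. The following are equivalent: (i) $M$ is representable over $\mathrm{GF}(3)\otimes\mathrm{GF}(7)$;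 (ii) $M$ is $\mathbb{Y}$-representable; (iii) $M$ is representable over $\mathrm{GF}(3)$, over $\mathrm{GF}(p^2)$ for all primes $p>2$, and over $\mathrm{GF}(p)$ for all primes $p\equiv 1 \pmod 3$. -/

import Mathlib

universe u v w

/-- `HasAssociation padd S r`: the multiset `S` has an association whose root is labelled `r`, with
respect to the partial operation `padd`. That is, there is a binary tree whose leaves are labelled
by the elements of `S` (with multiplicity) and in which every inner node is labelled by the
(defined) sum of the labels of its two children; `r` is the label of the root. -/
inductive HasAssociation {P : Type u} (padd : P → P → Part P) : Multiset P → P → Prop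
  | leaf (p : P) : HasAssociation padd {p} p
  | node (S T : Multiset P) (u w r : P) : HasAssociation padd S u → HasAssociation padd T w →
      r ∈ padd u w → HasAssociation padd (S + T) r

/-- A partial field. The nonzero elements form an abelian group under multiplication and `0` is
absorbing (`CommGroupWithZero`); `r ∈ padd p q` says that `p + q` is defined and equal to `r`.
The field `assoc_law` is the associative law: if `S` has an association with root `r`, and two
trees with root labels `u`, `w` and leaf multisets `S₁`, `S₂` form a pre-association of
`S = S₁ + S₂`, then `u + w` is defined and equal to `r`. -/
class PartialField (P : Type u) extends CommGroupWithZero P where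
  /-- the partial addition -/
  padd : P → P → Part P
  /-- the additive inverse -/
  pneg : P → P
  padd_zero : ∀ p : P, p ∈ padd p 0
  padd_pneg : ∀ p : P, 0 ∈ padd p (pneg p)
  eq_pneg : ∀ p q : P, 0 ∈ padd p q → q = pneg p
  padd_comm : ∀ p q r : P, r ∈ padd p q → r ∈ padd q p
  /-- distributivity: `p (q + r)` is defined if and only if `p q + p r` is -/
  dom_mul : ∀ p q r : P, p ≠ 0 → ((padd q r).Dom ↔ (padd (p * q) (p * r)).Dom)
  /-- distributivity: if defined, the two sides agree -/
  mul_padd : ∀ p q r s : P, s ∈ padd q r → p * s ∈ padd (p * q) (p * r)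
  assoc_law : ∀ (S : Multiset P) (r : P), HasAssociation padd S r →
    ∀ (S₁ S₂ : Multiset P) (u w : P), S₁ + S₂ = S →
      HasAssociation padd S₁ u → HasAssociation padd S₂ w → r ∈ padd u w

namespace PartialField

section Matrices

variable {P : Type u} [PartialField P]

/-- `IsSum S r`: the sum of the elements of `S` is defined and equal to `r`, i.e. after adding
finitely many pairs `z, -z` to `S` there is an association with root `r`. -/
def IsSum (S : Multiset P) (r : P) : Prop :=
  ∃ Z : Multiset P, HasAssociation padd (S + (Z + Z.map pneg)) r

/-- The terms `sign(σ) a_{1σ(1)} ⋯ a_{nσ(n)}` of the formal determinant. -/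
def detTerms {n : Type*} [Fintype n] [DecidableEq n] (A : Matrix n n P) : Multiset P :=
  (Finset.univ : Finset (Equiv.Perm n)).val.map fun σ =>
    if Equiv.Perm.sign σ = 1 then ∏ i, A i (σ i) else pneg (∏ i, A i (σ i))

/-- `HasDet A d`: the determinant of `A` is defined and equal to `d`. -/
def HasDet {n : Type*} [Fintype n] [DecidableEq n] (A : Matrix n n P) (d : P) : Prop :=
  IsSum (detTerms A) d

/-- `A` is a `P`-matrix: the determinant of every square submatrix is defined. -/
def IsPMatrix {X Y : Type*} (A : Matrix X Y P) : Prop :=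
  ∀ (k : ℕ) (f : Fin k ↪ X) (g : Fin k ↪ Y), ∃ d : P, HasDet (A.submatrix f g) d

end Matrices

/-- `Represents A M`: the `r × E` matrix `A` is a `P`-matrix (of rank `r`), and `M = M[A]`, i.e. the
bases of `M` are the sets `B` of `r` columns such that `det A[r, B]` is nonzero. (The rank condition
says that there is such a `B`, and follows since `M` has a basis.) -/
def Represents {P : Type u} [PartialField P] {α : Type v} {r : ℕ} {M : Matroid α}
    (A : Matrix (Fin r) M.E P) : Prop :=
  IsPMatrix A ∧
    ∀ B : Set α, M.IsBase B ↔
      ∃ g : Fin r ↪ M.E, Set.range (fun i => (g i : α)) = B ∧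
        ∃ d : P, HasDet (A.submatrix id g) d ∧ d ≠ 0

/-- The matroid `M` is representable over the partial field `P`. -/
def Representable (P : Type u) [PartialField P] {α : Type v} (M : Matroid α) : Prop :=
  ∃ (r : ℕ) (A : Matrix (Fin r) M.E P), Represents A

section Field

theorem HasAssociation_sum {R : Type u} [AddCommMonoid R] {P : Type v} (i : P → R)
    {padd : P → P → Part P} (hadd : ∀ p q r, r ∈ padd p q → i r = i p + i q)
    {S : Multiset P} {r : P} (h : HasAssociation padd S r) : i r = (S.map i).sum := by
  induction h with
  | leaf p => simp
  | node S T u w r _ _ hr ihS ihT => rw [hadd _ _ _ hr, ihS, ihT, Multiset.map_add, Multiset.sum_add]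

theorem HasAssociation_map {P : Type u} {Q : Type v} (i : P → Q)
    {padd : P → P → Part P} {qadd : Q → Q → Part Q}
    (hadd : ∀ p q r, r ∈ padd p q → i r ∈ qadd (i p) (i q))
    {S : Multiset P} {r : P} (h : HasAssociation padd S r) :
    HasAssociation qadd (S.map i) (i r) := by
  induction h with
  | leaf p => simpa using HasAssociation.leaf (padd := qadd) (i p)
  | node S T u w r _ _ hr ihS ihT =>
    rw [Multiset.map_add]
    exact HasAssociation.node _ _ _ _ _ ihS ihT (hadd _ _ _ hr)

/-- Every field is a partial field, in which all sums are defined. -/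
instance ofField (F : Type u) [Field F] : PartialField F where
  toCommGroupWithZero := inferInstance
  padd p q := Part.some (p + q)
  pneg p := -p
  padd_zero p := by simp
  padd_pneg p := by simp
  eq_pneg p q h := by
    rw [Part.mem_some_iff] at h
    exact eq_neg_of_add_eq_zero_right h.symm
  padd_comm p q r h := by rwa [add_comm]
  dom_mul p q r _ := by simp
  mul_padd p q r s h := by
    rw [Part.mem_some_iff] at h ⊢
    rw [h, mul_add]
  assoc_law S r hS S₁ S₂ u w h h₁ h₂ := by
    have key {S : Multiset F} {r : F} (h : HasAssociation (fun p q : F => Part.some (p + q)) S r) :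
        r = S.sum := by
      simpa using HasAssociation_sum id (fun p q r hr => by simpa using hr) h
    rw [Part.mem_some_iff, key hS, key h₁, key h₂, ← h, Multiset.sum_add]

end Field

/-- The underlying set `⟨S ∪ {-1}⟩ ∪ {0}` of `P(R, S)`, for a set `S` of units of a commutative
ring `R`. -/
def OfRing (R : Type u) [CommRing R] (S : Set Rˣ) : Type u :=
  {x : R // x = 0 ∨ ∃ g ∈ Subgroup.closure (S ∪ {-1}), (g : R) = x}

namespace OfRing

variable {R : Type u} [CommRing R] {S : Set Rˣ}

theorem mul_closed {x y : R} (hx : x = 0 ∨ ∃ g ∈ Subgroup.closure (S ∪ {-1}), (g : R) = x)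
    (hy : y = 0 ∨ ∃ g ∈ Subgroup.closure (S ∪ {-1}), (g : R) = y) :
    x * y = 0 ∨ ∃ g ∈ Subgroup.closure (S ∪ {-1}), (g : R) = x * y := by
  rcases hx with rfl | ⟨g, hg, rfl⟩
  · simp
  rcases hy with rfl | ⟨h, hh, rfl⟩
  · simp
  exact Or.inr ⟨g * h, mul_mem hg hh, by simp⟩

theorem inv_closed {x : R} (hx : x = 0 ∨ ∃ g ∈ Subgroup.closure (S ∪ {-1}), (g : R) = x) :
    Ring.inverse x = 0 ∨ ∃ g ∈ Subgroup.closure (S ∪ {-1}), (g : R) = Ring.inverse x := by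
  rcases hx with rfl | ⟨g, hg, rfl⟩
  · simp
  exact Or.inr ⟨g⁻¹, inv_mem hg, by simp⟩

theorem neg_closed {x : R} (hx : x = 0 ∨ ∃ g ∈ Subgroup.closure (S ∪ {-1}), (g : R) = x) :
    -x = 0 ∨ ∃ g ∈ Subgroup.closure (S ∪ {-1}), (g : R) = -x := by
  rcases hx with rfl | ⟨g, hg, rfl⟩
  · simp
  exact Or.inr ⟨-1 * g, mul_mem (Subgroup.subset_closure (by simp)) hg, by simp⟩

noncomputable instance [Nontrivial R] : CommGroupWithZero (OfRing R S) where
  zero := ⟨0, Or.inl rfl⟩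
  one := ⟨1, Or.inr ⟨1, one_mem _, rfl⟩⟩
  mul x y := ⟨x.1 * y.1, mul_closed x.2 y.2⟩
  inv x := ⟨Ring.inverse x.1, inv_closed x.2⟩
  mul_assoc x y z := Subtype.ext (mul_assoc x.1 y.1 z.1)
  one_mul x := Subtype.ext (one_mul x.1)
  mul_one x := Subtype.ext (mul_one x.1)
  mul_comm x y := Subtype.ext (mul_comm x.1 y.1)
  zero_mul x := Subtype.ext (zero_mul x.1)
  mul_zero x := Subtype.ext (mul_zero x.1)
  exists_pair_ne := ⟨⟨0, Or.inl rfl⟩, ⟨1, Or.inr ⟨1, one_mem _, rfl⟩⟩,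
    fun h => zero_ne_one (congrArg Subtype.val h)⟩
  inv_zero := Subtype.ext (Ring.inverse_zero R)
  mul_inv_cancel := by
    rintro ⟨x, hx⟩ hne
    rcases hx with rfl | ⟨g, hg, rfl⟩
    · exact absurd rfl hne
    · exact Subtype.ext (Ring.mul_inverse_cancel _ g.isUnit)

/-- The partial field `P(R, S)`: multiplication and addition are the restrictions of those of `R`,
and `p + q` is defined if and only if it lies in `⟨S ∪ {-1}⟩ ∪ {0}`. -/
noncomputable instance [Nontrivial R] : PartialField (OfRing R S) where
  toCommGroupWithZero := inferInstance
  padd p q := ⟨p.1 + q.1 = 0 ∨ ∃ g ∈ Subgroup.closure (S ∪ {-1}), (g : R) = p.1 + q.1,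
    fun h => ⟨p.1 + q.1, h⟩⟩
  pneg p := ⟨-p.1, neg_closed p.2⟩
  padd_zero p := by
    have h : p.1 + (0 : OfRing R S).1 = p.1 := add_zero p.1
    exact ⟨by rw [h]; exact p.2, Subtype.ext h⟩
  padd_pneg p := ⟨Or.inl (add_neg_cancel p.1), Subtype.ext (add_neg_cancel p.1)⟩
  eq_pneg p q := by
    rintro ⟨_, h⟩
    exact Subtype.ext (eq_neg_of_add_eq_zero_right (congrArg Subtype.val h))
  padd_comm p q r := by
    rintro ⟨hd, rfl⟩
    exact ⟨by rw [add_comm]; exact hd, Subtype.ext (add_comm _ _)⟩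
  dom_mul p q r hp := by
    have e : (p * q).1 + (p * r).1 = p.1 * (q.1 + r.1) := (mul_add p.1 q.1 r.1).symm
    change (_ ∨ _) ↔ (_ ∨ _)
    rw [e]
    refine ⟨fun h => mul_closed p.2 h, fun h => ?_⟩
    have h' := mul_closed (p⁻¹).2 h
    have e' : (p⁻¹).1 * (p.1 * (q.1 + r.1)) = q.1 + r.1 := by
      rw [← mul_assoc]
      have : (p⁻¹).1 * p.1 = 1 := congrArg (fun x : OfRing R S => x.1) (inv_mul_cancel₀ hp)
      rw [this, one_mul]
    rwa [e'] at h'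
  mul_padd p q r s := by
    rintro ⟨hd, rfl⟩
    have e : (p * q).1 + (p * r).1 = p.1 * (q.1 + r.1) := (mul_add p.1 q.1 r.1).symm
    exact ⟨by rw [e]; exact mul_closed p.2 hd, Subtype.ext e⟩
  assoc_law T r hT T₁ T₂ u w h h₁ h₂ := by
    have key := fun (T : Multiset (OfRing R S)) (r : OfRing R S) hT =>
      HasAssociation_sum (S := T) (r := r)
        (padd := fun p q => ⟨p.1 + q.1 = 0 ∨ ∃ g ∈ Subgroup.closure (S ∪ {-1}),
          (g : R) = p.1 + q.1, fun h => ⟨p.1 + q.1, h⟩⟩) (fun x : OfRing R S => x.1)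
        (by rintro p q r ⟨_, rfl⟩; rfl) hT
    have e : u.1 + w.1 = r.1 := by
      rw [key _ _ hT, key _ _ h₁, key _ _ h₂, ← h, Multiset.map_add, Multiset.sum_add]
    exact ⟨by rw [e]; exact r.2, Subtype.ext e⟩

end OfRing

/-- The underlying set of the direct product `P₁ ⊗ P₂`. -/
def DirectProduct (P₁ : Type u) (P₂ : Type v) [PartialField P₁] [PartialField P₂] : Type (max u v) :=
  {p : P₁ × P₂ // p.1 ≠ 0 ↔ p.2 ≠ 0}

namespace DirectProduct

variable {P₁ : Type u} {P₂ : Type v} [PartialField P₁] [PartialField P₂]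

theorem ext' {p q : DirectProduct P₁ P₂} (h₁ : p.1.1 = q.1.1) (h₂ : p.1.2 = q.1.2) : p = q :=
  Subtype.ext (Prod.ext h₁ h₂)

instance : CommGroupWithZero (DirectProduct P₁ P₂) where
  zero := ⟨(0, 0), by simp⟩
  one := ⟨(1, 1), by simp⟩
  mul x y := ⟨(x.1.1 * y.1.1, x.1.2 * y.1.2), by
    have hx := x.2
    have hy := y.2
    simp only [ne_eq, mul_eq_zero, not_or] at *
    rw [hx, hy]⟩
  inv x := ⟨(x.1.1⁻¹, x.1.2⁻¹), by simpa using x.2⟩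
  mul_assoc x y z := ext' (mul_assoc _ _ _) (mul_assoc _ _ _)
  one_mul x := ext' (one_mul _) (one_mul _)
  mul_one x := ext' (mul_one _) (mul_one _)
  mul_comm x y := ext' (mul_comm _ _) (mul_comm _ _)
  zero_mul x := ext' (zero_mul _) (zero_mul _)
  mul_zero x := ext' (mul_zero _) (mul_zero _)
  exists_pair_ne := ⟨⟨(0, 0), by simp⟩, ⟨(1, 1), by simp⟩,
    fun h => zero_ne_one (congrArg (fun x => x.1.1) h)⟩
  inv_zero := ext' inv_zero inv_zero
  mul_inv_cancel x hx := by
    have h1 : x.1.1 ≠ 0 := fun h => hx (ext' h (by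
      by_contra h2
      exact x.2.mpr h2 h))
    exact ext' (mul_inv_cancel₀ h1) (mul_inv_cancel₀ (x.2.mp h1))

theorem pneg_ne_zero {P : Type u} [PartialField P] (p : P) : pneg p ≠ 0 ↔ p ≠ 0 := by
  have h0 : (0 : P) = pneg 0 := eq_pneg 0 0 (padd_zero 0)
  constructor
  · rintro h rfl
    exact h h0.symm
  · intro h hp
    have h1 := padd_pneg p
    rw [hp] at h1
    exact h (Part.mem_unique (padd_zero p) h1)

/-- Addition in `P₁ ⊗ P₂` is componentwise, and it is defined if and only if both component sums
are defined and the pair of these sums lies in `P₁ ⊗ P₂`. -/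
def add (p q : DirectProduct P₁ P₂) : Part (DirectProduct P₁ P₂) :=
  ⟨∃ (h₁ : (padd p.1.1 q.1.1).Dom) (h₂ : (padd p.1.2 q.1.2).Dom),
    (padd p.1.1 q.1.1).get h₁ ≠ 0 ↔ (padd p.1.2 q.1.2).get h₂ ≠ 0,
   fun h => ⟨((padd p.1.1 q.1.1).get h.1, (padd p.1.2 q.1.2).get h.2.1), h.2.2⟩⟩

theorem mem_add {p q r : DirectProduct P₁ P₂} :
    r ∈ add p q ↔ r.1.1 ∈ padd p.1.1 q.1.1 ∧ r.1.2 ∈ padd p.1.2 q.1.2 := by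
  constructor
  · rintro ⟨h, rfl⟩
    exact ⟨⟨h.1, rfl⟩, ⟨h.2.1, rfl⟩⟩
  · rintro ⟨⟨h₁, e₁⟩, ⟨h₂, e₂⟩⟩
    exact ⟨⟨h₁, h₂, by rw [e₁, e₂]; exact r.2⟩, ext' e₁ e₂⟩

instance : PartialField (DirectProduct P₁ P₂) where
  toCommGroupWithZero := inferInstance
  padd := add
  pneg p := ⟨(pneg p.1.1, pneg p.1.2), by
    simpa only [pneg_ne_zero] using p.2⟩
  padd_zero p := mem_add.2 ⟨padd_zero _, padd_zero _⟩
  padd_pneg p := mem_add.2 ⟨padd_pneg _, padd_pneg _⟩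
  eq_pneg p q h := ext' (eq_pneg _ _ (mem_add.1 h).1) (eq_pneg _ _ (mem_add.1 h).2)
  padd_comm p q r h := mem_add.2
    ⟨padd_comm _ _ _ (mem_add.1 h).1, padd_comm _ _ _ (mem_add.1 h).2⟩
  dom_mul p q r hp := by
    have key : ∀ p q r s : DirectProduct P₁ P₂, s ∈ add q r → p * s ∈ add (p * q) (p * r) :=
      fun p q r s h => mem_add.2 ⟨mul_padd _ _ _ _ (mem_add.1 h).1, mul_padd _ _ _ _ (mem_add.1 h).2⟩
    constructor
    · intro h
      exact Part.dom_iff_mem.2 ⟨_, key p q r _ ⟨h, rfl⟩⟩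
    · intro h
      have := key p⁻¹ (p * q) (p * r) _ ⟨h, rfl⟩
      rw [inv_mul_cancel_left₀ hp, inv_mul_cancel_left₀ hp] at this
      exact Part.dom_iff_mem.2 ⟨_, this⟩
  mul_padd p q r s h :=
    mem_add.2 ⟨mul_padd _ _ _ _ (mem_add.1 h).1, mul_padd _ _ _ _ (mem_add.1 h).2⟩
  assoc_law S r hS S₁ S₂ u w h h₁ h₂ := by
    have m₁ := fun (S : Multiset (DirectProduct P₁ P₂)) (r : DirectProduct P₁ P₂) hS =>
      HasAssociation_map (S := S) (r := r) (padd := add) (qadd := padd) (fun x => x.1.1)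
        (fun p q r h => (mem_add.1 h).1) hS
    have m₂ := fun (S : Multiset (DirectProduct P₁ P₂)) (r : DirectProduct P₁ P₂) hS =>
      HasAssociation_map (S := S) (r := r) (padd := add) (qadd := padd) (fun x => x.1.2)
        (fun p q r h => (mem_add.1 h).2) hS
    refine mem_add.2 ⟨?_, ?_⟩
    · exact assoc_law _ _ (m₁ _ _ hS) _ _ _ _ (by rw [← h, Multiset.map_add]) (m₁ _ _ h₁) (m₁ _ _ h₂)
    · exact assoc_law _ _ (m₂ _ _ hS) _ _ _ _ (by rw [← h, Multiset.map_add]) (m₂ _ _ h₁) (m₂ _ _ h₂)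

end DirectProduct

end PartialField

/-- `7` is prime, so that `ZMod 7` is a field. -/
instance fact_prime_seven : Fact (Nat.Prime 7) := ⟨by norm_num⟩

/-!
The matrices over a partial field `P(R, S)` are matrices over the ring `R` whose minors are zero or
units, so the heart of the matter is to lift a matrix with unit minors along the homomorphism
`ℤ[1/2, ζ] → GF(3) × GF(7)`. This homomorphism is a bijection between the fundamental elements, the
units `p` with `1 - p` zero or a unit: up to the symmetries of the cross-ratio they are `1`, `-1`
and the primitive sixth roots of unity.

Such a matrix `A` lifts by induction on its size. Unless `A` is at most `2 × 2`, it has, after at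
most one pivot or transposition, two rows `x` and `y` such that the lifts of `A` without `x` and of
`A` without `y` can be scaled to agree on the common rows, because cross-ratios are fundamental
elements and a lift is therefore unique up to scaling. Pivoting on the glued matrix reduces the
claim that its minors are zero or units to the `2 × 2` minors in the rows `x` and `y`. The two
columns of such a minor are joined by a path through the other rows, which further pivots shorten to
at most two rows. There the minor is controlled by products of cross-ratios, and the relations
between fundamental elements lift.

A determinant over `𝕐` is defined as soon as its value lies in `𝕐`, because the defined sums of `𝕐`
already imply all additive relations in `ℤ[1/2, ζ]` between elements of `𝕐`.

The remaining implications hold because homomorphisms of partial fields preserve representations,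
and `ζ` can be sent to any root `z` of `z ^ 2 = z - 1` in a field in which `2` is nonzero.
-/

namespace UnitMinors

open scoped Ring

section IsZeroOrUnit

variable {R K : Type*} [CommRing R] [CommRing K] {x y : R}

/-- `x` is zero or a unit. The matrices over a partial field embedded in a commutative ring are
matrices over the ring whose minors have this property. -/
def IsZeroOrUnit (x : R) : Prop := x = 0 ∨ IsUnit x

namespace IsZeroOrUnit

theorem zero : IsZeroOrUnit (0 : R) := Or.inl rfl

theorem of_isUnit (hx : IsUnit x) : IsZeroOrUnit x := Or.inr hx

theorem isUnit (h : IsZeroOrUnit x) (hx : x ≠ 0) : IsUnit x := h.resolve_left hx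

theorem mul (hx : IsZeroOrUnit x) (hy : IsZeroOrUnit y) : IsZeroOrUnit (x * y) := by
  rcases hx with rfl | hx
  · exact Or.inl (zero_mul y)
  rcases hy with rfl | hy
  · exact Or.inl (mul_zero x)
  exact Or.inr (hx.mul hy)

theorem of_isUnit_mul (hx : IsUnit x) (h : IsZeroOrUnit (x * y)) : IsZeroOrUnit y :=
  h.imp hx.mul_right_eq_zero.1 isUnit_of_mul_isUnit_right

theorem neg (h : IsZeroOrUnit x) : IsZeroOrUnit (-x) := h.imp neg_eq_zero.2 IsUnit.neg

theorem map (h : IsZeroOrUnit x) (φ : R →+* K) : IsZeroOrUnit (φ x) :=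
  h.imp (fun hx => by rw [hx, map_zero]) (fun hx => hx.map φ)

theorem map_eq_zero_iff [Nontrivial K] (h : IsZeroOrUnit x) (φ : R →+* K) : φ x = 0 ↔ x = 0 := by
  refine ⟨fun hφx => ?_, fun hx => by rw [hx, map_zero]⟩
  by_contra hx
  exact ((h.isUnit hx).map φ).ne_zero hφx

end IsZeroOrUnit

end IsZeroOrUnit

section HasUnitMinors

variable {R : Type*} [CommRing R] {m n p q : Type*} {A : Matrix m n R}

/-- Every minor of `A` is zero or a unit; this plays the role of a `P`-matrix over a ring. Repeated
rows and columns are allowed, since they only add the minor `0`. -/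
def HasUnitMinors (A : Matrix m n R) : Prop :=
  ∀ (k : ℕ) (f : Fin k → m) (g : Fin k → n), IsZeroOrUnit (A.submatrix f g).det

theorem det_submatrix_eq_zero_of_not_injective {ι : Type*} [Fintype ι] [DecidableEq ι] {f : ι → m}
    (hf : ¬Function.Injective f) (g : ι → n) : (A.submatrix f g).det = 0 := by
  obtain ⟨i, j, hij, hne⟩ := Function.not_injective_iff.1 hf
  exact Matrix.det_zero_of_row_eq hne (by ext; simp only [Matrix.submatrix_apply, hij])

theorem isZeroOrUnit_det_of_column {k : ℕ} {B : Matrix (Fin (k + 1)) (Fin (k + 1)) R}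
    {i j : Fin (k + 1)} (hcol : ∀ l ≠ i, B l j = 0) (hij : IsZeroOrUnit (B i j))
    (h : IsZeroOrUnit (B.submatrix i.succAbove j.succAbove).det) : IsZeroOrUnit B.det := by
  rw [Matrix.det_succ_column B j, Finset.sum_eq_single i
    (fun l _ hl => by rw [hcol l hl, mul_zero, zero_mul])
    (fun hi => absurd (Finset.mem_univ i) hi)]
  exact ((IsZeroOrUnit.of_isUnit (isUnit_one.neg.pow _)).mul hij).mul h

namespace HasUnitMinors

theorem submatrix (h : HasUnitMinors A) (f : p → m) (g : q → n) :
    HasUnitMinors (A.submatrix f g) := fun k f' g' => h k (f ∘ f') (g ∘ g')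

theorem transpose (h : HasUnitMinors A) : HasUnitMinors A.transpose := fun k f g => by
  rw [← Matrix.transpose_submatrix, Matrix.det_transpose]
  exact h k g f

theorem isZeroOrUnit_apply (h : HasUnitMinors A) (i : m) (j : n) : IsZeroOrUnit (A i j) := by
  simpa only [Matrix.det_fin_one, Matrix.submatrix_apply] using h 1 (fun _ => i) (fun _ => j)

theorem isZeroOrUnit_mul_sub_mul (h : HasUnitMinors A) (i i' : m) (j j' : n) :
    IsZeroOrUnit (A i j * A i' j' - A i j' * A i' j) := by
  have hdet := h 2 ![i, i'] ![j, j']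
  rwa [Matrix.det_fin_two] at hdet

theorem isZeroOrUnit_det (h : HasUnitMinors A) {ι : Type*} [Fintype ι] [DecidableEq ι] (f : ι → m)
    (g : ι → n) : IsZeroOrUnit (A.submatrix f g).det := by
  have e := Fintype.equivFin ι
  have := h _ (f ∘ e.symm) (g ∘ e.symm)
  rwa [← Matrix.submatrix_submatrix, Matrix.det_submatrix_equiv_self] at this

theorem scale (h : HasUnitMinors A) (d : m → Rˣ) (e : n → Rˣ) :
    HasUnitMinors (Matrix.of fun i j => (d i : R) * A i j * (e j : R)) := fun k f g => by
  have factor : (Matrix.of fun i j => (d i : R) * A i j * (e j : R)).submatrix f g =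
      Matrix.of fun i j => (e (g j) : R) *
        (Matrix.of fun i j => (d (f i) : R) * A.submatrix f g i j) i j := by
    ext i j
    simp only [Matrix.submatrix_apply, Matrix.of_apply]
    ring
  rw [factor, Matrix.det_mul_row, Matrix.det_mul_column]
  exact (IsZeroOrUnit.of_isUnit (IsUnit.prod_univ_iff.2 fun j => (e (g j)).isUnit)).mul
    ((IsZeroOrUnit.of_isUnit (IsUnit.prod_univ_iff.2 fun i => (d (f i)).isUnit)).mul (h k f g))

theorem fromCols_one [DecidableEq m] (h : HasUnitMinors A) :
    HasUnitMinors (Matrix.fromCols (1 : Matrix m m R) A) := by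
  intro k
  induction k with
  | zero => exact fun f g => Or.inr (by simp)
  | succ k ih =>
    intro f g
    by_cases hf : Function.Injective f
    swap
    · exact Or.inl (det_submatrix_eq_zero_of_not_injective hf g)
    by_cases hg : ∃ j i, g j = Sum.inl i
    · obtain ⟨j, i, hj⟩ := hg
      by_cases hi : ∃ l, f l = i
      · obtain ⟨l, rfl⟩ := hi
        refine isZeroOrUnit_det_of_column (i := l) (j := j) (fun l' hl' => ?_) (Or.inr ?_) (ih _ _)
        · simp [hj, Matrix.one_apply_ne (hf.ne hl')]
        · simp [hj]
      · refine Or.inl (Matrix.det_eq_zero_of_column_eq_zero j fun l => ?_)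
        simp [hj, Matrix.one_apply_ne (fun hl => hi ⟨l, hl⟩)]
    · have hinr : ∀ j, ∃ i, g j = Sum.inr i := fun j => by
        rcases hgj : g j with i | i
        · exact absurd ⟨j, i, hgj⟩ hg
        · exact ⟨i, rfl⟩
      choose g' hg' using hinr
      obtain rfl : g = Sum.inr ∘ g' := funext hg'
      exact h _ f g'

/-- Every minor of a matrix in standard form is a maximal minor: complete the chosen columns by the
unit columns of the rows that are not chosen. -/
theorem of_maximal_minors [Fintype m] [DecidableEq m] (g : m → n) (hg : A.submatrix id g = 1)
    (h : ∀ h : m → n, IsZeroOrUnit (A.submatrix id h).det) : HasUnitMinors A := by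
  classical
  intro k f c
  by_cases hf : Function.Injective f
  swap
  · exact Or.inl (det_submatrix_eq_zero_of_not_injective hf c)
  set B := A.submatrix id (Function.extend f c g) with hB
  have hBout : ∀ i, ∀ j ∉ Set.range f, B i j = (1 : Matrix m m R) i j := fun i j hj => by
    simp only [hB, Matrix.submatrix_apply, Function.extend_apply' _ _ _ hj, ← hg]
  have hblock : B.det = (B.toSquareBlockProp (· ∈ Set.range f)).det := by
    rw [Matrix.twoBlockTriangular_det' B (· ∈ Set.range f)]
    · have hone : B.toSquareBlockProp (· ∉ Set.range f) = 1 := by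
        ext i j
        simp only [Matrix.toSquareBlockProp_def, Matrix.of_apply, hBout _ _ j.2, Matrix.one_apply,
          Subtype.ext_iff]
      rw [hone, Matrix.det_one, mul_one]
      congr!
    · intro i hi j hj
      rw [hBout i j hj, Matrix.one_apply_ne]
      rintro rfl
      exact hj hi
  have hminor : A.submatrix f c = (B.toSquareBlockProp (· ∈ Set.range f)).submatrix
      (Equiv.ofInjective f hf) (Equiv.ofInjective f hf) := by
    ext i j
    simp [hB, Matrix.toSquareBlockProp, hf.extend_apply]
  rw [hminor, Matrix.det_submatrix_equiv_self]
  have hmax := h (Function.extend f c g)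
  rwa [← hB, hblock] at hmax

end HasUnitMinors

end HasUnitMinors

section RowReduction

variable {R : Type*} [CommRing R] {m n : Type*} [DecidableEq m] {A : Matrix m n R} {r : m} {c : n}

/-- The product of the elementary matrices of the row operations that turn the column `c` of `A`
into the unit column of the row `r`. -/
noncomputable def rowReduction (A : Matrix m n R) (r : m) (c : n) : Matrix m m R :=
  (1 : Matrix m m R).updateCol r fun i => if i = r then (A r c)⁻¹ʳ else -((A r c)⁻¹ʳ * A i c)

variable [Fintype m]

theorem det_rowReduction : (rowReduction A r c).det = (A r c)⁻¹ʳ := by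
  rw [rowReduction, ← Matrix.cramer_apply]
  simp

theorem rowReduction_mulVec (v : m → R) (i : m) : (rowReduction A r c).mulVec v i =
    if i = r then (A r c)⁻¹ʳ * v r else v i - (A r c)⁻¹ʳ * A i c * v r := by
  have off_column : ∀ l ∈ Finset.univ.erase r,
      rowReduction A r c i l * v l = if i = l then v l else 0 := fun l hl => by
    simp [rowReduction, Finset.ne_of_mem_erase hl, Matrix.one_apply]
  rw [Matrix.mulVec, dotProduct, ← Finset.add_sum_erase _ _ (Finset.mem_univ r),
    Finset.sum_congr rfl off_column, Finset.sum_ite_eq]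
  by_cases hi : i = r
  · simp [hi, rowReduction]
  · simp only [hi, rowReduction, Matrix.updateCol_self, if_false, Finset.mem_erase, ne_eq,
      not_false_eq_true, Finset.mem_univ, and_true, if_true]
    ring

theorem rowReduction_mul_apply {l : Type*} (B : Matrix m l R) (i : m) (j : l) :
    (rowReduction A r c * B) i j =
      if i = r then (A r c)⁻¹ʳ * B r j else B i j - (A r c)⁻¹ʳ * A i c * B r j :=
  rowReduction_mulVec (fun i => B i j) i

theorem rowReduction_mul_submatrix_eq_one (h : IsUnit (A r c)) :
    (rowReduction A r c * Matrix.fromCols 1 A).submatrix id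
      (fun i => if i = r then Sum.inr c else Sum.inl i) = 1 := by
  have hinv : (A r c)⁻¹ʳ * A r c = 1 := Ring.inverse_mul_cancel _ h
  ext i j
  rw [Matrix.submatrix_apply, rowReduction_mul_apply]
  by_cases hj : j = r <;> by_cases hi : i = r
  · subst hi hj
    simp [hinv]
  · subst hj
    simp only [id, hi, if_false, if_true, Matrix.fromCols_apply_inr, Matrix.one_apply_ne hi]
    linear_combination (-A i c) * hinv
  · subst hi
    simp [hj, Matrix.one_apply_ne (Ne.symm hj)]
  · simp [hi, hj, Matrix.one_apply_ne (Ne.symm hj)]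

end RowReduction

section Pivot

variable {R K : Type*} [CommRing R] [CommRing K] {m n p q : Type*} [DecidableEq m] [DecidableEq n]

/-- The matrix obtained from `A` by pivoting on the entry `(r, c)`. The row index `r` and the column
index `c` are kept, although the elements they stand for are exchanged. -/
noncomputable def pivot (A : Matrix m n R) (r : m) (c : n) : Matrix m n R := Matrix.of fun i j =>
  if i = r then (if j = c then (A r c)⁻¹ʳ else (A r c)⁻¹ʳ * A r j)
  else if j = c then -((A r c)⁻¹ʳ * A i c)
  else A i j - (A r c)⁻¹ʳ * A i c * A r j

section Apply

variable (A : Matrix m n R) {r i : m} {c j : n}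

theorem pivot_self : pivot A r c r c = (A r c)⁻¹ʳ := by simp [pivot]

theorem pivot_apply_row (hj : j ≠ c) : pivot A r c r j = (A r c)⁻¹ʳ * A r j := by simp [pivot, hj]

theorem pivot_apply_col (hi : i ≠ r) : pivot A r c i c = -((A r c)⁻¹ʳ * A i c) := by
  simp [pivot, hi]

theorem pivot_apply_of_ne (hi : i ≠ r) (hj : j ≠ c) :
    pivot A r c i j = A i j - (A r c)⁻¹ʳ * A i c * A r j := by simp [pivot, hi, hj]

variable {A}

theorem pivot_apply_of_row_eq_zero (hi : i ≠ r) (hj : j ≠ c) (h : A r j = 0) :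
    pivot A r c i j = A i j := by
  rw [pivot_apply_of_ne A hi hj, h, mul_zero, sub_zero]

theorem pivot_apply_of_col_eq_zero (hi : i ≠ r) (hj : j ≠ c) (h : A i c = 0) :
    pivot A r c i j = A i j := by
  rw [pivot_apply_of_ne A hi hj, h, mul_zero, zero_mul, sub_zero]

theorem pivot_apply_ne_zero_of_eq_zero (hi : i ≠ r) (hj : j ≠ c) (hrc : IsUnit (A r c))
    (hic : IsUnit (A i c)) (hrj : A r j ≠ 0) (hij : A i j = 0) : pivot A r c i j ≠ 0 := by
  rwa [pivot_apply_of_ne A hi hj, hij, zero_sub, neg_ne_zero, Ne,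
    (hrc.ringInverse.mul hic).mul_right_eq_zero]

end Apply

variable {A : Matrix m n R} {r : m} {c : n}

theorem isUnit_pivot_self (h : IsUnit (A r c)) : IsUnit (pivot A r c r c) := by
  rw [pivot_self]
  exact h.ringInverse

theorem pivot_pivot (h : IsUnit (A r c)) : pivot (pivot A r c) r c = A := by
  have hinv : (pivot A r c r c)⁻¹ʳ = A r c := by
    obtain ⟨a, ha⟩ := h
    rw [pivot_self, ← ha, Ring.inverse_unit, Ring.inverse_unit, inv_inv]
  have hcancel : A r c * (A r c)⁻¹ʳ = 1 := Ring.mul_inverse_cancel _ h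
  ext i j
  by_cases hi : i = r <;> by_cases hj : j = c
  · subst hi hj
    rw [pivot_self, hinv]
  · subst hi
    rw [pivot_apply_row _ hj, hinv, pivot_apply_row _ hj, ← mul_assoc, hcancel, one_mul]
  · subst hj
    rw [pivot_apply_col _ hi, hinv, pivot_apply_col _ hi, mul_neg, neg_neg, ← mul_assoc, hcancel,
      one_mul]
  · rw [pivot_apply_of_ne _ hi hj, hinv, pivot_apply_of_ne _ hi hj, pivot_apply_col _ hi,
      pivot_apply_row _ hj]
    linear_combination ((A r c)⁻¹ʳ * A i c * A r j) * hcancel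

theorem pivot_map (φ : R →+* K) (h : IsUnit (A r c)) :
    (pivot A r c).map φ = pivot (A.map φ) r c := by
  have hinv : φ (A r c)⁻¹ʳ = (φ (A r c))⁻¹ʳ := by
    obtain ⟨a, ha⟩ := h
    rw [← ha, Ring.inverse_unit]
    exact (Ring.inverse_unit (Units.map (φ : R →* K) a)).symm
  ext i j
  simp only [pivot, Matrix.map_apply, Matrix.of_apply]
  split_ifs <;> simp only [map_neg, map_sub, map_mul, hinv]

theorem pivot_submatrix [DecidableEq p] [DecidableEq q] {f : p → m} {g : q → n}
    (hf : Function.Injective f) (hg : Function.Injective g) (r : p) (c : q) :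
    (pivot A (f r) (g c)).submatrix f g = pivot (A.submatrix f g) r c := by
  ext i j
  simp only [pivot, Matrix.submatrix_apply, Matrix.of_apply, hf.eq_iff, hg.eq_iff]

theorem pivot_eq_rowReduction_mul [Fintype m] : pivot A r c =
    (rowReduction A r c * Matrix.fromCols 1 A).submatrix id
      (fun j => if j = c then Sum.inl r else Sum.inr j) := by
  ext i j
  rw [Matrix.submatrix_apply, rowReduction_mul_apply]
  by_cases hi : i = r <;> by_cases hj : j = c
  · subst hi hj; simp [pivot_self]
  · subst hi; simp [pivot_apply_row _ hj, hj]
  · subst hj; simp [pivot_apply_col _ hi, hi]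
  · simp [pivot_apply_of_ne _ hi hj, hi, hj]

theorem HasUnitMinors.pivot [Finite m] (hA : HasUnitMinors A) (h : IsUnit (A r c)) :
    HasUnitMinors (pivot A r c) := by
  have := Fintype.ofFinite m
  rw [pivot_eq_rowReduction_mul]
  refine (HasUnitMinors.of_maximal_minors _ (rowReduction_mul_submatrix_eq_one h)
    fun g => ?_).submatrix _ _
  have hmul : (rowReduction A r c * Matrix.fromCols 1 A).submatrix id g =
      rowReduction A r c * (Matrix.fromCols 1 A).submatrix id g := rfl
  rw [hmul, Matrix.det_mul, det_rowReduction]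
  exact (IsZeroOrUnit.of_isUnit h.ringInverse).mul (hA.fromCols_one.isZeroOrUnit_det _ _)

theorem det_submatrix_eq_mul_det_pivot {k : ℕ} {f : Fin (k + 1) → m} {g : Fin (k + 1) → n}
    (hf : Function.Injective f) (hg : Function.Injective g) (i j : Fin (k + 1))
    (h : IsUnit (A (f i) (g j))) :
    (A.submatrix f g).det = (-1) ^ (i + j : ℕ) * A (f i) (g j) *
      ((pivot A (f i) (g j)).submatrix (f ∘ i.succAbove) (g ∘ j.succAbove)).det := by
  have hinv : (A (f i) (g j))⁻¹ʳ * A (f i) (g j) = 1 := Ring.inverse_mul_cancel _ h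
  let coeff : Fin (k + 1) → R := fun s => if s = i then 0 else (A (f i) (g j))⁻¹ʳ * A (f s) (g j)
  let B : Matrix (Fin (k + 1)) (Fin (k + 1)) R := Matrix.of fun s t =>
    A (f s) (g t) - coeff s * A (f i) (g t)
  have hdet : (A.submatrix f g).det = B.det := by
    refine Matrix.det_eq_of_forall_row_eq_smul_add_const coeff i (if_pos rfl) fun s t => ?_
    simp [B, coeff]
  have hcol : ∀ s ≠ i, B s j = 0 := fun s hs => by
    simp only [B, coeff, Matrix.of_apply, hs, if_false]
    linear_combination (-A (f s) (g j)) * hinv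
  have hrow : B i j = A (f i) (g j) := by simp [B, coeff]
  have hsub : B.submatrix i.succAbove j.succAbove =
      (pivot A (f i) (g j)).submatrix (f ∘ i.succAbove) (g ∘ j.succAbove) := by
    ext s t
    simp [B, coeff, pivot_apply_of_ne _ (hf.ne (i.succAbove_ne s)) (hg.ne (j.succAbove_ne t)),
      Fin.succAbove_ne]
  rw [hdet, Matrix.det_succ_column _ j, Finset.sum_eq_single i
    (fun s _ hs => by rw [hcol s hs, mul_zero, zero_mul]) (fun hi => absurd (Finset.mem_univ i) hi),
    hrow, hsub]

end Pivot

section Path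

variable {R : Type*} [CommRing R] {m n : Type*}

/-- The graph on the columns of `A` in which two columns are adjacent if some row in `s` is nonzero
at both. -/
def columnGraph (A : Matrix m n R) (s : Set m) : SimpleGraph n :=
  SimpleGraph.fromRel fun j j' => ∃ i ∈ s, A i j ≠ 0 ∧ A i j' ≠ 0

/-- The row `i` of `A` has nonzero entries both inside and outside of `S`. For a set `s` of rows,
the sets `S` crossed by no row in `s` are the unions of connected components of
`columnGraph A s`. -/
def Crosses (A : Matrix m n R) (i : m) (S : Set n) : Prop :=
  (∃ j ∈ S, A i j ≠ 0) ∧ ∃ j ∉ S, A i j ≠ 0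

/-- `r` and `c` describe a chordless path `c 0, r 0, c 1, …, r (l - 1), c l` from the column `u` to
the column `v`, with rows in `s`, in the bipartite graph of the nonzero entries of `A`. The values
of `r` from `l` on and of `c` beyond `l` are irrelevant. -/
structure IsInducedPath (A : Matrix m n R) (s : Set m) (u v : n) (l : ℕ) (r : ℕ → m) (c : ℕ → n) :
    Prop where
  left : c 0 = u
  right : c l = v
  mem : ∀ i < l, r i ∈ s
  ne_fst : ∀ i < l, A (r i) (c i) ≠ 0
  ne_snd : ∀ i < l, A (r i) (c (i + 1)) ≠ 0
  eq_zero : ∀ i < l, ∀ j ≤ l, j ≠ i → j ≠ i + 1 → A (r i) (c j) = 0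

theorem getVert_le_succ_of_dist_le_one {V : Type*} {G : SimpleGraph V} {u v : V} {p : G.Walk u v}
    (hp : p.length = G.dist u v) {i j : ℕ} (hj : j ≤ p.length)
    (hij : ∃ q : G.Walk (p.getVert i) (p.getVert j), q.length ≤ 1) : j ≤ i + 1 := by
  obtain ⟨q, hq⟩ := hij
  have hle := hp ▸ SimpleGraph.dist_le (((p.take i).append q).append (p.drop j))
  simp only [SimpleGraph.Walk.length_append, SimpleGraph.Walk.take_length,
    SimpleGraph.Walk.drop_length] at hle
  omega

variable {A : Matrix m n R} {s : Set m} {u v : n}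

theorem exists_walk_columnGraph {i : m} (hi : i ∈ s) {j j' : n} (hj : A i j ≠ 0)
    (hj' : A i j' ≠ 0) : ∃ q : (columnGraph A s).Walk j j', q.length ≤ 1 := by
  by_cases hjj' : j = j'
  · subst hjj'
    exact ⟨SimpleGraph.Walk.nil, zero_le_one⟩
  · have hadj : (columnGraph A s).Adj j j' :=
      (SimpleGraph.fromRel_adj _ _ _).2 ⟨hjj', Or.inl ⟨i, hi, hj, hj'⟩⟩
    exact ⟨hadj.toWalk, le_rfl⟩

theorem exists_row_of_columnGraph_adj {j j' : n} (h : (columnGraph A s).Adj j j') :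
    ∃ i ∈ s, A i j ≠ 0 ∧ A i j' ≠ 0 := by
  obtain ⟨-, ⟨i, hi, hj, hj'⟩ | ⟨i, hi, hj', hj⟩⟩ := (SimpleGraph.fromRel_adj _ _ _).1 h
  · exact ⟨i, hi, hj, hj'⟩
  · exact ⟨i, hi, hj, hj'⟩

theorem reachable_columnGraph_of_not_crosses
    (h : ∀ S : Set n, (∀ i ∈ s, ¬Crosses A i S) → u ∈ S → v ∈ S) :
    (columnGraph A s).Reachable u v := by
  refine h {w | (columnGraph A s).Reachable u w} ?_ (SimpleGraph.Reachable.refl u)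
  rintro i hi ⟨⟨j, hj, hij⟩, j', hj', hij'⟩
  obtain ⟨q, -⟩ := exists_walk_columnGraph hi hij hij'
  exact hj' (SimpleGraph.Reachable.trans hj ⟨q⟩)

theorem exists_isInducedPath [Nonempty m] (h : (columnGraph A s).Reachable u v) :
    ∃ l r c, IsInducedPath A s u v l r c := by
  obtain ⟨p, hp⟩ := h.exists_walk_length_eq_dist
  have exists_row : ∀ i, ∃ r, i < p.length →
      r ∈ s ∧ A r (p.getVert i) ≠ 0 ∧ A r (p.getVert (i + 1)) ≠ 0 := fun i => by
    by_cases hi : i < p.length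
    · obtain ⟨r, hr⟩ := exists_row_of_columnGraph_adj (p.adj_getVert_succ hi)
      exact ⟨r, fun _ => hr⟩
    · exact ⟨Classical.arbitrary m, fun h => absurd h hi⟩
  choose r hr using exists_row
  refine ⟨p.length, r, p.getVert, p.getVert_zero, p.getVert_length, fun i hi => (hr i hi).1,
    fun i hi => (hr i hi).2.1, fun i hi => (hr i hi).2.2, fun i hi j hj hji hji' => ?_⟩
  by_contra hne
  obtain ⟨hs, hfst, hsnd⟩ := hr i hi
  rcases lt_or_gt_of_ne hji with hlt | hgt
  · have := getVert_le_succ_of_dist_le_one hp (by omega) (exists_walk_columnGraph hs hne hsnd)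
    omega
  · have := getVert_le_succ_of_dist_le_one hp hj (exists_walk_columnGraph hs hfst hne)
    omega

namespace IsInducedPath

variable {l : ℕ} {r : ℕ → m} {c : ℕ → n}

theorem row_ne (h : IsInducedPath A s u v l r c) {i j : ℕ} (hij : i < j) (hj : j < l) :
    r i ≠ r j := fun e => h.ne_snd j hj
  (e ▸ h.eq_zero i (by omega) (j + 1) (by omega) (by omega) (by omega))

theorem col_ne_of_lt (h : IsInducedPath A s u v l r c) {i j : ℕ} (hij : i < j) (hj : j < l) :
    c i ≠ c j := fun e => h.ne_fst j hj
  (e ▸ h.eq_zero j hj i (by omega) (by omega) (by omega))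

theorem col_ne (h : IsInducedPath A s u v l r c) (hl : 2 ≤ l) {i j : ℕ} (hij : i < j)
    (hj : j ≤ l) : c i ≠ c j := by
  rcases hj.lt_or_eq with hj | rfl
  · exact h.col_ne_of_lt hij hj
  intro e
  by_cases hi : i + 1 = j
  · obtain ⟨k, rfl⟩ : ∃ k, i = k + 1 := ⟨i - 1, by omega⟩
    exact h.ne_snd k (by omega)
      (e ▸ h.eq_zero k (by omega) j le_rfl (by omega) (by omega))
  · exact h.ne_fst i (by omega) (e ▸ h.eq_zero i (by omega) j le_rfl (by omega) (by omega))

theorem row_ne_one (h : IsInducedPath A s u v l r c) (hl : 2 ≤ l) {i : ℕ} (hi : i ≠ 1)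
    (hil : i < l) : r i ≠ r 1 := by
  rcases lt_or_gt_of_ne hi with hi | hi
  · exact h.row_ne hi (by omega)
  · exact (h.row_ne hi hil).symm

theorem col_ne_one (h : IsInducedPath A s u v l r c) (hl : 2 ≤ l) {i : ℕ} (hi : i ≠ 1)
    (hil : i ≤ l) : c i ≠ c 1 := by
  rcases lt_or_gt_of_ne hi with hi | hi
  · exact h.col_ne hl hi (by omega)
  · exact (h.col_ne hl hi hil).symm

theorem reverse (h : IsInducedPath A s u v l r c) :
    IsInducedPath A s v u l (fun i => r (l - 1 - i)) (fun i => c (l - i)) where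
  left := h.right
  right := by rw [Nat.sub_self, h.left]
  mem i hi := h.mem _ (by omega)
  ne_fst i hi := by
    have hsnd := h.ne_snd (l - 1 - i) (by omega)
    rwa [show l - 1 - i + 1 = l - i by omega] at hsnd
  ne_snd i hi := by
    rw [show l - (i + 1) = l - 1 - i by omega]
    exact h.ne_fst _ (by omega)
  eq_zero i hi j hj hji hji' := h.eq_zero _ (by omega) _ (by omega) (by omega) (by omega)

variable [DecidableEq m] [DecidableEq n]

theorem pivot_zero_one_apply_ne_zero (hA : ∀ i ∈ s, ∀ j, IsZeroOrUnit (A i j))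
    (h : IsInducedPath A s u v 2 r c) :
    pivot A (r 0) (c 1) (r 1) u ≠ 0 ∧ pivot A (r 0) (c 1) (r 1) v ≠ 0 := by
  obtain ⟨rfl, rfl⟩ := And.intro h.left h.right
  have hr : r 1 ≠ r 0 := (h.row_ne zero_lt_one one_lt_two).symm
  have hc0 : c 0 ≠ c 1 := h.col_ne le_rfl zero_lt_one one_le_two
  have hc2 : c 2 ≠ c 1 := (h.col_ne le_rfl one_lt_two le_rfl).symm
  have z0 : A (r 0) (c 2) = 0 := h.eq_zero 0 two_pos 2 le_rfl (by omega) (by omega)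
  have z1 : A (r 1) (c 0) = 0 := h.eq_zero 1 one_lt_two 0 two_pos.le (by omega) (by omega)
  have u0 : IsUnit (A (r 0) (c 1)) := (hA _ (h.mem 0 two_pos) _).isUnit (h.ne_snd 0 two_pos)
  have u1 : IsUnit (A (r 1) (c 1)) := (hA _ (h.mem 1 one_lt_two) _).isUnit (h.ne_fst 1 one_lt_two)
  refine ⟨pivot_apply_ne_zero_of_eq_zero hr hc0 u0 u1 (h.ne_fst 0 two_pos) z1, ?_⟩
  rw [pivot_apply_of_row_eq_zero hr hc2 z0]
  exact h.ne_snd 1 one_lt_two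

theorem pivot_one_apply_col (h : IsInducedPath A s u v l r c) (hl : 2 ≤ l) {j : ℕ} (h1 : j ≠ 1)
    (h2 : j ≠ 2) (hjl : j ≤ l) {i : m} (hi : i ≠ r 1) :
    pivot A (r 1) (c 1) i (c j) = A i (c j) :=
  pivot_apply_of_row_eq_zero hi (h.col_ne_one hl h1 hjl) (h.eq_zero 1 (by omega) j hjl h1 h2)

theorem pivot_one_apply_row (h : IsInducedPath A s u v l r c) {i j : ℕ} (h2 : 2 ≤ i) (hil : i < l)
    (hj : j ≠ 1) (hjl : j ≤ l) : pivot A (r 1) (c 1) (r i) (c j) = A (r i) (c j) :=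
  pivot_apply_of_col_eq_zero (h.row_ne_one (by omega) (by omega) hil)
    (h.col_ne_one (by omega) hj hjl) (h.eq_zero i hil 1 (by omega) (by omega) (by omega))

theorem pivot_one_apply_zero (h : IsInducedPath A s u v l r c) (hl : 2 ≤ l) {j : ℕ} (h1 : j ≠ 1)
    (h2 : j ≠ 2) (hjl : j ≤ l) : pivot A (r 1) (c 1) (r 0) (c j) = A (r 0) (c j) :=
  h.pivot_one_apply_col hl h1 h2 hjl (h.row_ne_one hl zero_ne_one (by omega))

theorem pivot_one_apply_zero_two_ne_zero (hA : ∀ i ∈ s, ∀ j, IsZeroOrUnit (A i j))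
    (h : IsInducedPath A s u v l r c) (hl : 2 ≤ l) :
    pivot A (r 1) (c 1) (r 0) (c 2) ≠ 0 :=
  pivot_apply_ne_zero_of_eq_zero (h.row_ne_one hl zero_ne_one (by omega))
    (h.col_ne_one hl (by omega) hl) ((hA _ (h.mem 1 (by omega)) _).isUnit (h.ne_fst 1 (by omega)))
    ((hA _ (h.mem 0 (by omega)) _).isUnit (h.ne_snd 0 (by omega))) (h.ne_snd 1 (by omega))
    (h.eq_zero 0 (by omega) _ hl (by omega) (by omega))

theorem pivot_one_apply_left (h : IsInducedPath A s u v (l + 3) r c) {i : m} (hi : i ≠ r 1) :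
    pivot A (r 1) (c 1) i u = A i u := by
  rw [← h.left]
  exact h.pivot_one_apply_col (by omega) zero_ne_one (by omega) (by omega) hi

theorem pivot_one_apply_right (h : IsInducedPath A s u v (l + 3) r c) {i : m} (hi : i ≠ r 1) :
    pivot A (r 1) (c 1) i v = A i v := by
  rw [← h.right]
  exact h.pivot_one_apply_col (by omega) (by omega) (by omega) le_rfl hi

/-- Pivoting on `(r 1, c 1)` makes the row `r 0` nonzero at `c 2`, so that `c 1` and `r 1` can be
left out. -/
theorem pivot_shorten (hA : ∀ i ∈ s, ∀ j, IsZeroOrUnit (A i j))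
    (h : IsInducedPath A s u v (l + 3) r c) :
    IsInducedPath (pivot A (r 1) (c 1)) s u v (l + 2)
      (fun i => if i = 0 then r 0 else r (i + 1)) (fun i => if i = 0 then c 0 else c (i + 1)) where
  left := h.left
  right := h.right
  mem i hi := by
    split_ifs
    · exact h.mem 0 (by omega)
    · exact h.mem _ (by omega)
  ne_fst i hi := by
    split_ifs with hi0
    · rw [h.pivot_one_apply_zero (by omega) zero_ne_one (by omega) (by omega)]
      exact h.ne_fst 0 (by omega)
    · rw [h.pivot_one_apply_row (by omega) (by omega) (by omega) (by omega)]
      exact h.ne_fst _ (by omega)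
  ne_snd i hi := by
    rw [if_neg (Nat.succ_ne_zero i)]
    split_ifs with hi0
    · subst hi0
      exact h.pivot_one_apply_zero_two_ne_zero hA (by omega)
    · rw [h.pivot_one_apply_row (by omega) (by omega) (by omega) (by omega)]
      exact h.ne_snd _ (by omega)
  eq_zero i hi j hj hji hji' := by
    by_cases hi0 : i = 0
    · subst hi0
      rw [if_pos rfl, if_neg hji,
        h.pivot_one_apply_zero (by omega) (by omega) (by omega) (by omega)]
      exact h.eq_zero 0 (by omega) _ (by omega) (by omega) (by omega)
    · rw [if_neg hi0]
      split_ifs with hj0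
      all_goals
        rw [h.pivot_one_apply_row (by omega) (by omega) (by omega) (by omega)]
        exact h.eq_zero _ (by omega) _ (by omega) (by omega) (by omega)

end IsInducedPath

end Path

section Fundamental

variable {R K : Type*} [CommRing R] [CommRing K]

/-- A unit `p` such that `1 - p` is zero or a unit. Up to units, these are the numbers `1 - p` that
occur as `2 × 2` minors of matrices with unit minors. -/
def IsFundamental (p : Rˣ) : Prop := IsZeroOrUnit (1 - (p : R))

theorem isFundamental_iff {a b c d : Rˣ} :
    IsFundamental (b * c * a⁻¹ * d⁻¹) ↔ IsZeroOrUnit (a * d - b * c : R) := by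
  have hminor : (a * d - b * c : R) = ((a * d : Rˣ) : R) * (1 - (b * c * a⁻¹ * d⁻¹ : Rˣ)) := by
    have ha : (a : R) * (a⁻¹ : Rˣ) = 1 := a.mul_inv
    have hd : (d : R) * (d⁻¹ : Rˣ) = 1 := d.mul_inv
    push_cast
    linear_combination (b * c : R) * ha + (a * (a⁻¹ : Rˣ) * b * c : R) * hd
  rw [hminor]
  exact ⟨(IsZeroOrUnit.of_isUnit (Units.isUnit _)).mul,
    IsZeroOrUnit.of_isUnit_mul (Units.isUnit _)⟩

theorem IsFundamental.inv {p : Rˣ} (h : IsFundamental p) : IsFundamental p⁻¹ := by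
  have hp : IsZeroOrUnit ((p : R) * (1 : Rˣ) - (1 : Rˣ) * (1 : Rˣ)) := by
    simpa using IsZeroOrUnit.neg h
  simpa using isFundamental_iff.2 hp

theorem IsFundamental.map {p : Rˣ} (h : IsFundamental p) (φ : R →+* K) :
    IsFundamental (Units.map (φ : R →* K) p) := by
  simpa [IsFundamental] using IsZeroOrUnit.map h φ

/-- `φ` is injective on the fundamental elements of `R`. -/
def InjOnFundamental (φ : R →+* K) : Prop :=
  ∀ p q : Rˣ, IsFundamental p → IsFundamental q →
    Units.map (φ : R →* K) p = Units.map (φ : R →* K) q → p = q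

end Fundamental

section Unique

variable {R K : Type*} [CommRing R] [CommRing K] {m n : Type*}

/-- `L₁` and `L₂` are lifts with unit minors of one matrix along `φ`, and they agree on the rows
in `s`. -/
structure LiftsAgreeOn (φ : R →+* K) (s : Set m) (L₁ L₂ : Matrix m n R) : Prop where
  left : HasUnitMinors L₁
  right : HasUnitMinors L₂
  map_eq : L₁.map φ = L₂.map φ
  apply_eq : ∀ i ∈ s, ∀ j, L₁ i j = L₂ i j

namespace LiftsAgreeOn

variable {φ : R →+* K} {s : Set m} {L₁ L₂ : Matrix m n R} {x : m} {u v : n}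

theorem map_apply_eq (h : LiftsAgreeOn φ s L₁ L₂) (i : m) (j : n) : φ (L₁ i j) = φ (L₂ i j) :=
  congrFun (congrFun h.map_eq i) j

theorem pivot [Finite m] [DecidableEq m] [DecidableEq n] (h : LiftsAgreeOn φ s L₁ L₂) {i : m}
    (hi : i ∈ s) {j : n} (hij : L₁ i j ≠ 0) :
    LiftsAgreeOn φ s (pivot L₁ i j) (pivot L₂ i j) := by
  have h₁ : IsUnit (L₁ i j) := (h.left.isZeroOrUnit_apply i j).isUnit hij
  have h₂ : IsUnit (L₂ i j) := h.apply_eq i hi j ▸ h₁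
  refine ⟨h.left.pivot h₁, h.right.pivot h₂, ?_, fun i' hi' j' => ?_⟩
  · rw [pivot_map φ h₁, pivot_map φ h₂, h.map_eq]
  · simp only [UnitMinors.pivot, Matrix.of_apply, h.apply_eq i hi, h.apply_eq i' hi']

variable [Nontrivial K]

theorem apply_eq_zero_iff (h : LiftsAgreeOn φ s L₁ L₂) (i : m) (j : n) :
    L₁ i j = 0 ↔ L₂ i j = 0 := by
  rw [← (h.left.isZeroOrUnit_apply i j).map_eq_zero_iff φ,
    ← (h.right.isZeroOrUnit_apply i j).map_eq_zero_iff φ, h.map_apply_eq]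

theorem isInducedPath_right (h : LiftsAgreeOn φ s L₁ L₂) {l : ℕ} {r : ℕ → m} {c : ℕ → n}
    (hp : IsInducedPath L₁ s u v l r c) : IsInducedPath L₂ s u v l r c where
  left := hp.left
  right := hp.right
  mem := hp.mem
  ne_fst i hi := mt (h.apply_eq_zero_iff _ _).2 (hp.ne_fst i hi)
  ne_snd i hi := mt (h.apply_eq_zero_iff _ _).2 (hp.ne_snd i hi)
  eq_zero i hi j hj hji hji' := (h.apply_eq_zero_iff _ _).1 (hp.eq_zero i hi j hj hji hji')

theorem exists_units (h : LiftsAgreeOn φ s L₁ L₂) (hu : L₁ x u ≠ 0) :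
    ∃ p₁ p₂ : Rˣ, L₁ x u = p₁ ∧ L₂ x u = p₂ ∧
      Units.map (φ : R →* K) p₁ = Units.map (φ : R →* K) p₂ := by
  obtain ⟨p₁, hp₁⟩ := (h.left.isZeroOrUnit_apply x u).isUnit hu
  obtain ⟨p₂, hp₂⟩ := (h.right.isZeroOrUnit_apply x u).isUnit
    (mt (h.apply_eq_zero_iff x u).2 hu)
  exact ⟨p₁, p₂, hp₁.symm, hp₂.symm,
    Units.ext (by simpa [hp₁, hp₂] using h.map_apply_eq x u)⟩

theorem exists_unit_mul_eq (h : LiftsAgreeOn φ s L₁ L₂) (x : m) (u : n) :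
    ∃ a : Rˣ, Units.map (φ : R →* K) a = 1 ∧ L₂ x u = a * L₁ x u := by
  by_cases hu : L₁ x u = 0
  · exact ⟨1, map_one _, by rw [hu, (h.apply_eq_zero_iff x u).1 hu, mul_zero]⟩
  · obtain ⟨p₁, p₂, hp₁, hp₂, hp⟩ := h.exists_units hu
    exact ⟨p₂ * p₁⁻¹, by rw [map_mul, map_inv, hp, mul_inv_cancel],
      by rw [hp₁, hp₂, Units.val_mul, Units.inv_mul_cancel_right]⟩

/-- The cross-ratios of the two lifts in the rows `i` and `x` and the columns `u` and `v` are
fundamental and have the same image, so they are equal. -/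
theorem ratio_eq_of_row (hφ : InjOnFundamental φ) (h : LiftsAgreeOn φ s L₁ L₂)
    (hu : L₁ x u ≠ 0) (hv : L₁ x v ≠ 0) {i : m} (hi : i ∈ s) (hiu : L₁ i u ≠ 0)
    (hiv : L₁ i v ≠ 0) : L₂ x u * L₁ x v = L₂ x v * L₁ x u := by
  obtain ⟨a, ha⟩ := (h.left.isZeroOrUnit_apply i u).isUnit hiu
  obtain ⟨b, hb⟩ := (h.left.isZeroOrUnit_apply i v).isUnit hiv
  obtain ⟨p₁, p₂, hp₁, hp₂, hp⟩ := h.exists_units hu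
  obtain ⟨q₁, q₂, hq₁, hq₂, hq⟩ := h.exists_units hv
  have fund₁ : IsFundamental (b * p₁ * a⁻¹ * q₁⁻¹) := isFundamental_iff.2 (by
    rw [ha, hb, ← hp₁, ← hq₁]
    exact h.left.isZeroOrUnit_mul_sub_mul i x u v)
  have fund₂ : IsFundamental (b * p₂ * a⁻¹ * q₂⁻¹) := isFundamental_iff.2 (by
    rw [ha, hb, ← hp₂, ← hq₂, h.apply_eq i hi, h.apply_eq i hi]
    exact h.right.isZeroOrUnit_mul_sub_mul i x u v)
  have crossRatio_eq : b * p₁ * a⁻¹ * q₁⁻¹ = b * p₂ * a⁻¹ * q₂⁻¹ :=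
    hφ _ _ fund₁ fund₂ (by simp only [map_mul, map_inv, hp, hq])
  have ratio_eq : p₂ * q₁ = q₂ * p₁ := by
    rw [mul_right_comm b p₁, mul_right_comm b p₂, mul_assoc _ p₁, mul_assoc _ p₂,
      mul_right_inj, ← div_eq_mul_inv, ← div_eq_mul_inv, div_eq_div_iff_mul_eq_mul] at crossRatio_eq
    rw [← crossRatio_eq, mul_comm]
  rw [hp₁, hp₂, hq₁, hq₂, ← Units.val_mul, ratio_eq, Units.val_mul]

variable [Finite m]

theorem ratio_eq_of_isInducedPath_two (hφ : InjOnFundamental φ) (h : LiftsAgreeOn φ s L₁ L₂)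
    (hx : x ∉ s) (hu : L₁ x u ≠ 0) (hv : L₁ x v ≠ 0) {r : ℕ → m} {c : ℕ → n}
    (hp : IsInducedPath L₁ s u v 2 r c) : L₂ x u * L₁ x v = L₂ x v * L₁ x u := by
  classical
  by_cases hc : L₁ x (c 1) = 0
  · have hxr : x ≠ r 0 := fun e => hx (e ▸ hp.mem 0 two_pos)
    have huc : u ≠ c 1 := fun e => hu (e ▸ hc)
    have hvc : v ≠ c 1 := fun e => hv (e ▸ hc)
    have hc₂ : L₂ x (c 1) = 0 := (h.apply_eq_zero_iff _ _).1 hc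
    have hpiv := hp.pivot_zero_one_apply_ne_zero fun i _ => h.left.isZeroOrUnit_apply i
    have hratio := (h.pivot (hp.mem 0 two_pos) (hp.ne_snd 0 two_pos)).ratio_eq_of_row hφ
      (x := x) (u := u) (v := v) (by rwa [pivot_apply_of_col_eq_zero hxr huc hc])
      (by rwa [pivot_apply_of_col_eq_zero hxr hvc hc]) (hp.mem 1 one_lt_two) hpiv.1 hpiv.2
    rwa [pivot_apply_of_col_eq_zero hxr huc hc, pivot_apply_of_col_eq_zero hxr hvc hc,
      pivot_apply_of_col_eq_zero hxr huc hc₂, pivot_apply_of_col_eq_zero hxr hvc hc₂] at hratio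
  · have hratio_left := h.ratio_eq_of_row hφ hu hc (hp.mem 0 two_pos)
      (hp.left ▸ hp.ne_fst 0 two_pos) (hp.ne_snd 0 two_pos)
    have hratio_right := h.ratio_eq_of_row hφ hc hv (hp.mem 1 one_lt_two)
      (hp.ne_fst 1 one_lt_two) (hp.right ▸ hp.ne_snd 1 one_lt_two)
    refine ((h.left.isZeroOrUnit_apply x (c 1)).isUnit hc).mul_left_cancel ?_
    linear_combination L₁ x v * hratio_left + L₁ x u * hratio_right

theorem ratio_eq_of_isInducedPath (hφ : InjOnFundamental φ) (h : LiftsAgreeOn φ s L₁ L₂)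
    (hx : x ∉ s) (hu : L₁ x u ≠ 0) (hv : L₁ x v ≠ 0) {l : ℕ} {r : ℕ → m} {c : ℕ → n}
    (hp : IsInducedPath L₁ s u v l r c) : L₂ x u * L₁ x v = L₂ x v * L₁ x u := by
  classical
  induction l generalizing L₁ L₂ r c with
  | zero => rw [← hp.left, hp.right, mul_comm]
  | succ l ih =>
  obtain _ | _ | l := l
  · exact h.ratio_eq_of_row hφ hu hv (hp.mem 0 one_pos) (hp.left ▸ hp.ne_fst 0 one_pos)
      (hp.right ▸ hp.ne_snd 0 one_pos)
  · exact h.ratio_eq_of_isInducedPath_two hφ hx hu hv hp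
  · have hxr : x ≠ r 1 := fun e => hx (e ▸ hp.mem 1 (by omega))
    have hp₂ := h.isInducedPath_right hp
    have hratio := ih (h.pivot (hp.mem 1 (by omega)) (hp.ne_fst 1 (by omega)))
      (by rwa [hp.pivot_one_apply_left hxr]) (by rwa [hp.pivot_one_apply_right hxr])
      (hp.pivot_shorten fun i _ => h.left.isZeroOrUnit_apply i)
    rwa [hp.pivot_one_apply_left hxr, hp.pivot_one_apply_right hxr,
      hp₂.pivot_one_apply_left hxr, hp₂.pivot_one_apply_right hxr] at hratio

theorem exists_component_scaling (hφ : InjOnFundamental φ) (h : LiftsAgreeOn φ s L₁ L₂)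
    (hx : x ∉ s) (C : (columnGraph L₁ s).ConnectedComponent) :
    ∃ a : Rˣ, Units.map (φ : R →* K) a = 1 ∧
      ∀ u, (columnGraph L₁ s).connectedComponentMk u = C → L₂ x u = a * L₁ x u := by
  classical
  have hm : Nonempty m := ⟨x⟩
  by_cases hC : ∃ w, (columnGraph L₁ s).connectedComponentMk w = C ∧ L₁ x w ≠ 0
  · obtain ⟨w, rfl, hw⟩ := hC
    obtain ⟨a, ha, haw⟩ := h.exists_unit_mul_eq x w
    refine ⟨a, ha, fun u huw => ?_⟩
    by_cases hu : L₁ x u = 0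
    · rw [hu, (h.apply_eq_zero_iff x u).1 hu, mul_zero]
    obtain ⟨l, r, c, hp⟩ := exists_isInducedPath (SimpleGraph.ConnectedComponent.eq.1 huw)
    refine ((h.left.isZeroOrUnit_apply x w).isUnit hw).mul_right_cancel ?_
    rw [h.ratio_eq_of_isInducedPath hφ hx hu hw hp, haw, mul_right_comm]
  · refine ⟨1, map_one _, fun u hu => ?_⟩
    have hxu : L₁ x u = 0 := not_not.1 fun hne => hC ⟨u, hu, hne⟩
    rw [hxu, (h.apply_eq_zero_iff x u).1 hxu, mul_zero]

theorem exists_scaling_insert (hφ : InjOnFundamental φ) (h : LiftsAgreeOn φ s L₁ L₂)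
    (hx : x ∉ s) : ∃ (d : m → Rˣ) (e : n → Rˣ), (∀ i, Units.map (φ : R →* K) (d i) = 1) ∧
      (∀ j, Units.map (φ : R →* K) (e j) = 1) ∧
      ∀ i ∈ insert x s, ∀ j, L₂ i j = d i * L₁ i j * e j := by
  choose a ha hax using fun C => h.exists_component_scaling hφ hx C
  let e : n → Rˣ := fun j => a ((columnGraph L₁ s).connectedComponentMk j)
  have exists_row_factor : ∀ i, ∃ d : Rˣ, Units.map (φ : R →* K) d = 1 ∧
      (i ∈ insert x s → ∀ j, L₂ i j = d * L₁ i j * e j) := fun i => by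
    by_cases hi : i ∈ s ∧ ∃ j, L₁ i j ≠ 0
    · obtain ⟨hi, j, hj⟩ := hi
      refine ⟨(e j)⁻¹, by rw [map_inv, ha, inv_one], fun _ j' => ?_⟩
      rw [← h.apply_eq i hi]
      by_cases hj' : L₁ i j' = 0
      · rw [hj', mul_zero, zero_mul]
      · obtain ⟨q, -⟩ := exists_walk_columnGraph hi hj hj'
        have hee : e j = e j' := congrArg a (SimpleGraph.ConnectedComponent.eq.2 ⟨q⟩)
        rw [hee, mul_right_comm, Units.inv_mul, one_mul]
    · refine ⟨1, map_one _, fun hmem j => ?_⟩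
      rw [Units.val_one, one_mul]
      rcases Set.mem_insert_iff.1 hmem with rfl | his
      · rw [hax _ j rfl, mul_comm]
      · have hij : L₁ i j = 0 := not_not.1 fun hne => hi ⟨his, j, hne⟩
        rw [← h.apply_eq i his, hij, zero_mul]
  choose d hd hdx using exists_row_factor
  exact ⟨d, e, hd, fun j => ha _, fun i hi => hdx i hi⟩

theorem exists_scaling (hφ : InjOnFundamental φ) (h : LiftsAgreeOn φ ∅ L₁ L₂) :
    ∃ (d : m → Rˣ) (e : n → Rˣ), (∀ i, Units.map (φ : R →* K) (d i) = 1) ∧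
      (∀ j, Units.map (φ : R →* K) (e j) = 1) ∧ ∀ i j, L₂ i j = d i * L₁ i j * e j := by
  suffices H : ∀ s : Set m, s.Finite → ∃ (d : m → Rˣ) (e : n → Rˣ),
      (∀ i, Units.map (φ : R →* K) (d i) = 1) ∧ (∀ j, Units.map (φ : R →* K) (e j) = 1) ∧
      ∀ i ∈ s, ∀ j, L₂ i j = d i * L₁ i j * e j by
    simpa using H Set.univ Set.finite_univ
  intro s hs
  induction s, hs using Set.Finite.induction_on with
  | empty => exact ⟨1, 1, fun _ => map_one _, fun _ => map_one _, fun _ hi => absurd hi (by simp)⟩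
  | insert hx _ ih =>
  obtain ⟨d, e, hd, he, hde⟩ := ih
  have map_val : ∀ {a : Rˣ}, Units.map (φ : R →* K) a = 1 → φ a = 1 := fun ha =>
    congrArg Units.val ha
  have hscaled : LiftsAgreeOn φ _ (Matrix.of fun i j => (d i : R) * L₁ i j * (e j : R)) L₂ :=
    { left := h.left.scale d e
      right := h.right
      map_eq := by
        rw [← h.map_eq]
        ext i j
        simp [map_val (hd i), map_val (he j)]
      apply_eq := fun i hi j => (hde i hi j).symm }
  obtain ⟨d', e', hd', he', hde'⟩ := hscaled.exists_scaling_insert hφ hx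
  refine ⟨d' * d, e * e', fun i => ?_, fun j => ?_, fun i hi j => ?_⟩
  · rw [Pi.mul_apply, map_mul, hd, hd', one_mul]
  · rw [Pi.mul_apply, map_mul, he, he', one_mul]
  · rw [hde' i hi j]
    simp only [Matrix.of_apply, Pi.mul_apply, Units.val_mul, mul_assoc]

end LiftsAgreeOn

end Unique

section Lifting

variable {R K : Type*} [CommRing R] [CommRing K]

/-- The conditions on a ring homomorphism `φ : R → K` under which matrices with unit minors can be
lifted along `φ`. -/
structure IsLifting (φ : R →+* K) : Prop where
  inj : InjOnFundamental φ
  exists_unit : ∀ a : Kˣ, ∃ b : Rˣ, Units.map (φ : R →* K) b = a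
  exists_isFundamental : ∀ p : Kˣ, IsFundamental p →
    ∃ q : Rˣ, IsFundamental q ∧ Units.map (φ : R →* K) q = p
  mul : ∀ p q : Kˣ, IsFundamental p → IsFundamental q → IsFundamental (p * q) →
    p = 1 ∨ q = 1 ∨ p * q = 1
  neg : ∀ p : Kˣ, IsFundamental p → IsFundamental (-p) → p = 1 ∨ p = -1
  two : IsZeroOrUnit (2 : R)

variable {φ : R →+* K}

theorem isFundamental_one : IsFundamental (1 : Rˣ) := Or.inl (by rw [Units.val_one, sub_self])

namespace IsLifting

theorem isFundamental_mul (hφ : IsLifting φ) {p q : Rˣ} (hp : IsFundamental p)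
    (hq : IsFundamental q) (h : IsFundamental (Units.map (φ : R →* K) (p * q))) :
    IsFundamental (p * q) := by
  rw [map_mul] at h
  rcases hφ.mul _ _ (hp.map φ) (hq.map φ) h with h | h | h
  · rwa [hφ.inj p 1 hp isFundamental_one (by rw [h, map_one]), one_mul]
  · rwa [hφ.inj q 1 hq isFundamental_one (by rw [h, map_one]), mul_one]
  · rw [hφ.inj p q⁻¹ hp hq.inv (by rw [map_inv]; exact eq_inv_of_mul_eq_one_left h),
      inv_mul_cancel]
    exact isFundamental_one

theorem isFundamental_of_neg (hφ : IsLifting φ) {p : Rˣ} (hp : IsFundamental (-p))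
    (h : IsFundamental (Units.map (φ : R →* K) p)) : IsFundamental p := by
  have map_neg_unit : ∀ p : Rˣ, Units.map (φ : R →* K) (-p) = -Units.map (φ : R →* K) p :=
    fun p => Units.ext (by simp)
  have hneg : IsFundamental (-1 : Rˣ) := by
    rw [IsFundamental, Units.val_neg, Units.val_one, sub_neg_eq_add, one_add_one_eq_two]
    exact hφ.two
  rcases hφ.neg _ h (map_neg_unit p ▸ hp.map φ) with h | h
  · rw [neg_inj.1 (hφ.inj (-p) (-1) hp hneg (by rw [map_neg_unit, map_neg_unit, h, map_one]))]
    exact isFundamental_one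
  · have hp1 := hφ.inj (-p) 1 hp isFundamental_one (by rw [map_neg_unit, h, map_one, neg_neg])
    rwa [neg_eq_iff_eq_neg.1 hp1]

/-- The cross-ratio of the rows `(a, b)` and `(e, f)` is the product of the cross-ratios of
`(a, b)` and `(c, d)` and of `(c, d)` and `(e, f)`. -/
theorem isZeroOrUnit_of_chain (hφ : IsLifting φ) {a b c d e f : R} (ha : IsUnit a) (hb : IsUnit b)
    (hc : IsUnit c) (hd : IsUnit d) (he : IsUnit e) (hf : IsUnit f)
    (h₁ : IsZeroOrUnit (a * d - b * c)) (h₂ : IsZeroOrUnit (c * f - d * e))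
    (h : IsZeroOrUnit (φ (a * f - b * e))) : IsZeroOrUnit (a * f - b * e) := by
  lift a to Rˣ using ha
  lift b to Rˣ using hb
  lift c to Rˣ using hc
  lift d to Rˣ using hd
  lift e to Rˣ using he
  lift f to Rˣ using hf
  have hmap : IsFundamental (Units.map (φ : R →* K) (b * e * a⁻¹ * f⁻¹)) := by
    simp only [map_mul, map_inv]
    rw [isFundamental_iff]
    simpa using h
  have hmul : b * c * a⁻¹ * d⁻¹ * (d * e * c⁻¹ * f⁻¹) = b * e * a⁻¹ * f⁻¹ :=
    Additive.ofMul.injective (by simp only [ofMul_mul, ofMul_inv]; abel)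
  rw [← isFundamental_iff] at h₁ h₂ ⊢
  rw [← hmul] at hmap ⊢
  exact hφ.isFundamental_mul h₁ h₂ hmap

theorem isZeroOrUnit_sub_of_add (hφ : IsLifting φ) {a b c d : R} (ha : IsUnit a) (hb : IsUnit b)
    (hc : IsUnit c) (hd : IsUnit d) (hadd : IsZeroOrUnit (a * d + b * c))
    (h : IsZeroOrUnit (φ (a * d - b * c))) : IsZeroOrUnit (a * d - b * c) := by
  lift a to Rˣ using ha
  lift b to Rˣ using hb
  lift c to Rˣ using hc
  lift d to Rˣ using hd
  have hmap : IsFundamental (Units.map (φ : R →* K) (b * c * a⁻¹ * d⁻¹)) := by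
    simp only [map_mul, map_inv]
    rw [isFundamental_iff]
    simpa using h
  have hneg : IsFundamental (-(b * c * a⁻¹ * d⁻¹)) := by
    rw [← neg_mul, ← neg_mul, ← neg_mul, isFundamental_iff, Units.val_neg, neg_mul,
      sub_neg_eq_add]
    exact hadd
  exact isFundamental_iff.1 (hφ.isFundamental_of_neg hneg hmap)

end IsLifting

end Lifting

section Crossing

variable {R : Type*} [CommRing R] {m n : Type*} {A : Matrix m n R} {S : Set n}

theorem not_crosses_iff {i : m} :
    ¬Crosses A i S ↔ (∀ j ∈ S, A i j = 0) ∨ ∀ j ∈ Sᶜ, A i j = 0 := by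
  simp only [Crosses, not_and_or, not_exists, not_not, Set.mem_compl_iff, imp_iff_not_or]

theorem crosses_compl {i : m} : Crosses A i Sᶜ ↔ Crosses A i S := by
  rw [← not_iff_not, not_crosses_iff, not_crosses_iff, compl_compl, or_comm]

/-- A condition on two rows `x` and `y` under which lifts of `A` without `x` and of `A` without `y`
can be glued: either no set of columns crossed by both is uncrossed by the other rows, or `A` is a
direct sum with `x` and `y` in different summands. -/
def IsRemovablePair (A : Matrix m n R) (x y : m) : Prop :=
  (∀ S : Set n, (∀ i, i ≠ x → i ≠ y → ¬Crosses A i S) → Crosses A x S → ¬Crosses A y S) ∨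
    ∃ S : Set n, (∀ i, ¬Crosses A i S) ∧ (∀ j ∈ Sᶜ, A x j = 0) ∧ ∀ j ∈ S, A y j = 0

theorem IsRemovablePair.congr {K : Type*} [CommRing K] {B : Matrix m n K}
    (h : ∀ i j, A i j = 0 ↔ B i j = 0) {x y : m} (hA : IsRemovablePair A x y) :
    IsRemovablePair B x y := by
  simpa only [IsRemovablePair, Crosses, ne_eq, h] using hA

variable [Nontrivial R] [DecidableEq m] [DecidableEq n] {r : m} {c : n}

theorem pivot_apply_eq_zero_of_not_crosses (h : IsUnit (A r c)) (hr : ¬Crosses A r S) {i : m}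
    (hi : ∀ j ∈ S, A i j = 0) : ∀ j ∈ S, pivot A r c i j = 0 := by
  intro j hj
  by_cases hc : c ∈ S
  · have hic : A i c = 0 := hi c hc
    have hir : i ≠ r := fun e => h.ne_zero (e ▸ hic)
    by_cases hjc : j = c
    · rw [hjc, pivot_apply_col _ hir, hic, mul_zero, neg_zero]
    · rw [pivot_apply_of_col_eq_zero hir hjc hic, hi j hj]
  · have hjc : j ≠ c := fun e => hc (e ▸ hj)
    have hrj : A r j = 0 := not_not.1 fun hne => hr ⟨⟨j, hj, hne⟩, c, hc, h.ne_zero⟩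
    by_cases hir : i = r
    · rw [hir, pivot_apply_row _ hjc, hrj, mul_zero]
    · rw [pivot_apply_of_row_eq_zero hir hjc hrj, hi j hj]

theorem Crosses.of_pivot (h : IsUnit (A r c)) (hr : ¬Crosses A r S) {i : m}
    (hi : Crosses (pivot A r c) i S) : Crosses A i S := by
  contrapose hi
  rw [not_crosses_iff] at hi ⊢
  exact hi.imp (pivot_apply_eq_zero_of_not_crosses h hr)
    (pivot_apply_eq_zero_of_not_crosses h (crosses_compl.not.2 hr))

theorem crosses_pivot_self (h : IsUnit (A r c)) : Crosses (pivot A r c) r S ↔ Crosses A r S := by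
  have zero_iff : ∀ j, pivot A r c r j = 0 ↔ A r j = 0 := fun j => by
    by_cases hj : j = c
    · subst hj
      exact iff_of_false (isUnit_pivot_self h).ne_zero h.ne_zero
    · rw [pivot_apply_row _ hj, h.ringInverse.mul_right_eq_zero]
  simp only [Crosses, ne_eq, zero_iff]

theorem crosses_pivot (h : IsUnit (A r c)) (hr : ¬Crosses A r S) {i : m} :
    Crosses (pivot A r c) i S ↔ Crosses A i S := by
  refine ⟨Crosses.of_pivot h hr, fun hi => ?_⟩
  rw [← pivot_pivot h] at hi
  exact hi.of_pivot (isUnit_pivot_self h) ((crosses_pivot_self h).not.2 hr)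

theorem IsRemovablePair.pivot {x y : m} (hA : IsRemovablePair A x y) (h : IsUnit (A r c))
    (hx : r ≠ x) (hy : r ≠ y) : IsRemovablePair (pivot A r c) x y := by
  rcases hA with hA | ⟨S, hS, hxS, hyS⟩
  · refine Or.inl fun S hS hxS hyS => ?_
    have hr : ¬Crosses A r S := (crosses_pivot_self h).not.1 (hS r hx hy)
    exact hA S (fun i hix hiy => (crosses_pivot h hr).not.1 (hS i hix hiy)) (hxS.of_pivot h hr)
      (hyS.of_pivot h hr)
  · exact Or.inr ⟨S, fun i => (crosses_pivot h (hS r)).not.2 (hS i),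
      pivot_apply_eq_zero_of_not_crosses h (crosses_compl.not.2 (hS r)) hxS,
      pivot_apply_eq_zero_of_not_crosses h (hS r) hyS⟩

end Crossing

section Glue

variable {R K : Type*} [CommRing R] [CommRing K] {m n : Type*}

/-- The rows of `L` other than `x`. -/
abbrev rowsOff {α : Type*} (L : Matrix m n α) (x : m) : Matrix {i // i ≠ x} n α :=
  L.submatrix (↑) id

theorem exists_rowsOff_eq {α : Type*} {x y : m} (hxy : x ≠ y)
    {L₁ : Matrix {i // i ≠ x} n α} {L₂ : Matrix {i // i ≠ y} n α}
    (h : ∀ i (hx : i ≠ x) (hy : i ≠ y) j, L₁ ⟨i, hx⟩ j = L₂ ⟨i, hy⟩ j) :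
    ∃ L : Matrix m n α, rowsOff L x = L₁ ∧ rowsOff L y = L₂ := by
  classical
  refine ⟨Matrix.of fun i j => if hi : i = x then L₂ ⟨i, hi ▸ hxy⟩ j else L₁ ⟨i, hi⟩ j, ?_, ?_⟩
  · ext ⟨i, hi⟩ j
    simp [hi]
  · ext ⟨i, hi⟩ j
    by_cases hix : i = x
    · simp [hix]
    · simp [hix, h i hix hi j]

/-- `L` lifts a matrix with unit minors along `φ`, and the minors of `L` that avoid one of the rows
`x` and `y` are zero or units. -/
structure IsPartialLift (φ : R →+* K) (L : Matrix m n R) (x y : m) : Prop where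
  ne : x ≠ y
  off_left : HasUnitMinors (rowsOff L x)
  off_right : HasUnitMinors (rowsOff L y)
  map : HasUnitMinors (L.map φ)

theorem isZeroOrUnit_det_of_rows_mem_pair {A : Matrix m n R} (hA : ∀ i j, IsZeroOrUnit (A i j))
    {x y : m} (hxy : ∀ u v, IsZeroOrUnit (A x u * A y v - A x v * A y u)) {k : ℕ} {f : Fin k → m}
    (hf : ∀ i, f i = x ∨ f i = y) (g : Fin k → n) : IsZeroOrUnit (A.submatrix f g).det := by
  classical
  by_cases hinj : Function.Injective f
  swap
  · exact Or.inl (det_submatrix_eq_zero_of_not_injective hinj g)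
  have hcard : k ≤ 2 := by
    have hle := Finset.card_le_card_of_injOn (s := Finset.univ) (t := {x, y}) f
      (fun i _ => by simpa using hf i) hinj.injOn
    rw [Finset.card_fin] at hle
    exact hle.trans Finset.card_le_two
  interval_cases k
  · rw [Matrix.det_fin_zero]
    exact IsZeroOrUnit.of_isUnit isUnit_one
  · rw [Matrix.det_fin_one]
    exact hA _ _
  · have hne : f 0 ≠ f 1 := hinj.ne zero_ne_one
    rw [Matrix.det_fin_two]
    simp only [Matrix.submatrix_apply]
    rcases hf 0 with h₀ | h₀ <;> rcases hf 1 with h₁ | h₁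
    · exact absurd (h₀.trans h₁.symm) hne
    · rw [h₀, h₁]
      exact hxy _ _
    · rw [h₀, h₁, ← neg_sub, mul_comm (A y _), mul_comm (A y _)]
      exact (hxy _ _).neg
    · exact absurd (h₀.trans h₁.symm) hne

namespace IsPartialLift

variable {φ : R →+* K} {L : Matrix m n R} {x y : m}

theorem symm (h : IsPartialLift φ L x y) : IsPartialLift φ L y x :=
  ⟨h.ne.symm, h.off_right, h.off_left, h.map⟩

theorem isZeroOrUnit_apply (h : IsPartialLift φ L x y) (i : m) (j : n) :
    IsZeroOrUnit (L i j) := by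
  by_cases hi : i = x
  · exact h.off_right.isZeroOrUnit_apply ⟨i, hi ▸ h.ne⟩ j
  · exact h.off_left.isZeroOrUnit_apply ⟨i, hi⟩ j

theorem isUnit_apply (h : IsPartialLift φ L x y) {i : m} {j : n} (hij : L i j ≠ 0) :
    IsUnit (L i j) :=
  (h.isZeroOrUnit_apply i j).isUnit hij

theorem isZeroOrUnit_map_mul_sub_mul (h : IsPartialLift φ L x y) (i i' : m) (j j' : n) :
    IsZeroOrUnit (φ (L i j * L i' j' - L i j' * L i' j)) := by
  simpa using h.map.isZeroOrUnit_mul_sub_mul i i' j j'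

theorem pivot [Finite m] [DecidableEq m] [DecidableEq n] (h : IsPartialLift φ L x y) {r : m} {c : n}
    (hr : r ∈ ({x, y} : Set m)ᶜ) (hrc : L r c ≠ 0) : IsPartialLift φ (pivot L r c) x y := by
  obtain ⟨hx, hy⟩ : r ≠ x ∧ r ≠ y := by simpa using hr
  have hu := h.isUnit_apply hrc
  have rowsOff_pivot : ∀ (z : m) (hz : r ≠ z), rowsOff (UnitMinors.pivot L r c) z =
      UnitMinors.pivot (rowsOff L z) ⟨r, hz⟩ c := fun z hz =>
    pivot_submatrix Subtype.val_injective Function.injective_id (⟨r, hz⟩ : {i // i ≠ z}) c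
  refine ⟨h.ne, ?_, ?_, ?_⟩
  · rw [rowsOff_pivot x hx]
    exact h.off_left.pivot hu
  · rw [rowsOff_pivot y hy]
    exact h.off_right.pivot hu
  · rw [pivot_map φ hu]
    exact h.map.pivot (hu.map φ)

variable {u v : n}

theorem isZeroOrUnit_minor_of_row (hφ : IsLifting φ) (h : IsPartialLift φ L x y) (hxu : L x u ≠ 0)
    (hxv : L x v ≠ 0) (hyu : L y u ≠ 0) (hyv : L y v ≠ 0) {i : m} (hi : i ∈ ({x, y} : Set m)ᶜ)
    (hiu : L i u ≠ 0) (hiv : L i v ≠ 0) : IsZeroOrUnit (L x u * L y v - L x v * L y u) := by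
  obtain ⟨hix, hiy⟩ : i ≠ x ∧ i ≠ y := by simpa using hi
  exact hφ.isZeroOrUnit_of_chain (h.isUnit_apply hxu) (h.isUnit_apply hxv) (h.isUnit_apply hiu)
    (h.isUnit_apply hiv) (h.isUnit_apply hyu) (h.isUnit_apply hyv)
    (h.off_right.isZeroOrUnit_mul_sub_mul ⟨x, h.ne⟩ ⟨i, hiy⟩ u v)
    (h.off_left.isZeroOrUnit_mul_sub_mul ⟨i, hix⟩ ⟨y, h.ne.symm⟩ u v)
    (h.isZeroOrUnit_map_mul_sub_mul x y u v)

theorem mul_eq_mul_of_pivot_apply_eq_zero [DecidableEq m] [DecidableEq n]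
    (h : IsPartialLift φ L x y) {i : m} {j k : n} (hi : i ∈ ({x, y} : Set m)ᶜ) (hij : L i j ≠ 0)
    (hkj : k ≠ j) (hpiv : UnitMinors.pivot L i j x k = 0) : L i j * L x k = L x j * L i k := by
  obtain ⟨hix, -⟩ : i ≠ x ∧ i ≠ y := by simpa using hi
  rw [pivot_apply_of_ne _ hix.symm hkj] at hpiv
  linear_combination L i j * hpiv + (L x j * L i k) *
    (Ring.mul_inverse_cancel _ (h.isUnit_apply hij))

variable [Finite m] {r : ℕ → m} {c : ℕ → n}

theorem isZeroOrUnit_minor_of_pivot_apply_ne_zero [DecidableEq m] [DecidableEq n] (hφ : IsLifting φ)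
    (h : IsPartialLift φ L x y) (hxu : L x u ≠ 0) (hxv : L x v ≠ 0) (hyu : L y u ≠ 0)
    (hyv : L y v ≠ 0) (hp : IsInducedPath L {x, y}ᶜ u v 2 r c) (hyc : L y (c 1) = 0)
    (hne : UnitMinors.pivot L (r 0) (c 1) x u ≠ 0) :
    IsZeroOrUnit (L x u * L y v - L x v * L y u) := by
  have hr := hp.mem 0 two_pos
  obtain ⟨hrx, hry⟩ : r 0 ≠ x ∧ r 0 ≠ y := by simpa using hr
  have huc : u ≠ c 1 := fun e => hyu (e ▸ hyc)
  have hvc : v ≠ c 1 := fun e => hyv (e ▸ hyc)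
  have hrv : L (r 0) v = 0 :=
    hp.right ▸ hp.eq_zero 0 two_pos 2 le_rfl (by omega) (by omega)
  have hpiv := h.pivot hr (hp.ne_snd 0 two_pos)
  have pivot_xv := pivot_apply_of_row_eq_zero hrx.symm hvc hrv
  have pivot_yu := pivot_apply_of_col_eq_zero hry.symm huc hyc
  have pivot_yv := pivot_apply_of_col_eq_zero hry.symm hvc hyc
  have row_ne := hp.pivot_zero_one_apply_ne_zero fun i _ => h.isZeroOrUnit_apply i
  have hminor := hpiv.isZeroOrUnit_minor_of_row hφ hne (by rwa [pivot_xv]) (by rwa [pivot_yu])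
    (by rwa [pivot_yv]) (hp.mem 1 one_lt_two) row_ne.1 row_ne.2
  rw [pivot_xv, pivot_yu, pivot_yv] at hminor
  refine hφ.isZeroOrUnit_of_chain (h.isUnit_apply hxu) (h.isUnit_apply hxv)
    (hpiv.isUnit_apply hne) (h.isUnit_apply hxv) (h.isUnit_apply hyu) (h.isUnit_apply hyv) ?_ hminor
    (h.isZeroOrUnit_map_mul_sub_mul x y u v)
  have hinv : IsUnit (Ring.inverse (L (r 0) (c 1))) :=
    (h.isUnit_apply (hp.ne_snd 0 two_pos)).ringInverse
  have hdiff : L x u * L x v - L x v * UnitMinors.pivot L (r 0) (c 1) x u =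
      L x v * (Ring.inverse (L (r 0) (c 1)) * L x (c 1) * L (r 0) u) := by
    rw [pivot_apply_of_ne _ hrx.symm huc]
    ring
  rw [hdiff]
  exact (h.isZeroOrUnit_apply _ _).mul (((IsZeroOrUnit.of_isUnit hinv).mul
    (h.isZeroOrUnit_apply _ _)).mul (h.isZeroOrUnit_apply _ _))

theorem isZeroOrUnit_minor_of_apply_mid_eq_zero (hφ : IsLifting φ) (h : IsPartialLift φ L x y)
    (hxu : L x u ≠ 0) (hxv : L x v ≠ 0) (hyu : L y u ≠ 0) (hyv : L y v ≠ 0)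
    (hp : IsInducedPath L {x, y}ᶜ u v 2 r c) (hyc : L y (c 1) = 0) :
    IsZeroOrUnit (L x u * L y v - L x v * L y u) := by
  classical
  have huc : u ≠ c 1 := fun e => hyu (e ▸ hyc)
  have hvc : v ≠ c 1 := fun e => hyv (e ▸ hyc)
  by_cases hpu : UnitMinors.pivot L (r 0) (c 1) x u = 0
  swap
  · exact isZeroOrUnit_minor_of_pivot_apply_ne_zero hφ h hxu hxv hyu hyv hp hyc hpu
  by_cases hpv : UnitMinors.pivot L (r 1) (c 1) x v = 0
  swap
  · rw [← neg_sub]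
    exact (isZeroOrUnit_minor_of_pivot_apply_ne_zero hφ h hxv hxu hyv hyu hp.reverse hyc hpv).neg
  have h₀ := hp.ne_snd 0 two_pos
  have h₁ := hp.ne_fst 1 one_lt_two
  have parallel_u := h.mul_eq_mul_of_pivot_apply_eq_zero (hp.mem 0 two_pos) h₀ huc hpu
  have parallel_v := h.mul_eq_mul_of_pivot_apply_eq_zero (hp.mem 1 one_lt_two) h₁ hvc
    hpv
  have hrv : L (r 0) v = 0 := hp.right ▸ hp.eq_zero 0 two_pos 2 le_rfl (by omega) (by omega)
  have hru : L (r 1) u = 0 :=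
    hp.left ▸ hp.eq_zero 1 one_lt_two 0 (by omega) (by omega) (by omega)
  have hdet : IsZeroOrUnit
      (L (r 0) u * L (r 1) (c 1) * L y v + L (r 0) (c 1) * L (r 1) v * L y u) := by
    obtain ⟨hx₀, -⟩ : r 0 ≠ x ∧ r 0 ≠ y := by simpa using hp.mem 0 two_pos
    obtain ⟨hx₁, -⟩ : r 1 ≠ x ∧ r 1 ≠ y := by simpa using hp.mem 1 one_lt_two
    have hminor := h.off_left 3 ![⟨r 0, hx₀⟩, ⟨r 1, hx₁⟩, ⟨y, h.ne.symm⟩] ![u, c 1, v]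
    rw [Matrix.det_fin_three] at hminor
    simpa [hrv, hru, hyc] using hminor
  refine hφ.isZeroOrUnit_sub_of_add (h.isUnit_apply hxu) (h.isUnit_apply hxv)
    (h.isUnit_apply hyu) (h.isUnit_apply hyv) ?_ (h.isZeroOrUnit_map_mul_sub_mul x y u v)
  refine IsZeroOrUnit.of_isUnit_mul ((h.isUnit_apply h₀).mul (h.isUnit_apply h₁)) ?_
  have hsum : L (r 0) (c 1) * L (r 1) (c 1) * (L x u * L y v + L x v * L y u) =
      L x (c 1) * (L (r 0) u * L (r 1) (c 1) * L y v + L (r 0) (c 1) * L (r 1) v * L y u) := by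
    linear_combination (L (r 1) (c 1) * L y v) * parallel_u + (L (r 0) (c 1) * L y u) * parallel_v
  rw [hsum]
  exact (h.isZeroOrUnit_apply _ _).mul hdet

theorem isZeroOrUnit_minor_of_isInducedPath_two (hφ : IsLifting φ) (h : IsPartialLift φ L x y)
    (hxu : L x u ≠ 0) (hxv : L x v ≠ 0) (hyu : L y u ≠ 0) (hyv : L y v ≠ 0)
    (hp : IsInducedPath L {x, y}ᶜ u v 2 r c) :
    IsZeroOrUnit (L x u * L y v - L x v * L y u) := by
  by_cases hyc : L y (c 1) = 0
  · exact isZeroOrUnit_minor_of_apply_mid_eq_zero hφ h hxu hxv hyu hyv hp hyc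
  by_cases hxc : L x (c 1) = 0
  · rw [← neg_sub, mul_comm (L x v), mul_comm (L x u)]
    exact (isZeroOrUnit_minor_of_apply_mid_eq_zero hφ h.symm hyu hyv hxu hxv
      (Set.pair_comm x y ▸ hp) hxc).neg
  have minor_left := isZeroOrUnit_minor_of_row hφ h hxu hxc hyu hyc (hp.mem 0 two_pos)
    (hp.left ▸ hp.ne_fst 0 two_pos) (hp.ne_snd 0 two_pos)
  have minor_right := isZeroOrUnit_minor_of_row hφ h hxc hxv hyc hyv (hp.mem 1 one_lt_two)
    (hp.ne_fst 1 one_lt_two) (hp.right ▸ hp.ne_snd 1 one_lt_two)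
  have hchain := hφ.isZeroOrUnit_of_chain (h.isUnit_apply hxu) (h.isUnit_apply hyu)
    (h.isUnit_apply hxc) (h.isUnit_apply hyc) (h.isUnit_apply hxv) (h.isUnit_apply hyv)
    (by rwa [mul_comm (L y u)]) (by rwa [mul_comm (L y (c 1))])
    (by rw [mul_comm (L y u)]; exact h.isZeroOrUnit_map_mul_sub_mul x y u v)
  rwa [mul_comm (L y u)] at hchain

theorem isZeroOrUnit_minor_of_isInducedPath (hφ : IsLifting φ) (h : IsPartialLift φ L x y)
    (hxu : L x u ≠ 0) (hxv : L x v ≠ 0) (hyu : L y u ≠ 0) (hyv : L y v ≠ 0) {l : ℕ}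
    (hp : IsInducedPath L {x, y}ᶜ u v l r c) :
    IsZeroOrUnit (L x u * L y v - L x v * L y u) := by
  classical
  induction l generalizing L r c with
  | zero =>
    rw [← hp.left, hp.right, sub_self]
    exact IsZeroOrUnit.zero
  | succ l ih =>
  obtain _ | _ | l := l
  · exact isZeroOrUnit_minor_of_row hφ h hxu hxv hyu hyv (hp.mem 0 one_pos)
      (hp.left ▸ hp.ne_fst 0 one_pos) (hp.right ▸ hp.ne_snd 0 one_pos)
  · exact isZeroOrUnit_minor_of_isInducedPath_two hφ h hxu hxv hyu hyv hp
  · have hr := hp.mem 1 (by omega)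
    obtain ⟨hrx, hry⟩ : r 1 ≠ x ∧ r 1 ≠ y := by simpa using hr
    have hminor := ih (h.pivot hr (hp.ne_fst 1 (by omega)))
      (by rwa [hp.pivot_one_apply_left hrx.symm]) (by rwa [hp.pivot_one_apply_right hrx.symm])
      (by rwa [hp.pivot_one_apply_left hry.symm]) (by rwa [hp.pivot_one_apply_right hry.symm])
      (hp.pivot_shorten fun i _ => h.isZeroOrUnit_apply i)
    rwa [hp.pivot_one_apply_left hrx.symm, hp.pivot_one_apply_right hrx.symm,
      hp.pivot_one_apply_left hry.symm, hp.pivot_one_apply_right hry.symm] at hminor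

theorem isZeroOrUnit_minor_of_isRemovablePair (hφ : IsLifting φ) (h : IsPartialLift φ L x y)
    (hxy : IsRemovablePair L x y) (u v : n) : IsZeroOrUnit (L x u * L y v - L x v * L y u) := by
  have hmul : ∀ i i' j j', IsZeroOrUnit (L i j * L i' j') := fun i i' j j' =>
    (h.isZeroOrUnit_apply i j).mul (h.isZeroOrUnit_apply i' j')
  by_cases hleft : L x u * L y v = 0
  · rw [hleft, zero_sub]
    exact (hmul _ _ _ _).neg
  by_cases hright : L x v * L y u = 0
  · rw [hright, sub_zero]
    exact hmul _ _ _ _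
  have hxu := left_ne_zero_of_mul hleft
  have hyv := right_ne_zero_of_mul hleft
  have hxv := left_ne_zero_of_mul hright
  have hyu := right_ne_zero_of_mul hright
  rcases hxy with hcross | ⟨S, -, hxS, hyS⟩
  · have : Nonempty m := ⟨x⟩
    have hreach : (columnGraph L {x, y}ᶜ).Reachable u v :=
      reachable_columnGraph_of_not_crosses fun S hS hu => not_not.1 fun hv =>
        hcross S (fun i hix hiy => hS i (by simp [hix, hiy])) ⟨⟨u, hu, hxu⟩, v, hv, hxv⟩
          ⟨⟨u, hu, hyu⟩, v, hv, hyv⟩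
    obtain ⟨l, r, c, hp⟩ := exists_isInducedPath hreach
    exact isZeroOrUnit_minor_of_isInducedPath hφ h hxu hxv hyu hyv hp
  · by_cases hu : u ∈ S
    · exact absurd (hyS u hu) hyu
    · exact absurd (hxS u hu) hxu

theorem hasUnitMinors [Nontrivial R] (hφ : IsLifting φ) (h : IsPartialLift φ L x y)
    (hxy : IsRemovablePair L x y) : HasUnitMinors L := by
  classical
  intro k
  induction k generalizing L with
  | zero => exact fun f g => by simp [IsZeroOrUnit]
  | succ k ih =>
  intro f g
  by_cases hf : Function.Injective f
  swap
  · exact Or.inl (det_submatrix_eq_zero_of_not_injective hf g)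
  by_cases hg : Function.Injective g
  swap
  · rw [← Matrix.det_transpose]
    exact Or.inl (det_submatrix_eq_zero_of_not_injective (A := L.transpose) hg f)
  by_cases hrows : ∀ t, f t = x ∨ f t = y
  · exact isZeroOrUnit_det_of_rows_mem_pair h.isZeroOrUnit_apply
      (h.isZeroOrUnit_minor_of_isRemovablePair hφ hxy) hrows g
  obtain ⟨t, ht⟩ := not_forall.1 hrows
  by_cases hzero : ∀ j, L (f t) (g j) = 0
  · exact Or.inl (Matrix.det_eq_zero_of_row_eq_zero t hzero)
  obtain ⟨j, hj⟩ := not_forall.1 hzero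
  have hu := h.isUnit_apply hj
  rw [det_submatrix_eq_mul_det_pivot hf hg t j hu]
  refine ((IsZeroOrUnit.of_isUnit (isUnit_one.neg.pow _)).mul (IsZeroOrUnit.of_isUnit hu)).mul ?_
  exact ih (h.pivot (by simpa using ht) hj) (hxy.pivot hu (fun e => ht (Or.inl e))
    fun e => ht (Or.inr e)) _ _

end IsPartialLift

/-- `A` has a lift along `φ` with unit minors. -/
def HasUnitLift (φ : R →+* K) (A : Matrix m n K) : Prop :=
  ∃ L : Matrix m n R, HasUnitMinors L ∧ L.map φ = A

variable [Nontrivial K] [Finite m] {φ : R →+* K}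

theorem exists_lifts_agreeing (hφ : InjOnFundamental φ) {A : Matrix m n K} {x y : m}
    (hx : HasUnitLift φ (rowsOff A x)) (hy : HasUnitLift φ (rowsOff A y)) :
    ∃ L₁ L₂, (HasUnitMinors L₁ ∧ L₁.map φ = rowsOff A x) ∧
      (HasUnitMinors L₂ ∧ L₂.map φ = rowsOff A y) ∧
      ∀ i (hx : i ≠ x) (hy : i ≠ y) j, L₁ ⟨i, hx⟩ j = L₂ ⟨i, hy⟩ j := by
  classical
  obtain ⟨L₁, h₁, e₁⟩ := hx
  obtain ⟨L₂, h₂, e₂⟩ := hy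
  let toOffLeft : {i // i ≠ x ∧ i ≠ y} → {i // i ≠ x} := fun i => ⟨i, i.2.1⟩
  let toOffRight : {i // i ≠ x ∧ i ≠ y} → {i // i ≠ y} := fun i => ⟨i, i.2.2⟩
  have hlifts : LiftsAgreeOn φ ∅ (L₁.submatrix toOffLeft id) (L₂.submatrix toOffRight id) :=
    { left := h₁.submatrix _ _
      right := h₂.submatrix _ _
      map_eq := by
        rw [← Matrix.submatrix_map, ← Matrix.submatrix_map, e₁, e₂]
        rfl
      apply_eq := fun i hi => absurd hi (Set.notMem_empty i) }
  obtain ⟨d, e, hd, he, hde⟩ := hlifts.exists_scaling hφ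
  let d' : {i // i ≠ x} → Rˣ := fun i => if hi : i.1 ≠ y then d ⟨i, i.2, hi⟩ else 1
  have hd' : ∀ i, Units.map (φ : R →* K) (d' i) = 1 := fun i => by
    unfold d'
    split_ifs
    exacts [hd _, map_one _]
  have map_val : ∀ {a : Rˣ}, Units.map (φ : R →* K) a = 1 → φ a = 1 := fun ha =>
    congrArg Units.val ha
  refine ⟨_, L₂, ⟨h₁.scale d' e, ?_⟩, ⟨h₂, e₂⟩, fun i hix hiy j => ?_⟩
  · rw [← e₁]
    ext i j
    simp [map_val (hd' i), map_val (he j)]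
  · have hij := hde ⟨i, hix, hiy⟩ j
    simp only [Matrix.submatrix_apply, id, toOffLeft, toOffRight] at hij
    simp [d', hiy, hij]

theorem hasUnitLift_of_isRemovablePair (hφ : IsLifting φ) {A : Matrix m n K}
    (hA : HasUnitMinors A) {x y : m} (hxy : x ≠ y) (hrem : IsRemovablePair A x y)
    (hx : HasUnitLift φ (rowsOff A x)) (hy : HasUnitLift φ (rowsOff A y)) : HasUnitLift φ A := by
  classical
  have := φ.domain_nontrivial
  obtain ⟨L₁, L₂, ⟨h₁, e₁⟩, ⟨h₂, e₂⟩, hagree⟩ := exists_lifts_agreeing hφ.inj hx hy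
  obtain ⟨L, rfl, rfl⟩ := exists_rowsOff_eq hxy hagree
  have hmap : L.map φ = A := by
    ext i j
    by_cases hi : i = x
    · exact congrFun (congrFun e₂ ⟨i, hi ▸ hxy⟩) j
    · exact congrFun (congrFun e₁ ⟨i, hi⟩) j
  have hL : IsPartialLift φ L x y := ⟨hxy, h₁, h₂, hmap.symm ▸ hA⟩
  refine ⟨L, hL.hasUnitMinors hφ (hrem.congr fun i j => ?_), hmap⟩
  rw [← (hL.isZeroOrUnit_apply i j).map_eq_zero_iff φ, ← hmap, Matrix.map_apply]

end Glue

section Leaves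

variable {V : Type*} {G : SimpleGraph V} {w : V} {f : V → V}

/-- The vertices of `X` can be deleted without disconnecting the component of `w`: a set that
contains `w` and is closed under adjacency off `X` contains all other vertices of the component. -/
def IsDeletable (G : SimpleGraph V) (w : V) (X : Set V) : Prop :=
  ∀ T : Set V, w ∈ T → (∀ u ∈ T, ∀ v ∉ X, G.Adj u v → v ∈ T) →
    ∀ v ∉ X, G.Reachable w v → v ∈ T

theorem IsDeletable.map_iso {W : Type*} {H : SimpleGraph W} (e : G ≃g H) {X : Set V}
    (h : IsDeletable G w X) : IsDeletable H (e w) (e '' X) := by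
  intro T hw hT v hv hreach
  have hmem : e.symm v ∈ e ⁻¹' T := by
    refine h (e ⁻¹' T) hw (fun u hu v hv hadj => ?_) (e.symm v)
      (fun hX => hv ⟨_, hX, e.apply_symm_apply v⟩) ?_
    · refine hT _ hu _ (fun hX => hv ?_) (e.map_adj_iff.2 hadj)
      rwa [e.injective.mem_set_image] at hX
    · rw [← e.reachable_iff, e.apply_symm_apply]
      exact hreach
  rwa [Set.mem_preimage, e.apply_symm_apply] at hmem

/-- `f` sends each vertex of the component of `w` other than `w` to its parent in a breadth-first
spanning tree with root `w`. -/
def IsParentMap (G : SimpleGraph V) (w : V) (f : V → V) : Prop :=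
  ∀ v, G.Reachable w v → v ≠ w →
    G.Adj (f v) v ∧ G.Reachable w (f v) ∧ G.dist w v = G.dist w (f v) + 1

theorem exists_isParentMap (G : SimpleGraph V) (w : V) : ∃ f, IsParentMap G w f := by
  have exists_parent : ∀ v, ∃ u, G.Reachable w v → v ≠ w →
      G.Adj u v ∧ G.Reachable w u ∧ G.dist w v = G.dist w u + 1 := by
    intro v
    by_cases hv : G.Reachable w v ∧ v ≠ w
    swap
    · exact ⟨w, fun hreach hne => absurd ⟨hreach, hne⟩ hv⟩
    obtain ⟨p, hp⟩ := hv.1.exists_walk_length_eq_dist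
    have hnil : ¬p.Nil := fun h => hv.2 h.eq.symm
    have hadj := p.adj_penultimate hnil
    have hreach : G.Reachable w p.penultimate := ⟨p.dropLast⟩
    refine ⟨p.penultimate, fun _ _ => ⟨hadj, hreach, le_antisymm ?_ ?_⟩⟩
    · obtain ⟨q, hq⟩ := hreach.exists_walk_length_eq_dist
      simpa [hq] using SimpleGraph.dist_le (q.append hadj.toWalk)
    · have hle := SimpleGraph.dist_le p.dropLast
      have hlen := SimpleGraph.Walk.length_dropLast_add_one hnil
      omega
  choose f hf using exists_parent
  exact ⟨f, hf⟩

/-- The child of the root `w` above `v` in the tree with parent map `f`. -/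
noncomputable def topAncestor (G : SimpleGraph V) (w : V) (f : V → V) (v : V) : V :=
  f^[G.dist w v - 1] v

namespace IsParentMap

theorem topAncestor_parent (hf : IsParentMap G w f) {v : V} (hv : G.Reachable w v) (hvw : v ≠ w)
    (hne : f v ≠ w) : topAncestor G w f (f v) = topAncestor G w f v := by
  obtain ⟨-, hreach, hdist⟩ := hf v hv hvw
  obtain ⟨k, hk⟩ := Nat.exists_eq_succ_of_ne_zero
    (fun h => hne (hreach.dist_eq_zero_iff.1 h).symm : G.dist w (f v) ≠ 0)
  rw [topAncestor, topAncestor, hdist, hk, Nat.add_sub_cancel, Function.iterate_succ_apply]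
  rfl

theorem exists_leaf [Finite V] (hf : IsParentMap G w f) {a : V} (ha : G.Adj w a) :
    ∃ b, G.Reachable w b ∧ b ≠ w ∧ topAncestor G w f b = a ∧
      ∀ v, G.Reachable w v → v ≠ w → f v ≠ b := by
  have hdist : G.dist w a = 1 := SimpleGraph.dist_eq_one_iff_adj.2 ha
  obtain ⟨b, ⟨hb, hbw, hba⟩, hmax⟩ := Set.exists_max_image
    {v | G.Reachable w v ∧ v ≠ w ∧ topAncestor G w f v = a} (G.dist w) (Set.toFinite _)
    ⟨a, ha.reachable, ha.ne', by simp [topAncestor, hdist]⟩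
  refine ⟨b, hb, hbw, hba, ?_⟩
  rintro v hv hvw rfl
  have hle := hmax v ⟨hv, hvw, hf.topAncestor_parent hv hvw hbw ▸ hba⟩
  have hdist := (hf v hv hvw).2.2
  omega

theorem isDeletable (hf : IsParentMap G w f) {X : Set V}
    (hX : ∀ v, G.Reachable w v → v ≠ w → f v ∉ X) : IsDeletable G w X := by
  intro T hw hT v
  induction hd : G.dist w v using Nat.strong_induction_on generalizing v with
  | _ d ih =>
    intro hvX hv
    by_cases hvw : v = w
    · exact hvw ▸ hw
    obtain ⟨hadj, hreach, hdist⟩ := hf v hv hvw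
    exact hT _ (ih _ (by omega) (f v) rfl (hX v hv hvw) hreach) v hvX hadj

end IsParentMap

theorem exists_deletable_vertices [Finite V] {ι : Type*} {a : ι → V} (ha : Function.Injective a)
    (hadj : ∀ i, G.Adj w (a i)) :
    ∃ b : ι → V, Function.Injective b ∧ (∀ i, G.Reachable w (b i) ∧ b i ≠ w) ∧
      ∀ X ⊆ Set.range b, IsDeletable G w X := by
  obtain ⟨f, hf⟩ := exists_isParentMap G w
  choose b hreach hne htop hleaf using fun i => hf.exists_leaf (hadj i)
  refine ⟨b, fun i j hij => ha ?_, fun i => ⟨hreach i, hne i⟩, fun X hX => hf.isDeletable ?_⟩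
  · rw [← htop i, ← htop j, hij]
  · intro v hv hvw hvX
    obtain ⟨i, hi⟩ := hX hvX
    exact hleaf i v hv hvw hi.symm

end Leaves

section Reduction

variable {R : Type*} [CommRing R] {m n : Type*} {A : Matrix m n R}

/-- The bipartite graph on the rows and columns of `A` whose edges are the nonzero entries. -/
def entryGraph (A : Matrix m n R) : SimpleGraph (m ⊕ n) where
  Adj
    | Sum.inl i, Sum.inr j => A i j ≠ 0
    | Sum.inr j, Sum.inl i => A i j ≠ 0
    | _, _ => False
  symm := ⟨by rintro (i | j) (i' | j') h <;> exact h⟩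
  loopless := ⟨by rintro (i | j) h <;> exact h⟩

/-- Transposition exchanges the two sides of the entry graph. -/
def entryGraphSwap (A : Matrix m n R) : entryGraph A ≃g entryGraph A.transpose where
  toEquiv := Equiv.sumComm m n
  map_rel_iff' := by rintro (i | j) (i' | j') <;> exact Iff.rfl

/-- The rows supported on `P`, together with the columns in `P`. -/
def entryClosure (A : Matrix m n R) (P : Set n) : Set (m ⊕ n) :=
  Sum.elim (fun i => ∀ j ∈ Pᶜ, A i j = 0) P

theorem mem_of_isDeletable {w : m ⊕ n} {x y : m}
    (hdel : IsDeletable (entryGraph A) w {Sum.inl x, Sum.inl y}) {P : Set n}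
    (hP : ∀ i, i ≠ x → i ≠ y → ¬Crosses A i P) (hw : w ∈ entryClosure A P) {j : n}
    (hj : (entryGraph A).Reachable w (Sum.inr j)) : j ∈ P := by
  refine hdel (entryClosure A P) hw ?_ (Sum.inr j) (by simp) hj
  rintro (i | j) hu (i' | j') hX hadj
  · exact hadj.elim
  · exact not_not.1 fun hj' => hadj (hu j' hj')
  · refine (not_crosses_iff.1 (hP i' (fun e => hX ?_) fun e => hX ?_)).resolve_left
      fun h => hadj (h j hu)
    · simp [e]
    · simp [e]
  · exact hadj.elim

theorem isRemovablePair_of_isDeletable {w : m ⊕ n} {x y : m} (hx : w ≠ Sum.inl x)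
    (hy : w ≠ Sum.inl y) (hreach : (entryGraph A).Reachable w (Sum.inl x))
    (hdel : IsDeletable (entryGraph A) w {Sum.inl x, Sum.inl y}) : IsRemovablePair A x y := by
  refine Or.inl fun S hS ⟨⟨j, hj, hxj⟩, k, hk, hxk⟩ _ => ?_
  have reach : ∀ j, A x j ≠ 0 → (entryGraph A).Reachable w (Sum.inr j) := fun j hxj =>
    have hadj : (entryGraph A).Adj (Sum.inl x) (Sum.inr j) := hxj
    hreach.trans hadj.reachable
  have hw : w ∈ entryClosure A S ∨ w ∈ entryClosure A Sᶜ := by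
    rcases w with i | j
    · have hi := not_crosses_iff.1 (hS i (fun e => hx (e ▸ rfl)) fun e => hy (e ▸ rfl))
      exact hi.symm.imp_right fun h => by rwa [← compl_compl S] at h
    · exact em (j ∈ S)
  rcases hw with hw | hw
  · exact hk (mem_of_isDeletable hdel hS hw (reach k hxk))
  · exact mem_of_isDeletable hdel (fun i hix hiy => crosses_compl.not.2 (hS i hix hiy)) hw
      (reach j hxj) hj

/-- `A` has a removable pair of rows or of columns. -/
def HasRemovablePair (A : Matrix m n R) : Prop :=
  (∃ x y, x ≠ y ∧ IsRemovablePair A x y) ∨ ∃ x y, x ≠ y ∧ IsRemovablePair A.transpose x y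

theorem hasRemovablePair_transpose : HasRemovablePair A.transpose ↔ HasRemovablePair A := or_comm

/-- Three nonzero entries in a row give three deletable vertices of the entry graph, two of which
lie on the same side. -/
theorem hasRemovablePair_of_three_entries [Finite m] [Finite n] {i : m} {a : Fin 3 → n}
    (ha : Function.Injective a) (h : ∀ t, A i (a t) ≠ 0) : HasRemovablePair A := by
  obtain ⟨b, hb, hbw, hdel⟩ := exists_deletable_vertices (G := entryGraph A) (w := Sum.inl i)
    (Sum.inr_injective.comp ha) h
  obtain ⟨s, t, hst, hside⟩ :=
    Fintype.exists_ne_map_eq_of_card_lt (fun t => (b t).isLeft) (by simp)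
  have hpair := hdel {b s, b t} (Set.pair_subset ⟨s, rfl⟩ ⟨t, rfl⟩)
  have hne := hb.ne hst
  obtain ⟨hreach, hs⟩ := hbw s
  have ht := (hbw t).2
  rcases hbs : b s with x | x <;> rcases hbt : b t with y | y <;>
    simp only [hbs, hbt] at hside hpair hne hreach hs ht
  · exact Or.inl ⟨x, y, fun e => hne (e ▸ rfl),
      isRemovablePair_of_isDeletable hs.symm ht.symm hreach hpair⟩
  · simp at hside
  · simp at hside
  · have hpair' := hpair.map_iso (entryGraphSwap A)
    rw [Set.image_pair] at hpair'
    exact Or.inr ⟨x, y, fun e => hne (e ▸ rfl), isRemovablePair_of_isDeletable Sum.inr_ne_inl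
      Sum.inr_ne_inl ((entryGraphSwap A).reachable_iff.2 hreach) hpair'⟩

theorem hasRemovablePair_of_three_ne [Finite m] [Finite n] {i : m} {j₁ j₂ j₃ : n} (h₁₂ : j₁ ≠ j₂)
    (h₁₃ : j₁ ≠ j₃) (h₂₃ : j₂ ≠ j₃) (h₁ : A i j₁ ≠ 0) (h₂ : A i j₂ ≠ 0) (h₃ : A i j₃ ≠ 0) :
    HasRemovablePair A := by
  refine hasRemovablePair_of_three_entries (i := i) (a := ![j₁, j₂, j₃]) ?_ ?_
  · intro s t hst
    fin_cases s <;> fin_cases t <;> simp_all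
  · intro t
    fin_cases t <;> assumption

theorem exists_two_entries (hA : ¬HasRemovablePair A) [Nontrivial m] (i : m) :
    ∃ j j', j ≠ j' ∧ A i j ≠ 0 ∧ A i j' ≠ 0 := by
  obtain ⟨i', hi'⟩ := exists_ne i
  by_contra! hne
  refine hA (Or.inl ⟨i, i', hi'.symm, Or.inl ?_⟩)
  rintro S - ⟨⟨j, hj, hij⟩, k, hk, hik⟩
  exact absurd (hne j k (fun e => hk (e ▸ hj)) hij) hik

/-- The nonzero entries of row `i` are those in the two distinct columns `a` and `c`. -/
def IsRowSupport (A : Matrix m n R) (i : m) (a c : n) : Prop :=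
  a ≠ c ∧ ∀ j, A i j ≠ 0 ↔ j = a ∨ j = c

theorem exists_isRowSupport [Finite m] [Finite n] (hA : ¬HasRemovablePair A) [Nontrivial m] {i : m}
    {a : n} (hia : A i a ≠ 0) : ∃ c, IsRowSupport A i a c := by
  obtain ⟨c, hac, hic⟩ : ∃ c, a ≠ c ∧ A i c ≠ 0 := by
    obtain ⟨j, j', hjj, hj, hj'⟩ := exists_two_entries hA i
    by_cases haj : a = j
    · exact ⟨j', haj ▸ hjj, hj'⟩
    · exact ⟨j, haj, hj⟩
  refine ⟨c, hac, fun j => ⟨fun hij => ?_, ?_⟩⟩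
  · by_contra! hj
    exact hA (hasRemovablePair_of_three_ne hac hj.1.symm hj.2.symm hia hic hij)
  · rintro (rfl | rfl) <;> assumption

theorem IsRowSupport.eq_or_eq {b d : m} {a c : n} (hA : ¬HasRemovablePair A)
    (hb : IsRowSupport A b a c) (hd : IsRowSupport A d a c) (ha : IsRowSupport A.transpose a b d)
    (hc : IsRowSupport A.transpose c b d) (i : m) : i = b ∨ i = d := by
  by_contra! hi
  have rows : ∀ j ∈ ({a, c} : Set n), ∀ i, A i j ≠ 0 → i = b ∨ i = d := by
    rintro j (rfl | rfl) i hij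
    exacts [(ha.2 i).1 hij, (hc.2 i).1 hij]
  refine hA (Or.inl ⟨b, i, hi.1.symm, Or.inr ⟨{a, c}, ?_, ?_, ?_⟩⟩)
  · rintro i ⟨⟨j, hj, hij⟩, k, hk, hik⟩
    rcases rows j hj i hij with rfl | rfl
    exacts [hk ((hb.2 k).1 hik), hk ((hd.2 k).1 hik)]
  · exact fun j hj => not_not.1 fun hbj => hj ((hb.2 j).1 hbj)
  · exact fun j hj => not_not.1 fun hij => (rows j hj i hij).elim hi.1 hi.2

/-- `A` is a `2 × 2` matrix, with rows `b`, `d` and columns `a`, `c`, without zero entries. -/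
structure IsFullTwoByTwo (A : Matrix m n R) (b d : m) (a c : n) : Prop where
  row_ne : b ≠ d
  col_ne : a ≠ c
  row_eq : ∀ i, i = b ∨ i = d
  col_eq : ∀ j, j = a ∨ j = c
  apply_ne_zero : ∀ i j, A i j ≠ 0

theorem isFullTwoByTwo_of_isRowSupport [Finite m] [Finite n] (hA : ¬HasRemovablePair A)
    [Nontrivial m] [Nontrivial n] {b d : m} {a c : n} (hb : IsRowSupport A b a c)
    (ha : IsRowSupport A.transpose a b d) (hc : IsRowSupport A.transpose c b d) :
    IsFullTwoByTwo A b d a c := by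
  have hd : IsRowSupport A d a c := by
    obtain ⟨c', hc'⟩ := exists_isRowSupport hA ((ha.2 d).2 (Or.inr rfl) : A d a ≠ 0)
    obtain rfl : c = c' :=
      ((hc'.2 c).1 ((hc.2 d).2 (Or.inr rfl) : A d c ≠ 0)).resolve_left hb.1.symm
    exact hc'
  have hrow := hb.eq_or_eq hA hd ha hc
  have hcol := ha.eq_or_eq (hasRemovablePair_transpose.not.2 hA) hc hb hd
  refine ⟨ha.1, hb.1, hrow, hcol, fun i j => ?_⟩
  rcases hrow i with rfl | rfl
  exacts [(hb.2 j).2 (hcol j), (hd.2 j).2 (hcol j)]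

variable [DecidableEq m] [DecidableEq n]

theorem hasRemovablePair_pivot [Finite m] [Finite n] {b d z : m} {a c : n}
    (hb : IsRowSupport A b a c) (ha : IsRowSupport A.transpose a b z)
    (hc : IsRowSupport A.transpose c b d) (hzd : z ≠ d) (hbc : IsUnit (A b c))
    (hdc : IsUnit (A d c)) : HasRemovablePair (pivot A b c) := by
  have hba : A b a ≠ 0 := (hb.2 a).2 (Or.inl rfl)
  have hza : A z a ≠ 0 := (ha.2 z).2 (Or.inr rfl)
  have hda : A d a = 0 := not_not.1 fun h => ((ha.2 d).1 h).elim hc.1.symm hzd.symm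
  have hzc : A z c = 0 := not_not.1 fun h => ((hc.2 z).1 h).elim ha.1.symm hzd
  refine hasRemovablePair_transpose.1
    (hasRemovablePair_of_three_ne (i := a) hc.1 ha.1 hzd.symm ?_ ?_ ?_)
  · rwa [Matrix.transpose_apply, pivot_apply_row _ hb.1, Ne, hbc.ringInverse.mul_right_eq_zero]
  · exact pivot_apply_ne_zero_of_eq_zero hc.1.symm hb.1 hbc hdc hba hda
  · rwa [Matrix.transpose_apply, pivot_apply_of_col_eq_zero ha.1.symm hb.1 hzc]

theorem hasRemovablePair_cases [Finite m] [Finite n] (hA : ∀ i j, IsZeroOrUnit (A i j)) :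
    HasRemovablePair A ∨ (∃ r c, IsUnit (A r c) ∧ HasRemovablePair (pivot A r c)) ∨
      Subsingleton m ∨ ∃ b d a c, IsFullTwoByTwo A b d a c := by
  by_cases h : HasRemovablePair A
  · exact Or.inl h
  rcases subsingleton_or_nontrivial m with hm | hm
  · exact Or.inr (Or.inr (Or.inl hm))
  have hT := hasRemovablePair_transpose.not.2 h
  obtain ⟨b⟩ : Nonempty m := inferInstance
  obtain ⟨a, a', haa', hba, -⟩ := exists_two_entries h b
  have hn : Nontrivial n := ⟨a, a', haa'⟩
  obtain ⟨c, hb⟩ := exists_isRowSupport h hba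
  have hbc : A b c ≠ 0 := (hb.2 c).2 (Or.inr rfl)
  obtain ⟨d, hc⟩ := exists_isRowSupport hT hbc
  obtain ⟨z, ha⟩ := exists_isRowSupport hT hba
  by_cases hzd : z = d
  · subst hzd
    exact Or.inr (Or.inr (Or.inr ⟨b, z, a, c, isFullTwoByTwo_of_isRowSupport h hb ha hc⟩))
  · have hdc : A d c ≠ 0 := (hc.2 d).2 (Or.inr rfl)
    have hu := (hA b c).isUnit hbc
    exact Or.inr (Or.inl ⟨b, c, hu,
      hasRemovablePair_pivot hb ha hc hzd hu ((hA d c).isUnit hdc)⟩)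

end Reduction

section SmallMatrices

variable {R : Type*} [CommRing R] {m n : Type*} {A : Matrix m n R}

theorem hasUnitMinors_of_subsingleton [Subsingleton m] (hA : ∀ i j, IsZeroOrUnit (A i j)) :
    HasUnitMinors A := by
  intro k f g
  obtain _ | k := k
  · simp [IsZeroOrUnit]
  · exact isZeroOrUnit_det_of_rows_mem_pair hA (x := f 0) (y := f 0)
      (fun u v => Or.inl (by ring)) (fun i => Or.inl (Subsingleton.elim _ _)) g

theorem hasUnitMinors_of_two {b d : m} {a c : n} (hm : ∀ i, i = b ∨ i = d)
    (hn : ∀ j, j = a ∨ j = c) (hA : ∀ i j, IsZeroOrUnit (A i j))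
    (hdet : IsZeroOrUnit (A b a * A d c - A b c * A d a)) : HasUnitMinors A := by
  intro k f g
  refine isZeroOrUnit_det_of_rows_mem_pair hA (x := b) (y := d) (fun u v => ?_) (fun i => hm _) g
  rcases hn u with rfl | rfl <;> rcases hn v with rfl | rfl
  · exact Or.inl (by ring)
  · exact hdet
  · rw [← neg_sub]
    exact hdet.neg
  · exact Or.inl (by ring)

end SmallMatrices

section LiftTheorem

variable {R K : Type*} [CommRing R] [CommRing K] {φ : R →+* K} {m n : Type*} {A : Matrix m n K}

theorem IsLifting.exists_isZeroOrUnit (hφ : IsLifting φ) {a : K} (ha : IsZeroOrUnit a) :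
    ∃ b, IsZeroOrUnit b ∧ φ b = a := by
  rcases ha with rfl | ⟨a, rfl⟩
  · exact ⟨0, IsZeroOrUnit.zero, map_zero φ⟩
  · obtain ⟨b, rfl⟩ := hφ.exists_unit a
    exact ⟨b, IsZeroOrUnit.of_isUnit b.isUnit, rfl⟩

theorem IsLifting.exists_units (hφ : IsLifting φ) {p q r s : Kˣ}
    (h : IsZeroOrUnit (p * s - q * r : K)) :
    ∃ p' q' r' s' : Rˣ, IsZeroOrUnit (p' * s' - q' * r' : R) ∧ φ p' = p ∧ φ q' = q ∧ φ r' = r ∧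
      φ s' = s := by
  obtain ⟨t, ht, et⟩ := hφ.exists_isFundamental _ (isFundamental_iff.2 h)
  obtain ⟨p', rfl⟩ := hφ.exists_unit p
  obtain ⟨q', rfl⟩ := hφ.exists_unit q
  obtain ⟨r', rfl⟩ := hφ.exists_unit r
  let s' : Rˣ := q' * r' * p'⁻¹ * t⁻¹
  have hs' : Units.map (φ : R →* K) s' = s := by
    simp only [s', map_mul, map_inv, et]
    exact Additive.ofMul.injective (by simp only [ofMul_mul, ofMul_inv]; abel)
  have ht' : q' * r' * p'⁻¹ * s'⁻¹ = t :=
    Additive.ofMul.injective (by simp only [s', ofMul_mul, ofMul_inv]; abel)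
  exact ⟨p', q', r', s', isFundamental_iff.1 (ht' ▸ ht), rfl, rfl, rfl, congrArg Units.val hs'⟩

namespace HasUnitLift

theorem transpose (h : HasUnitLift φ A) : HasUnitLift φ A.transpose := by
  obtain ⟨L, hL, rfl⟩ := h
  exact ⟨L.transpose, hL.transpose, Matrix.transpose_map⟩

theorem of_pivot [Nontrivial K] [Finite m] [DecidableEq m] [DecidableEq n] {r : m} {c : n}
    (hu : IsUnit (A r c)) (h : HasUnitLift φ (pivot A r c)) : HasUnitLift φ A := by
  obtain ⟨L, hL, e⟩ := h
  have hLu : IsUnit (L r c) := by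
    refine (hL.isZeroOrUnit_apply r c).isUnit fun h => (isUnit_pivot_self hu).ne_zero ?_
    rw [← e, Matrix.map_apply, h, map_zero]
  exact ⟨pivot L r c, hL.pivot hLu, by rw [pivot_map φ hLu, e, pivot_pivot hu]⟩

theorem of_subsingleton [Subsingleton m] (hφ : IsLifting φ) (hA : ∀ i j, IsZeroOrUnit (A i j)) :
    HasUnitLift φ A := by
  choose L hL e using fun i j => hφ.exists_isZeroOrUnit (hA i j)
  exact ⟨Matrix.of L, hasUnitMinors_of_subsingleton hL, by ext i j; exact e i j⟩

theorem of_isFullTwoByTwo (hφ : IsLifting φ) (hA : HasUnitMinors A) {b d : m} {a c : n}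
    (h : IsFullTwoByTwo A b d a c) : HasUnitLift φ A := by
  classical
  obtain ⟨hbd, hac, hm, hn, hne⟩ := h
  have isUnit_apply : ∀ i j, IsUnit (A i j) := fun i j =>
    (hA.isZeroOrUnit_apply i j).isUnit (hne i j)
  obtain ⟨p, hp⟩ := isUnit_apply b a
  obtain ⟨q, hq⟩ := isUnit_apply b c
  obtain ⟨r, hr⟩ := isUnit_apply d a
  obtain ⟨s, hs⟩ := isUnit_apply d c
  have hminor : IsZeroOrUnit (p * s - q * r : K) := by
    rw [hp, hq, hr, hs]
    exact hA.isZeroOrUnit_mul_sub_mul b d a c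
  obtain ⟨p', q', r', s', hdet, ep, eq, er, es⟩ := hφ.exists_units hminor
  let L : Matrix m n R := Matrix.of fun i j =>
    if i = b then (if j = a then (p' : R) else q') else (if j = a then (r' : R) else s')
  refine ⟨L, hasUnitMinors_of_two hm hn (fun i j => ?_) ?_, ?_⟩
  · simp only [L, Matrix.of_apply]
    split_ifs <;> exact IsZeroOrUnit.of_isUnit (Units.isUnit _)
  · simpa [L, hbd.symm, hac.symm] using hdet
  · ext i j
    rcases hm i with rfl | rfl <;> rcases hn j with rfl | rfl <;>
      simp [L, hbd.symm, hac.symm, ep, eq, er, es, hp, hq, hr, hs]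

theorem of_hasRemovablePair [Nontrivial K] [Finite m] [Finite n] (hφ : IsLifting φ)
    (hA : HasUnitMinors A) (h : HasRemovablePair A)
    (hrow : ∀ x : m, HasUnitLift φ (A.submatrix ((↑) : {i // i ≠ x} → m) id))
    (hcol : ∀ y : n, HasUnitLift φ (A.submatrix id ((↑) : {j // j ≠ y} → n))) :
    HasUnitLift φ A := by
  rcases h with ⟨x, y, hxy, hrem⟩ | ⟨x, y, hxy, hrem⟩
  · exact hasUnitLift_of_isRemovablePair hφ hA hxy hrem (hrow x) (hrow y)
  · exact (hasUnitLift_of_isRemovablePair hφ hA.transpose hxy hrem (hcol x).transpose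
      (hcol y).transpose).transpose

end HasUnitLift

theorem IsLifting.hasUnitLift [Nontrivial K] [Finite m] [Finite n] (hφ : IsLifting φ)
    (hA : HasUnitMinors A) : HasUnitLift φ A := by
  classical
  induction hN : Nat.card m + Nat.card n using Nat.strong_induction_on generalizing m n with
  | _ N ih =>
    have lift_of_hasRemovablePair : ∀ B : Matrix m n K, HasUnitMinors B → HasRemovablePair B →
        HasUnitLift φ B := by
      refine fun B hB h => HasUnitLift.of_hasRemovablePair hφ hB h (fun x => ?_) (fun y => ?_)
      · have hlt := Finite.card_subtype_lt (p := (· ≠ x)) (x := x) (by simp)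
        exact ih _ (by omega) (hB.submatrix _ _) rfl
      · have hlt := Finite.card_subtype_lt (p := (· ≠ y)) (x := y) (by simp)
        exact ih _ (by omega) (hB.submatrix _ _) rfl
    rcases hasRemovablePair_cases hA.isZeroOrUnit_apply with
      h | ⟨r, c, hu, h⟩ | hm | ⟨b, d, a, c, h⟩
    · exact lift_of_hasRemovablePair A hA h
    · exact HasUnitLift.of_pivot hu (lift_of_hasRemovablePair _ (hA.pivot hu) h)
    · exact HasUnitLift.of_subsingleton hφ hA.isZeroOrUnit_apply
    · exact HasUnitLift.of_isFullTwoByTwo hφ hA h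

end LiftTheorem

section SixthRoots

theorem pow_six_eq_one_of_sq_eq_sub_one {R : Type*} [CommRing R] {z : R} (hz : z ^ 2 = z - 1) :
    z ^ 6 = 1 := by
  linear_combination (z ^ 4 + z ^ 3 - z - 1) * hz

theorem eq_or_sq_eq_sub_one_of_pow_six_eq_one {R : Type*} [CommRing R] [IsDomain R] {u : R}
    (hu : u ^ 6 = 1) : u = 1 ∨ u = -1 ∨ u ^ 2 = u - 1 ∨ (-u) ^ 2 = -u - 1 := by
  have factored : (u - 1) * ((u + 1) * ((u ^ 2 - u + 1) * (u ^ 2 + u + 1))) = 0 := by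
    linear_combination hu
  simp only [mul_eq_zero] at factored
  rcases factored with h | h | h | h
  · exact Or.inl (by linear_combination h)
  · exact Or.inr (Or.inl (by linear_combination h))
  · exact Or.inr (Or.inr (Or.inl (by linear_combination h)))
  · exact Or.inr (Or.inr (Or.inr (by linear_combination h)))

theorem sq_eq_sub_one_of_isPrimitiveRoot {R : Type*} [CommRing R] [IsDomain R] {ζ : R}
    (hζ : IsPrimitiveRoot ζ 6) : ζ ^ 2 = ζ - 1 := by
  have ne_one : ∀ j, 0 < j → j < 6 → ζ ^ j ≠ 1 := fun j h₀ h₆ =>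
    hζ.pow_ne_one_of_pos_of_lt h₀.ne' h₆
  rcases eq_or_sq_eq_sub_one_of_pow_six_eq_one hζ.pow_eq_one with h | h | h | h
  · exact absurd (by rw [h, one_pow]) (ne_one 1 (by norm_num) (by norm_num))
  · exact absurd (by rw [h, neg_one_sq]) (ne_one 2 (by norm_num) (by norm_num))
  · exact h
  · exact absurd (by linear_combination (ζ - 1) * h) (ne_one 3 (by norm_num) (by norm_num))

end SixthRoots

section Eisenstein

theorem eq_one_or_four_dvd_of_eq_zpow {N : ℤ} {l : ℤ} (h : (N : ℝ) = 4 ^ l) : N = 1 ∨ 4 ∣ N := by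
  have nonneg : 0 ≤ N := by exact_mod_cast h.symm ▸ zpow_nonneg (by norm_num : (0 : ℝ) ≤ 4) l
  obtain ⟨l, rfl | rfl⟩ := l.eq_nat_or_neg
  · have hN : N = 4 ^ l := by exact_mod_cast h
    obtain _ | l := l
    · exact Or.inl hN
    · exact Or.inr (hN ▸ dvd_pow_self 4 l.succ_ne_zero)
  · have hN : N * 4 ^ l = 1 := by
      rw [zpow_neg, zpow_natCast] at h
      exact_mod_cast show (N : ℝ) * 4 ^ l = 1 by rw [h, inv_mul_cancel₀ (by positivity)]
    exact Or.inl (Int.eq_one_of_mul_eq_one_right nonneg hN)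

theorem even_of_even_sq_add_mul_add_sq {a b : ℤ} (h : Even (a ^ 2 + a * b + b ^ 2)) :
    Even a ∧ Even b := by
  simp only [Int.even_add, Int.even_mul, Int.even_pow] at h
  tauto

theorem pow_six_eq_one_of_norm_eq_one {R : Type*} [CommRing R] {z : R} (hz : z ^ 2 = z - 1)
    {a b : ℤ} (h : a ^ 2 + a * b + b ^ 2 = 1) : ((a : R) + b * z) ^ 6 = 1 := by
  have hz' : (1 - z) ^ 2 = (1 - z) - 1 := by linear_combination hz
  obtain ⟨ha, ha'⟩ : -1 ≤ a ∧ a ≤ 1 :=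
    abs_le.1 (sq_le_one_iff_abs_le_one a |>.1 (by nlinarith [sq_nonneg (a + 2 * b)]))
  obtain ⟨hb, hb'⟩ : -1 ≤ b ∧ b ≤ 1 :=
    abs_le.1 (sq_le_one_iff_abs_le_one b |>.1 (by nlinarith [sq_nonneg (2 * a + b)]))
  have h₁ := pow_six_eq_one_of_sq_eq_sub_one hz
  have h₂ := pow_six_eq_one_of_sq_eq_sub_one hz'
  interval_cases a <;> interval_cases b <;> norm_num at h <;> push_cast
  · ring
  · linear_combination h₂
  · linear_combination h₁
  · linear_combination h₁
  · linear_combination h₂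
  · ring

/-- Infinite descent: if the norm is even, then so are `a` and `b`. -/
theorem exists_eq_two_pow_mul_of_norm {R : Type*} [CommRing R] {z : R} (hz : z ^ 2 = z - 1)
    {s : ℕ} {a b : ℤ} (h : a ^ 2 + a * b + b ^ 2 = 2 ^ s) :
    ∃ (k : ℕ) (u : R), u ^ 6 = 1 ∧ (a : R) + b * z = 2 ^ k * u := by
  induction s using Nat.twoStepInduction generalizing a b with
  | zero => exact ⟨0, _, pow_six_eq_one_of_norm_eq_one hz (by simpa using h), by simp⟩
  | one =>
    obtain ⟨⟨a, rfl⟩, ⟨b, rfl⟩⟩ :=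
      even_of_even_sq_add_mul_add_sq (h ▸ even_two.pow_of_ne_zero one_ne_zero)
    have : 4 * (a ^ 2 + a * b + b ^ 2) = 2 := by linear_combination h
    omega
  | more s ih _ =>
    obtain ⟨⟨a, rfl⟩, ⟨b, rfl⟩⟩ :=
      even_of_even_sq_add_mul_add_sq (h ▸ even_two.pow_of_ne_zero (by omega))
    have hs : a ^ 2 + a * b + b ^ 2 = 2 ^ s := by
      have : 4 * (a ^ 2 + a * b + b ^ 2) = 4 * 2 ^ s := by linear_combination h
      linarith
    obtain ⟨k, u, hu, hab⟩ := ih hs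
    exact ⟨k + 1, u, hu, by push_cast; linear_combination 2 * hab⟩

variable {z : ℂ} (hz : z ^ 2 = z - 1)

include hz

theorem re_eq_half_and_im_sq : z.re = 1 / 2 ∧ z.im ^ 2 = 3 / 4 := by
  have hre := congrArg Complex.re hz
  have him := congrArg Complex.im hz
  simp only [sq, Complex.mul_re, Complex.mul_im, Complex.sub_re, Complex.sub_im, Complex.one_re,
    Complex.one_im, sub_zero] at hre him
  have him0 : z.im ≠ 0 := by
    intro h
    rw [h] at hre
    nlinarith [sq_nonneg (z.re - 1 / 2)]
  have hre' : z.re = 1 / 2 :=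
    mul_right_cancel₀ him0 (by linear_combination him / 2)
  exact ⟨hre', by rw [hre'] at hre; linear_combination -hre⟩

theorem normSq_add_mul (a b : ℝ) :
    Complex.normSq (a + b * z) = a ^ 2 + a * b + b ^ 2 := by
  obtain ⟨hre, him⟩ := re_eq_half_and_im_sq hz
  simp only [Complex.normSq_apply, Complex.add_re, Complex.add_im, Complex.re_ofReal_mul,
    Complex.im_ofReal_mul, Complex.ofReal_re, Complex.ofReal_im, hre]
  linear_combination b ^ 2 * him

theorem normSq_intCast_add_mul (a b : ℤ) :
    Complex.normSq (a + b * z) = (a ^ 2 + a * b + b ^ 2 : ℤ) := by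
  simpa using normSq_add_mul hz a b

theorem eq_zero_of_intCast_add_mul_eq_zero {a b : ℤ} (h : (a : ℂ) + b * z = 0) :
    a = 0 ∧ b = 0 := by
  have hN : a ^ 2 + a * b + b ^ 2 = 0 := by
    exact Int.cast_eq_zero.1 ((normSq_intCast_add_mul hz a b).symm.trans (by rw [h, map_zero]))
  obtain rfl : b = 0 := by nlinarith [sq_nonneg (2 * a + b), sq_nonneg b]
  exact ⟨by simpa using hN, rfl⟩

omit hz

theorem two_mul_re_of_pow_six_eq_one {u : ℂ} (hu : u ^ 6 = 1) : ∃ t : ℤ, 2 * u.re = t ∧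
    (t = 2 ∧ u = 1 ∨ t = -2 ∧ u = -1 ∨ t = 1 ∧ u ^ 2 = u - 1 ∨ t = -1) := by
  rcases eq_or_sq_eq_sub_one_of_pow_six_eq_one hu with rfl | rfl | h | h
  · exact ⟨2, by norm_num, by simp⟩
  · exact ⟨-2, by norm_num, by simp⟩
  · exact ⟨1, by rw [(re_eq_half_and_im_sq h).1]; norm_num, by simp [h]⟩
  · have hre := (re_eq_half_and_im_sq h).1
    rw [Complex.neg_re] at hre
    exact ⟨-1, by push_cast; linear_combination -2 * hre, by simp⟩

theorem normSq_two_zpow_mul {u : ℂ} (hu : u ^ 6 = 1) (k : ℤ) :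
    Complex.normSq (2 ^ k * u) = 4 ^ k := by
  have hu' : Complex.normSq u = 1 := by
    rw [Complex.normSq_eq_norm_sq, Complex.norm_eq_one_of_pow_eq_one hu (by norm_num), one_pow]
  rw [map_mul, hu', mul_one, map_zpow₀, Complex.normSq_ofNat]
  norm_num

theorem normSq_one_sub_two_pow_mul {u : ℂ} (hu : u ^ 6 = 1) {t : ℤ} (ht : 2 * u.re = t) (k : ℕ) :
    Complex.normSq (1 - 2 ^ k * u) = ((1 - 2 ^ k * t + 4 ^ k : ℤ) : ℝ) := by
  have hre : (2 ^ k * u).re = 2 ^ k * u.re := by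
    exact_mod_cast Complex.re_ofReal_mul (2 ^ k) u
  have hk := normSq_two_zpow_mul hu k
  simp only [zpow_natCast] at hk
  rw [Complex.normSq_sub, hk, map_one, one_mul, Complex.conj_re, hre]
  push_cast
  linear_combination -2 ^ k * ht

/-- If `x = 2 ^ k * u`, then `1 - x` has norm `1 - 2 ^ k * t + 4 ^ k`, where `t` is the trace of
`u`. When `k` is positive this is odd, so it can be a power of `4` only if `2 ^ k = t`. -/
theorem eq_of_one_sub_two_pow_mul {k : ℕ} {u : ℂ} (hu : u ^ 6 = 1)
    (h : 1 - 2 ^ k * u = 0 ∨ ∃ (l : ℤ) (v : ℂ), v ^ 6 = 1 ∧ 1 - 2 ^ k * u = 2 ^ l * v) :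
    k = 0 ∧ (u = 1 ∨ u = -1 ∨ u ^ 2 = u - 1) ∨ k = 1 ∧ u = 1 := by
  obtain ⟨t, ht, htu⟩ := two_mul_re_of_pow_six_eq_one hu
  have norm_eq := normSq_one_sub_two_pow_mul hu ht k
  have norm_cases : 1 - 2 ^ k * t + 4 ^ k = 1 ∨ 4 ∣ 1 - 2 ^ k * t + 4 ^ k := by
    rcases h with h | ⟨l, v, hv, h⟩
    · rw [h, map_zero] at norm_eq
      exact Or.inr (Int.cast_eq_zero.1 norm_eq.symm ▸ dvd_zero 4)
    · exact eq_one_or_four_dvd_of_eq_zpow (norm_eq.symm.trans (h ▸ normSq_two_zpow_mul hv l))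
  obtain _ | k := k
  · have : t ≠ -1 := by rintro rfl; omega
    tauto
  · have hpow : (2 : ℤ) ^ (k + 1) = t := by
      have hN : 1 - 2 ^ (k + 1) * t + 4 ^ (k + 1) = (1 : ℤ) := by
        refine norm_cases.resolve_right fun h4 => ?_
        rw [pow_succ, pow_succ, mul_right_comm] at h4
        omega
      have h4 : (4 : ℤ) ^ (k + 1) = 2 ^ (k + 1) * 2 ^ (k + 1) := by rw [← mul_pow]; norm_num
      exact mul_left_cancel₀ (pow_ne_zero (k + 1) two_ne_zero) (by linear_combination hN - h4)
    obtain _ | k := k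
    · rw [zero_add, pow_one] at hpow
      exact Or.inr ⟨rfl, by simpa [← hpow] using htu⟩
    · have : (4 : ℤ) ≤ 2 ^ (k + 2) := by
        rw [pow_add]
        linarith [one_le_pow₀ (n := k) (one_le_two : (1 : ℤ) ≤ 2)]
      rw [add_assoc, one_add_one_eq_two] at hpow
      omega

end Eisenstein

section EisensteinGraph

variable {F : Type*} [CommRing F] {ζ : ℂ} {z : F}

/-- The graph of the homomorphism from `ℤ[1/2, ζ]` to `F` that maps `ζ` to `z`. It serves as the
ring `ℤ[1/2, ζ]` together with that homomorphism. -/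
def eisensteinGraph (hζ : ζ ^ 2 = ζ - 1) (hz : z ^ 2 = z - 1) : Subring (ℂ × F) where
  carrier := {x | ∃ (n : ℕ) (a b : ℤ), 2 ^ n * x.1 = a + b * ζ ∧ 2 ^ n * x.2 = a + b * z}
  zero_mem' := ⟨0, 0, 0, by simp, by simp⟩
  one_mem' := ⟨0, 1, 0, by simp, by simp⟩
  add_mem' := by
    rintro x y ⟨n, a, b, hx₁, hx₂⟩ ⟨m, c, d, hy₁, hy₂⟩
    refine ⟨n + m, 2 ^ m * a + 2 ^ n * c, 2 ^ m * b + 2 ^ n * d, ?_, ?_⟩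
    · push_cast [Prod.fst_add]
      linear_combination 2 ^ m * hx₁ + 2 ^ n * hy₁
    · push_cast [Prod.snd_add]
      linear_combination 2 ^ m * hx₂ + 2 ^ n * hy₂
  mul_mem' := by
    rintro x y ⟨n, a, b, hx₁, hx₂⟩ ⟨m, c, d, hy₁, hy₂⟩
    refine ⟨n + m, a * c - b * d, a * d + b * c + b * d, ?_, ?_⟩
    · push_cast [Prod.fst_mul]
      linear_combination (2 ^ m * y.1) * hx₁ + (a + b * ζ) * hy₁ + (b * d : ℂ) * hζ
    · push_cast [Prod.snd_mul]
      linear_combination (2 ^ m * y.2) * hx₂ + (a + b * z) * hy₂ + (b * d : F) * hz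
  neg_mem' := by
    rintro x ⟨n, a, b, hx₁, hx₂⟩
    refine ⟨n, -a, -b, ?_, ?_⟩
    · push_cast [Prod.fst_neg]
      linear_combination -hx₁
    · push_cast [Prod.snd_neg]
      linear_combination -hx₂

namespace eisensteinGraph

variable (hζ : ζ ^ 2 = ζ - 1) (hz : z ^ 2 = z - 1)

/-- The embedding of `ℤ[1/2, ζ]` into the complex numbers. -/
def fst : eisensteinGraph hζ hz →+* ℂ := (RingHom.fst ℂ F).comp (eisensteinGraph hζ hz).subtype

/-- The homomorphism from `ℤ[1/2, ζ]` to `F` that maps `ζ` to `z`. -/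
def snd : eisensteinGraph hζ hz →+* F := (RingHom.snd ℂ F).comp (eisensteinGraph hζ hz).subtype

theorem mem_of_two_mul_eq_one {h : F} (hh : 2 * h = 1) : ((2⁻¹ : ℂ), h) ∈ eisensteinGraph hζ hz :=
  ⟨1, 1, 0, by simp, by simpa using hh⟩

theorem fst_injective (h2 : IsUnit (2 : F)) : Function.Injective (fst hζ hz) := by
  refine (injective_iff_map_eq_zero _).2 fun x hx => Subtype.ext (Prod.ext hx ?_)
  obtain ⟨n, a, b, h₁, h₂⟩ := x.2
  rw [show x.1.1 = 0 from hx, mul_zero] at h₁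
  obtain ⟨rfl, rfl⟩ := eq_zero_of_intCast_add_mul_eq_zero hζ h₁.symm
  exact (h2.pow n).mul_right_eq_zero.1 (by simpa using h₂)

/-- The unit `2`. -/
noncomputable def unitTwo (h2 : IsUnit (2 : F)) : (eisensteinGraph hζ hz)ˣ where
  val := 2
  inv := ⟨_, mem_of_two_mul_eq_one hζ hz (Ring.mul_inverse_cancel _ h2)⟩
  val_inv := Subtype.ext (Prod.ext (mul_inv_cancel₀ two_ne_zero) (Ring.mul_inverse_cancel _ h2))
  inv_val := Subtype.ext (Prod.ext (inv_mul_cancel₀ two_ne_zero) (Ring.inverse_mul_cancel _ h2))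

/-- The unit `ζ`, with inverse `1 - ζ`. -/
def unitZeta : (eisensteinGraph hζ hz)ˣ :=
  have mul_one_sub : (⟨(ζ, z), 0, 0, 1, by simp, by simp⟩ : eisensteinGraph hζ hz) *
      (1 - ⟨(ζ, z), 0, 0, 1, by simp, by simp⟩) = 1 :=
    Subtype.ext (Prod.ext (by
      change ζ * (1 - ζ) = 1
      linear_combination -hζ) (by
      change z * (1 - z) = 1
      linear_combination -hz))
  ⟨_, _, mul_one_sub, mul_comm _ _ |>.trans mul_one_sub⟩

theorem val_unitTwo (h2 : IsUnit (2 : F)) : (unitTwo hζ hz h2).val = 2 := rfl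

theorem val_inv_unitZeta : (unitZeta hζ hz)⁻¹.val = 1 - (unitZeta hζ hz).val := rfl

theorem snd_unitZeta : snd hζ hz (unitZeta hζ hz) = z := rfl

variable {hζ hz}

theorem exists_fst_eq_two_zpow_mul {x : eisensteinGraph hζ hz} (hx : IsUnit x) :
    ∃ (k : ℤ) (u : ℂ), u ^ 6 = 1 ∧ fst hζ hz x = 2 ^ k * u := by
  obtain ⟨y, hxy⟩ := hx.exists_right_inv
  obtain ⟨n, a, b, hab, -⟩ := x.2
  obtain ⟨m, c, d, hcd, -⟩ := y.2
  have hprod : ((a : ℂ) + b * ζ) * (c + d * ζ) = 2 ^ (n + m) := by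
    have : x.1.1 * y.1.1 = 1 := congrArg (fst hζ hz) hxy
    rw [← hab, ← hcd]
    linear_combination 2 ^ (n + m) * this
  have norm_dvd : a ^ 2 + a * b + b ^ 2 ∣ 4 ^ (n + m) := by
    have := congrArg Complex.normSq hprod
    rw [map_mul, normSq_intCast_add_mul hζ, normSq_intCast_add_mul hζ, map_pow,
      Complex.normSq_ofNat] at this
    norm_num at this
    exact Dvd.intro _ (by exact_mod_cast this)
  obtain ⟨s, -, hs⟩ : ∃ s ≤ 2 * (n + m), (a ^ 2 + a * b + b ^ 2).natAbs = 2 ^ s := by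
    refine (Nat.dvd_prime_pow Nat.prime_two).1 ?_
    rw [pow_mul]
    simpa [Int.natAbs_pow] using Int.natAbs_dvd_natAbs.2 norm_dvd
  have hpow : a ^ 2 + a * b + b ^ 2 = 2 ^ s := by
    rw [← Int.natAbs_of_nonneg (by nlinarith [sq_nonneg (2 * a + b), sq_nonneg b] :
      0 ≤ a ^ 2 + a * b + b ^ 2), hs]
    push_cast
    rfl
  obtain ⟨k, u, hu, habu⟩ := exists_eq_two_pow_mul_of_norm hζ hpow
  refine ⟨k - n, u, hu, ?_⟩
  rw [zpow_sub₀ two_ne_zero, zpow_natCast, zpow_natCast, div_mul_eq_mul_div, ← habu, ← hab]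
  exact (mul_div_cancel_left₀ _ (pow_ne_zero n two_ne_zero)).symm

theorem fst_eq_of_isFundamental {p : (eisensteinGraph hζ hz)ˣ} (hp : IsFundamental p)
    {k : ℕ} {u : ℂ} (hu : u ^ 6 = 1) (hpu : fst hζ hz p = 2 ^ k * u) :
    fst hζ hz p = 1 ∨ fst hζ hz p = -1 ∨ fst hζ hz p ^ 2 = fst hζ hz p - 1 ∨
      fst hζ hz p = 2 := by
  have h : 1 - 2 ^ k * u = 0 ∨ ∃ (l : ℤ) (v : ℂ), v ^ 6 = 1 ∧ 1 - 2 ^ k * u = 2 ^ l * v := by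
    rw [← hpu, ← map_one (fst hζ hz), ← map_sub]
    exact hp.imp (fun h => by rw [h, map_zero]) exists_fst_eq_two_zpow_mul
  rw [hpu]
  rcases eq_of_one_sub_two_pow_mul hu h with ⟨rfl, hu⟩ | ⟨rfl, rfl⟩
  · rw [pow_zero, one_mul]
    exact hu.imp_right (Or.imp_right Or.inl)
  · exact Or.inr (Or.inr (Or.inr (by norm_num)))

theorem isFundamental_neg_one (h2 : IsUnit (2 : F)) :
    IsFundamental (-1 : (eisensteinGraph hζ hz)ˣ) := by
  rw [IsFundamental, Units.val_neg, Units.val_one, sub_neg_eq_add, one_add_one_eq_two]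
  exact Or.inr (unitTwo hζ hz h2).isUnit

theorem isFundamental_unitTwo (h2 : IsUnit (2 : F)) : IsFundamental (unitTwo hζ hz h2) := by
  have : 1 - (unitTwo hζ hz h2).val = -1 := by
    rw [val_unitTwo]
    norm_num
  exact Or.inr (this ▸ isUnit_one.neg)

theorem isFundamental_unitZeta : IsFundamental (unitZeta hζ hz) :=
  Or.inr (val_inv_unitZeta hζ hz ▸ (unitZeta hζ hz)⁻¹.isUnit)

theorem eq_of_isFundamental (h2 : IsUnit (2 : F)) {p : (eisensteinGraph hζ hz)ˣ}
    (hp : IsFundamental p) :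
    p = 1 ∨ p = -1 ∨ p = unitTwo hζ hz h2 ∨ p = (unitTwo hζ hz h2)⁻¹ ∨ p = unitZeta hζ hz ∨
      p = (unitZeta hζ hz)⁻¹ := by
  have hext {p q : (eisensteinGraph hζ hz)ˣ} (h : fst hζ hz p = fst hζ hz q) : p = q :=
    Units.ext (fst_injective hζ hz h2 h)
  have of_nonneg {p : (eisensteinGraph hζ hz)ˣ} (hp : IsFundamental p) {k : ℕ} {u : ℂ}
      (hu : u ^ 6 = 1) (hpu : fst hζ hz p = 2 ^ k * u) :
      p = 1 ∨ p = -1 ∨ p = unitTwo hζ hz h2 ∨ p = unitZeta hζ hz ∨ p = (unitZeta hζ hz)⁻¹ := by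
    rcases fst_eq_of_isFundamental hp hu hpu with h | h | h | h
    · exact Or.inl (hext (by simpa using h))
    · exact Or.inr (Or.inl (hext (by simpa using h)))
    · have hroot : (fst hζ hz p - ζ) * (fst hζ hz p - (1 - ζ)) = 0 := by
        linear_combination h - hζ
      refine Or.inr (Or.inr (Or.inr ((mul_eq_zero.1 hroot).imp (fun h => ?_) fun h => ?_)))
      · exact hext (sub_eq_zero.1 h)
      · refine hext ?_
        rw [val_inv_unitZeta, map_sub, map_one]
        exact sub_eq_zero.1 h
    · exact Or.inr (Or.inr (Or.inl (hext h)))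
  obtain ⟨k, u, hu, hpu⟩ := exists_fst_eq_two_zpow_mul p.isUnit
  obtain ⟨k, rfl | rfl⟩ := k.eq_nat_or_neg
  · have := of_nonneg hp hu (by rw [hpu, zpow_natCast])
    tauto
  · have hpu' : fst hζ hz p⁻¹.val = 2 ^ k * u⁻¹ := by
      rw [map_units_inv, hpu, zpow_neg, zpow_natCast, mul_inv, inv_inv]
    rcases of_nonneg hp.inv (by rw [inv_pow, hu, inv_one]) hpu' with h | h | h | h | h
    all_goals
      obtain rfl := inv_eq_iff_eq_inv.1 h
      simp

theorem range_map_fst {ζ : ℂ} (hζ : IsPrimitiveRoot ζ 6) (hz : z ^ 2 = z - 1)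
    (h2 : IsUnit (2 : F)) :
    (Units.map (fst (sq_eq_sub_one_of_isPrimitiveRoot hζ) hz).toMonoidHom).range =
      Subgroup.closure ({g : ℂˣ | (g : ℂ) = 2 ∨ (g : ℂ) = ζ} ∪ {-1}) := by
  have hζ' := sq_eq_sub_one_of_isPrimitiveRoot hζ
  have mem_closure {g : ℂˣ} (hg : (g : ℂ) = 2 ∨ (g : ℂ) = ζ) :
      g ∈ Subgroup.closure ({g : ℂˣ | (g : ℂ) = 2 ∨ (g : ℂ) = ζ} ∪ {-1}) :=
    Subgroup.subset_closure (Or.inl hg)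
  refine le_antisymm ?_ ((Subgroup.closure_le _).2 ?_)
  · rintro _ ⟨p, rfl⟩
    obtain ⟨k, u, hu, hpu⟩ := exists_fst_eq_two_zpow_mul p.isUnit
    obtain ⟨j, -, rfl⟩ := hζ.eq_pow_of_pow_eq_one hu
    have hp : Units.map (fst hζ' hz).toMonoidHom p =
        Units.mk0 2 two_ne_zero ^ k * Units.mk0 ζ (hζ.ne_zero (by norm_num)) ^ j :=
      Units.ext (by simpa using hpu)
    rw [hp]
    exact mul_mem (zpow_mem (mem_closure (Or.inl rfl)) k) (pow_mem (mem_closure (Or.inr rfl)) j)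
  · rintro g ((hg | hg) | rfl)
    · exact ⟨unitTwo hζ' hz h2, Units.ext hg.symm⟩
    · exact ⟨unitZeta hζ' hz, Units.ext hg.symm⟩
    · exact ⟨-1, Units.ext (by simp)⟩

end eisensteinGraph

end EisensteinGraph

section Seven

theorem two_three_sq_eq : ((2, 3) : ZMod 3 × ZMod 7) ^ 2 = (2, 3) - 1 := by decide

theorem isUnit_zmod_prod_iff {x : ZMod 3 × ZMod 7} : IsUnit x ↔ x.1 ≠ 0 ∧ x.2 ≠ 0 := by
  rw [Prod.isUnit_iff, isUnit_iff_ne_zero, isUnit_iff_ne_zero]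

theorem isUnit_two_zmod_prod : IsUnit (2 : ZMod 3 × ZMod 7) :=
  isUnit_zmod_prod_iff.2 (by decide)

theorem exists_eq_two_pow_or_eq_neg (a : (ZMod 3 × ZMod 7)ˣ) :
    ∃ k : Fin 6, a.val = 2 ^ (k : ℕ) ∨ a.val = -2 ^ (k : ℕ) := by
  have : ∀ x : ZMod 3 × ZMod 7, x.1 ≠ 0 ∧ x.2 ≠ 0 →
      ∃ k : Fin 6, x = 2 ^ (k : ℕ) ∨ x = -2 ^ (k : ℕ) := by decide
  exact this a (isUnit_zmod_prod_iff.1 a.isUnit)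

theorem IsFundamental.mem_of_zmod_prod {p : (ZMod 3 × ZMod 7)ˣ} (hp : IsFundamental p) :
    p.val ∈ ({(1, 1), (2, 6), (2, 2), (2, 4), (2, 3), (2, 5)} : Finset (ZMod 3 × ZMod 7)) := by
  have hunit := isUnit_zmod_prod_iff.1 p.isUnit
  have hsub := hp.imp_right isUnit_zmod_prod_iff.1
  revert hunit hsub
  generalize p.val = x
  revert x
  decide

theorem IsFundamental.eq_one_of_mul_zmod_prod {p q : (ZMod 3 × ZMod 7)ˣ} (hp : IsFundamental p)
    (hq : IsFundamental q) (hpq : IsFundamental (p * q)) : p = 1 ∨ q = 1 ∨ p * q = 1 := by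
  have hp' := hp.mem_of_zmod_prod
  have hq' := hq.mem_of_zmod_prod
  have hpq' := hpq.mem_of_zmod_prod
  simp only [Units.ext_iff, Units.val_mul, Units.val_one] at hpq' ⊢
  generalize p.val = x at *
  generalize q.val = y at *
  revert x y
  decide

theorem IsFundamental.eq_one_or_eq_neg_one_zmod_prod {p : (ZMod 3 × ZMod 7)ˣ} (hp : IsFundamental p)
    (hp' : IsFundamental (-p)) : p = 1 ∨ p = -1 := by
  have h := hp.mem_of_zmod_prod
  have h' := hp'.mem_of_zmod_prod
  simp only [Units.ext_iff, Units.val_neg, Units.val_one] at h' ⊢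
  generalize p.val = x at *
  revert x
  decide

namespace eisensteinGraph

variable {ζ : ℂ} (hζ : ζ ^ 2 = ζ - 1)

theorem snd_inv_unitTwo :
    snd hζ two_three_sq_eq (unitTwo hζ two_three_sq_eq isUnit_two_zmod_prod)⁻¹.val = (2, 4) :=
  left_inv_eq_right_inv (Ring.inverse_mul_cancel _ isUnit_two_zmod_prod) (by decide)

theorem injOnFundamental_snd : InjOnFundamental (snd hζ two_three_sq_eq) := by
  intro p q hp hq h
  have h' : snd hζ two_three_sq_eq p = snd hζ two_three_sq_eq q := congrArg Units.val h
  rcases eq_of_isFundamental isUnit_two_zmod_prod hp with rfl | rfl | rfl | rfl | rfl | rfl <;>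
  rcases eq_of_isFundamental isUnit_two_zmod_prod hq with rfl | rfl | rfl | rfl | rfl | rfl <;>
  first
    | rfl
    | simp only [Units.val_one, Units.val_neg, val_unitTwo, snd_inv_unitTwo, snd_unitZeta,
        val_inv_unitZeta, map_one, map_neg, map_sub, map_ofNat] at h'
      exact absurd h' (by decide)

theorem exists_isFundamental_snd {p : (ZMod 3 × ZMod 7)ˣ} (hp : IsFundamental p) :
    ∃ q, IsFundamental q ∧ Units.map (snd hζ two_three_sq_eq).toMonoidHom q = p := by
  have hz := two_three_sq_eq
  have h2 := isUnit_two_zmod_prod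
  have h := hp.mem_of_zmod_prod
  simp only [Finset.mem_insert, Finset.mem_singleton] at h
  rcases h with h | h | h | h | h | h
  · exact ⟨1, isFundamental_one, Units.ext h.symm⟩
  · exact ⟨-1, isFundamental_neg_one h2, Units.ext h.symm⟩
  · exact ⟨unitTwo hζ hz h2, isFundamental_unitTwo h2, Units.ext h.symm⟩
  · exact ⟨(unitTwo hζ hz h2)⁻¹, (isFundamental_unitTwo h2).inv,
      Units.ext ((snd_inv_unitTwo hζ).trans h.symm)⟩
  · exact ⟨unitZeta hζ hz, isFundamental_unitZeta, Units.ext h.symm⟩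
  · exact ⟨(unitZeta hζ hz)⁻¹, isFundamental_unitZeta.inv, Units.ext h.symm⟩

theorem exists_unit_map_snd_eq (a : (ZMod 3 × ZMod 7)ˣ) :
    ∃ b, Units.map (snd hζ two_three_sq_eq).toMonoidHom b = a := by
  have hz := two_three_sq_eq
  obtain ⟨k, hk | hk⟩ := exists_eq_two_pow_or_eq_neg a
  · exact ⟨unitTwo hζ hz isUnit_two_zmod_prod ^ (k : ℕ), Units.ext hk.symm⟩
  · exact ⟨-unitTwo hζ hz isUnit_two_zmod_prod ^ (k : ℕ), Units.ext hk.symm⟩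

theorem isLifting_snd : IsLifting (snd hζ two_three_sq_eq) where
  inj := injOnFundamental_snd hζ
  exists_unit := exists_unit_map_snd_eq hζ
  exists_isFundamental _ := exists_isFundamental_snd hζ
  mul _ _ := IsFundamental.eq_one_of_mul_zmod_prod
  neg _ := IsFundamental.eq_one_or_eq_neg_one_zmod_prod
  two := Or.inr (unitTwo hζ two_three_sq_eq isUnit_two_zmod_prod).isUnit

end eisensteinGraph

end Seven

end UnitMinors

namespace PartialField

open UnitMinors

section Sums

variable {P : Type*} [PartialField P]

theorem pneg_eq_mul (p : P) : pneg p = p * pneg 1 := by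
  refine (eq_pneg _ _ ?_).symm
  simpa using mul_padd p 1 (pneg 1) 0 (padd_pneg 1)

theorem pneg_pneg (p : P) : pneg (pneg p) = p :=
  (eq_pneg _ _ (padd_comm _ _ _ (padd_pneg p))).symm

theorem pneg_zero : pneg (0 : P) = 0 := (eq_pneg 0 0 (padd_zero 0)).symm

theorem pneg_mem_padd {p q r : P} (h : r ∈ padd p q) : pneg r ∈ padd (pneg p) (pneg q) := by
  rw [pneg_eq_mul p, pneg_eq_mul q, pneg_eq_mul r, mul_comm p, mul_comm q, mul_comm r]
  exact mul_padd _ _ _ _ h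

theorem isSum_singleton (p : P) : IsSum {p} p := ⟨0, by simpa using HasAssociation.leaf p⟩

theorem IsSum.add {S T : Multiset P} {p q r : P} (hS : IsSum S p) (hT : IsSum T q)
    (h : r ∈ padd p q) : IsSum (S + T) r := by
  obtain ⟨Z, hZ⟩ := hS
  obtain ⟨W, hW⟩ := hT
  refine ⟨Z + W, ?_⟩
  convert HasAssociation.node _ _ _ _ _ hZ hW h using 1
  rw [Multiset.map_add]
  abel

theorem IsSum.of_add_map_pneg {S Z : Multiset P} {r : P} (h : IsSum (S + (Z + Z.map pneg)) r) :
    IsSum S r := by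
  obtain ⟨W, hW⟩ := h
  refine ⟨Z + W, ?_⟩
  convert hW using 1
  rw [Multiset.map_add]
  abel

theorem IsSum.map_pneg {S : Multiset P} {r : P} (h : IsSum S r) :
    IsSum (S.map pneg) (pneg r) := by
  obtain ⟨Z, hZ⟩ := h
  exact ⟨Z.map pneg, by simpa using HasAssociation_map pneg (fun _ _ _ => pneg_mem_padd) hZ⟩

theorem IsSum.of_add_singleton_pneg {S : Multiset P} {r : P} (h : IsSum (S + {pneg r}) 0) :
    IsSum S r := by
  refine IsSum.of_add_map_pneg (Z := {r}) ?_
  rw [Multiset.map_singleton, add_comm ({r} : Multiset P), ← add_assoc]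
  exact h.add (isSum_singleton r) (padd_comm _ _ _ (padd_zero r))

theorem isSum_pair_pneg (p : P) : IsSum ({p} + {pneg p}) 0 :=
  (isSum_singleton p).add (isSum_singleton _) (padd_pneg p)

theorem isSum_zero : IsSum (0 : Multiset P) 0 :=
  IsSum.of_add_map_pneg (Z := {0}) (by simpa using isSum_pair_pneg (0 : P))

theorem isSum_add_map_pneg (Z : Multiset P) : IsSum (Z + Z.map pneg) 0 := by
  induction Z using Multiset.induction_on with
  | empty => simpa using isSum_zero
  | cons a Z ih =>
    convert (isSum_pair_pneg a).add ih (padd_zero 0) using 1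
    rw [← Multiset.singleton_add, Multiset.map_add, Multiset.map_singleton]
    abel

theorem hasAssociation_add_map_pneg {Z : Multiset P} (hZ : Z ≠ 0) :
    HasAssociation padd (Z + Z.map pneg) 0 := by
  induction Z using Multiset.induction_on with
  | empty => exact absurd rfl hZ
  | cons a Z ih =>
    have pair := HasAssociation.node _ _ _ _ _ (HasAssociation.leaf a)
      (HasAssociation.leaf (pneg a)) (padd_pneg a)
    rw [← Multiset.singleton_add, Multiset.map_add, Multiset.map_singleton]
    obtain rfl | hZ := eq_or_ne Z 0
    · simpa using pair
    · convert HasAssociation.node _ _ _ _ _ pair (ih hZ) (padd_zero 0) using 1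
      abel

theorem IsSum.exists_ne_zero {S : Multiset P} {r : P} (h : IsSum S r) :
    ∃ Z ≠ 0, HasAssociation padd (S + (Z + Z.map pneg)) r := by
  obtain ⟨Z, hZ⟩ := h
  refine ⟨Z + {0}, by simp, ?_⟩
  convert HasAssociation.node _ _ _ _ _ hZ
    (hasAssociation_add_map_pneg (Multiset.singleton_ne_zero (0 : P))) (padd_zero r) using 1
  rw [Multiset.map_add]
  abel

theorem IsSum.unique {S : Multiset P} {r r' : P} (h : IsSum S r) (h' : IsSum S r') : r = r' := by
  obtain ⟨Z, hZ, hr⟩ := h.exists_ne_zero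
  obtain ⟨Z', hZ', hr'⟩ := h'.exists_ne_zero
  have h_assoc := HasAssociation.node _ _ _ _ _ hr (hasAssociation_add_map_pneg hZ') (padd_zero r)
  exact Part.mem_unique
    (assoc_law _ _ h_assoc _ _ _ _ (add_right_comm _ _ _) hr' (hasAssociation_add_map_pneg hZ))
    (padd_zero r')

variable (P) in
/-- Two multisets of elements of a partial field are congruent if their formal difference sums
to zero. -/
def sumCon : AddCon (Multiset P) where
  r S T := IsSum (S + T.map pneg) 0
  iseqv :=
    { refl := isSum_add_map_pneg
      symm := by
        intro S T h
        have := h.map_pneg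
        rw [Multiset.map_add, Multiset.map_map, pneg_zero] at this
        simpa [Function.comp_def, pneg_pneg, add_comm] using this
      trans := by
        intro S T U hST hTU
        refine IsSum.of_add_map_pneg (Z := T) ?_
        convert hST.add hTU (padd_zero 0) using 1
        abel }
  add' := by
    intro S T U V hST hUV
    convert hST.add hUV (padd_zero 0) using 1
    rw [Multiset.map_add]
    abel

variable (P) in
/-- The universal abelian group of a partial field `P`: its generators are the elements of `P` and
its relations are the defined sums. A sum in `P` is defined exactly if it is equal to an element of
`P` in this group. -/
abbrev SumGroup := AddUnits (sumCon P).Quotient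

namespace SumGroup

/-- The generator of `SumGroup P` that belongs to an element of `P`. -/
def of (p : P) : SumGroup P :=
  have add_eq_zero : (({p} : Multiset P) : (sumCon P).Quotient) + ({pneg p} : Multiset P) = 0 := by
    rw [← AddCon.coe_add, ← AddCon.coe_zero, AddCon.eq]
    simpa [sumCon] using isSum_pair_pneg p
  ⟨({p} : Multiset P), ({pneg p} : Multiset P), add_eq_zero, (add_comm _ _).trans add_eq_zero⟩

theorem of_eq_add {p q r : P} (h : r ∈ padd p q) : of r = of p + of q := by
  have : sumCon P {r} ({p} + {q}) := by
    refine (sumCon P).symm (?_ : IsSum ({p} + {q} + Multiset.map pneg {r}) 0)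
    rw [Multiset.map_singleton]
    exact ((isSum_singleton p).add (isSum_singleton q) h).add (isSum_singleton _) (padd_pneg r)
  exact AddUnits.ext ((AddCon.eq _).2 this)

theorem of_zero : of (0 : P) = 0 := by simpa using of_eq_add (padd_zero (0 : P))

theorem val_sum_map_of (S : Multiset P) : (S.map of).sum.val = (S : (sumCon P).Quotient) := by
  induction S using Multiset.induction_on with
  | empty => rfl
  | cons a S ih =>
    rw [Multiset.map_cons, Multiset.sum_cons, AddUnits.val_add, ih, ← Multiset.singleton_add]
    rfl

theorem isSum_of_sum_map_of_eq {S : Multiset P} {r : P} (h : (S.map of).sum = of r) :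
    IsSum S r := by
  have : (S : (sumCon P).Quotient) = ({r} : Multiset P) := by
    rw [← val_sum_map_of, h]
    rfl
  exact IsSum.of_add_singleton_pneg ((AddCon.eq _).1 this)

end SumGroup

end Sums

section Homomorphisms

/-- A homomorphism of partial fields: a homomorphism of the underlying monoids with zero that
preserves all defined sums. -/
def IsHom {P Q : Type*} [PartialField P] [PartialField Q] (φ : P →*₀ Q) : Prop :=
  ∀ ⦃p q r⦄, r ∈ padd p q → φ r ∈ padd (φ p) (φ q)

namespace IsHom

variable {P Q : Type*} [PartialField P] [PartialField Q] {φ : P →*₀ Q} (hφ : IsHom φ)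

include hφ

theorem map_pneg (p : P) : φ (pneg p) = pneg (φ p) :=
  eq_pneg _ _ (map_zero φ ▸ hφ (padd_pneg p))

theorem isSum_map {S : Multiset P} {r : P} (hS : IsSum S r) : IsSum (S.map φ) (φ r) := by
  obtain ⟨Z, hZ⟩ := hS
  refine ⟨Z.map φ, ?_⟩
  convert HasAssociation_map φ hφ hZ using 1
  simp [Multiset.map_map, hφ.map_pneg]

theorem detTerms_map {n : Type*} [Fintype n] [DecidableEq n] (A : Matrix n n P) :
    detTerms (A.map φ) = (detTerms A).map φ := by
  rw [detTerms, detTerms, Multiset.map_map]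
  refine Multiset.map_congr rfl fun σ _ => ?_
  rw [Function.comp_apply, apply_ite φ, hφ.map_pneg, map_prod]
  rfl

theorem hasDet_map {n : Type*} [Fintype n] [DecidableEq n] {A : Matrix n n P} {d : P}
    (hd : HasDet A d) : HasDet (A.map φ) (φ d) := by
  rw [HasDet, hφ.detTerms_map]
  exact hφ.isSum_map hd

end IsHom

theorem Representable.map {P : Type u} {Q : Type v} [PartialField P] [PartialField Q]
    {φ : P →*₀ Q} (hφ : IsHom φ) {α : Type w} {M : Matroid α} (hM : Representable P M) :
    Representable Q M := by
  obtain ⟨r, A, hA, hB⟩ := hM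
  refine ⟨r, A.map φ, fun k f g => (hA k f g).imp' φ fun d => hφ.hasDet_map, fun B => ?_⟩
  rw [hB]
  refine exists_congr fun g => and_congr_right fun _ => ⟨?_, ?_⟩
  · rintro ⟨d, hd, hne⟩
    exact ⟨φ d, hφ.hasDet_map hd, (map_ne_zero φ).2 hne⟩
  · rintro ⟨e, he, hne⟩
    obtain ⟨d, hd⟩ := hA r (Function.Embedding.refl _) g
    refine ⟨d, hd, fun h0 => hne ?_⟩
    rw [IsSum.unique he (hφ.hasDet_map hd), h0, map_zero]

namespace DirectProduct

variable {P P₁ P₂ : Type*} [PartialField P] [PartialField P₁] [PartialField P₂]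

/-- The first projection of a direct product of partial fields. -/
def fst : DirectProduct P₁ P₂ →*₀ P₁ where
  toFun p := p.1.1
  map_zero' := rfl
  map_one' := rfl
  map_mul' _ _ := rfl

/-- The second projection of a direct product of partial fields. -/
def snd : DirectProduct P₁ P₂ →*₀ P₂ where
  toFun p := p.1.2
  map_zero' := rfl
  map_one' := rfl
  map_mul' _ _ := rfl

/-- The homomorphism to a direct product of partial fields with given components. -/
def prod (φ₁ : P →*₀ P₁) (φ₂ : P →*₀ P₂) : P →*₀ DirectProduct P₁ P₂ where
  toFun p := ⟨(φ₁ p, φ₂ p), by simp only [map_ne_zero]⟩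
  map_zero' := ext' (map_zero φ₁) (map_zero φ₂)
  map_one' := ext' (map_one φ₁) (map_one φ₂)
  map_mul' p q := ext' (map_mul φ₁ p q) (map_mul φ₂ p q)

theorem isHom_fst : IsHom (fst : DirectProduct P₁ P₂ →*₀ P₁) :=
  fun _ _ _ h => (mem_add.1 h).1

theorem isHom_snd : IsHom (snd : DirectProduct P₁ P₂ →*₀ P₂) :=
  fun _ _ _ h => (mem_add.1 h).2

theorem isHom_prod {φ₁ : P →*₀ P₁} {φ₂ : P →*₀ P₂} (h₁ : IsHom φ₁) (h₂ : IsHom φ₂) :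
    IsHom (prod φ₁ φ₂) :=
  fun _ _ _ h => mem_add.2 ⟨h₁ h, h₂ h⟩

end DirectProduct

end Homomorphisms

section Field

variable {F : Type*} [Field F]

theorem isSum_iff_eq_sum {S : Multiset F} {r : F} : IsSum S r ↔ r = S.sum := by
  refine ⟨fun ⟨Z, hZ⟩ => ?_, ?_⟩
  · have := HasAssociation_sum id (fun p q r h => Part.mem_some_iff.1 h) hZ
    have map_neg : (Z.map pneg).sum = -Z.sum := Multiset.sum_map_neg' Z
    simpa [map_neg] using this
  · rintro rfl
    induction S using Multiset.induction_on with
    | empty => exact isSum_zero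
    | cons a S ih =>
      rw [Multiset.sum_cons, ← Multiset.singleton_add]
      exact (isSum_singleton a).add ih (Part.mem_some _)

theorem hasDet_iff_eq_det {n : Type*} [Fintype n] [DecidableEq n] {A : Matrix n n F} {d : F} :
    HasDet A d ↔ d = A.det := by
  have sum_detTerms : (detTerms A).sum = A.det := by
    rw [detTerms, ← Matrix.det_transpose, Matrix.det_apply]
    refine congrArg Multiset.sum (Multiset.map_congr rfl fun σ _ => ?_)
    rcases Int.units_eq_one_or (Equiv.Perm.sign σ) with h | h
    · simp [h]
    · rw [if_neg (by rw [h]; decide), h, Units.neg_smul, one_smul]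
      rfl
  rw [HasDet, isSum_iff_eq_sum, sum_detTerms]

end Field

section StandardForm

variable {F : Type u} [Field F] {α : Type v} {r : ℕ} {M : Matroid α} {A : Matrix (Fin r) M.E F}

theorem det_submatrix_ne_zero_of_range_eq {m n : Type*} [Fintype m] [DecidableEq m]
    {A : Matrix m n F} {f g : m ↪ n} (h : Set.range f = Set.range g)
    (hf : (A.submatrix id f).det ≠ 0) : (A.submatrix id g).det ≠ 0 := by
  let σ : Equiv.Perm m := (Equiv.ofInjective f f.injective).trans
    ((Equiv.setCongr h).trans (Equiv.ofInjective g g.injective).symm)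
  have hσ : A.submatrix id f = (A.submatrix id g).submatrix id σ := by
    ext i j
    simp [σ, Equiv.apply_ofInjective_symm]
  rw [hσ, Matrix.det_permute'] at hf
  exact right_ne_zero_of_mul hf

theorem Represents.det_ne_zero_iff (h : Represents A) (f : Fin r ↪ M.E) :
    (A.submatrix id f).det ≠ 0 ↔ M.IsBase (Set.range fun i => (f i : α)) := by
  simp only [h.2, hasDet_iff_eq_det, exists_eq_left]
  refine ⟨fun hf => ⟨f, rfl, hf⟩, ?_⟩
  rintro ⟨g, hg, hne⟩
  refine det_submatrix_ne_zero_of_range_eq ?_ hne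
  rw [← Set.image_eq_image Subtype.val_injective, ← Set.range_comp, ← Set.range_comp]
  exact hg

theorem Represents.exists_standard (h : Represents A) {g : Fin r ↪ M.E}
    (hg : M.IsBase (Set.range fun i => (g i : α))) :
    ∃ N : Matrix (Fin r) M.E F, N.submatrix id g = 1 ∧
      ∀ f : Fin r ↪ M.E, (N.submatrix id f).det ≠ 0 ↔ M.IsBase (Set.range fun i => (f i : α)) := by
  have hu : IsUnit (A.submatrix id g).det := ((h.det_ne_zero_iff g).2 hg).isUnit
  have hinv : (A.submatrix id g)⁻¹.det ≠ 0 :=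
    left_ne_zero_of_mul_eq_one (Matrix.det_nonsing_inv_mul_det _ hu)
  refine ⟨(A.submatrix id g)⁻¹ * A, Matrix.nonsing_inv_mul _ hu, fun f => ?_⟩
  rw [show ((A.submatrix id g)⁻¹ * A).submatrix id f =
    (A.submatrix id g)⁻¹ * A.submatrix id f from rfl, Matrix.det_mul, ← h.det_ne_zero_iff,
    mul_ne_zero_iff, and_iff_right hinv]

end StandardForm

namespace OfRing

variable {K : Type*} [Field K] {S : Set Kˣ}

/-- The inclusion of the partial field `P(K, S)` into the field `K`. -/
def val : OfRing K S →*₀ K where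
  toFun := Subtype.val
  map_zero' := rfl
  map_one' := rfl
  map_mul' _ _ := rfl

theorem val_injective : Function.Injective (val : OfRing K S →*₀ K) := Subtype.val_injective

theorem mem_padd_iff {p q r : OfRing K S} : r ∈ padd p q ↔ val r = val p + val q := by
  refine ⟨fun ⟨_, h⟩ => h ▸ rfl, fun h => ⟨?_, val_injective h.symm⟩⟩
  have := r.2
  rwa [show r.1 = p.1 + q.1 from h] at this

theorem isHom_val : IsHom (val : OfRing K S →*₀ K) :=
  fun _ _ _ h => Part.mem_some_iff.2 (mem_padd_iff.1 h)

end OfRing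

/-- The partial field `𝕐 = P(ℂ, {2, ζ})`. -/
abbrev SixthTwo (ζ : ℂ) : Type := OfRing ℂ {g : ℂˣ | (g : ℂ) = 2 ∨ (g : ℂ) = ζ}

namespace SixthTwo

open OfRing

variable {ζ : ℂ} (hζ : IsPrimitiveRoot ζ 6)

section Graph

open eisensteinGraph

variable {F : Type*} [CommRing F] {z : F} (hz : z ^ 2 = z - 1)

theorem exists_fst_eq_val (h2 : IsUnit (2 : F)) (p : SixthTwo ζ) :
    ∃ x, fst (sq_eq_sub_one_of_isPrimitiveRoot hζ) hz x = val p := by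
  obtain hp | ⟨g, hg, hp⟩ := p.2
  · exact ⟨0, (map_zero _).trans hp.symm⟩
  · rw [← range_map_fst hζ hz h2] at hg
    obtain ⟨u, rfl⟩ := hg
    exact ⟨u, hp⟩

theorem exists_val_eq_fst (h2 : IsUnit (2 : F))
    {x : eisensteinGraph (sq_eq_sub_one_of_isPrimitiveRoot hζ) hz}
    (hx : IsZeroOrUnit x) : ∃ p : SixthTwo ζ, val p = fst _ hz x := by
  obtain rfl | ⟨u, rfl⟩ := hx
  · exact ⟨0, (map_zero val).trans (map_zero _).symm⟩
  · have mem_closure := Set.mem_of_eq_of_mem (s := SetLike.coe _) rfl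
      ((range_map_fst hζ hz h2).le ⟨u, rfl⟩)
    exact ⟨⟨_, Or.inr ⟨_, mem_closure, rfl⟩⟩, rfl⟩

variable (h2 : IsUnit (2 : F))

/-- The element of `ℤ[1/2, ζ]` that belongs to an element of `𝕐`. -/
noncomputable def toGraph (p : SixthTwo ζ) :
    eisensteinGraph (sq_eq_sub_one_of_isPrimitiveRoot hζ) hz :=
  (exists_fst_eq_val hζ hz h2 p).choose

theorem toGraph_eq_iff {p : SixthTwo ζ} {x} :
    toGraph hζ hz h2 p = x ↔ val p = fst (sq_eq_sub_one_of_isPrimitiveRoot hζ) hz x := by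
  rw [← (exists_fst_eq_val hζ hz h2 p).choose_spec]
  exact (fst_injective _ hz h2).eq_iff.symm

theorem fst_toGraph (p : SixthTwo ζ) :
    fst (sq_eq_sub_one_of_isPrimitiveRoot hζ) hz (toGraph hζ hz h2 p) = val p :=
  ((toGraph_eq_iff hζ hz h2).1 rfl).symm

end Graph

section ToField

open eisensteinGraph

variable {F : Type*} [Field F] {z : F} (hz : z ^ 2 = z - 1) (h2 : (2 : F) ≠ 0)

/-- The homomorphism from `𝕐` to a field that maps `ζ` to `z`. -/
noncomputable def toField : SixthTwo ζ →*₀ F where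
  toFun p := snd _ hz (toGraph hζ hz h2.isUnit p)
  map_zero' := by rw [(toGraph_eq_iff hζ hz h2.isUnit).2 ((map_zero val).trans (map_zero _).symm),
    map_zero]
  map_one' := by rw [(toGraph_eq_iff hζ hz h2.isUnit).2 ((map_one val).trans (map_one _).symm),
    map_one]
  map_mul' p q := by
    rw [← map_mul, (toGraph_eq_iff hζ hz h2.isUnit).2]
    rw [map_mul, map_mul, fst_toGraph, fst_toGraph]

theorem isHom_toField : IsHom (toField hζ hz h2) := by
  intro p q r h
  have toGraph_add : toGraph hζ hz h2.isUnit r =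
      toGraph hζ hz h2.isUnit p + toGraph hζ hz h2.isUnit q := by
    rw [toGraph_eq_iff, map_add, fst_toGraph, fst_toGraph, mem_padd_iff.1 h]
  exact Part.mem_some_iff.2 ((congrArg (snd _ hz) toGraph_add).trans (map_add _ _ _))

end ToField

section Sums

variable (ζ) in
/-- The element `2` of `𝕐`. -/
def two : SixthTwo ζ :=
  ⟨2, Or.inr ⟨Units.mk0 2 two_ne_zero, Subgroup.subset_closure (Or.inl (Or.inl rfl)), rfl⟩⟩

/-- The element `ζ` of `𝕐`. -/
def zeta : SixthTwo ζ :=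
  ⟨ζ, Or.inr ⟨Units.mk0 ζ (hζ.ne_zero (by norm_num)),
    Subgroup.subset_closure (Or.inl (Or.inr rfl)), rfl⟩⟩

theorem val_two : val (two ζ) = 2 := rfl

theorem val_zeta : val (zeta hζ) = ζ := rfl

theorem two_ne_zero' : two ζ ≠ 0 := (map_ne_zero val).1 two_ne_zero

theorem eq_zero_or_eq_two_zpow_mul (p : SixthTwo ζ) :
    p = 0 ∨ ∃ (k : ℤ) (j : ℕ), p = two ζ ^ k * zeta hζ ^ j := by
  obtain hp | ⟨g, hg, hp⟩ := p.2
  · exact Or.inl (val_injective hp)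
  · rw [← eisensteinGraph.range_map_fst hζ (sq_eq_sub_one_of_isPrimitiveRoot hζ)
      two_ne_zero.isUnit] at hg
    obtain ⟨x, rfl⟩ := hg
    obtain ⟨k, u, hu, hx⟩ := eisensteinGraph.exists_fst_eq_two_zpow_mul x.isUnit
    obtain ⟨j, -, rfl⟩ := hζ.eq_pow_of_pow_eq_one hu
    refine Or.inr ⟨k, j, val_injective ?_⟩
    rw [map_mul, map_zpow₀, map_pow, val_two, val_zeta, ← hx]
    exact hp.symm

open SumGroup

theorem of_two_pow_mul (t : ℕ) (p : SixthTwo ζ) : of (two ζ ^ t * p) = (2 ^ t : ℤ) • of p := by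
  induction t with
  | zero => simp
  | succ t ih =>
    have : of (two ζ ^ (t + 1) * p) = of (two ζ ^ t * p) + of (two ζ ^ t * p) := by
      refine of_eq_add (mem_padd_iff.2 ?_)
      simp only [map_mul, map_pow, val_two]
      ring
    rw [this, ih, ← two_zsmul, smul_smul, pow_succ']

theorem of_div_two_pow (n m : ℕ) (p : SixthTwo ζ) :
    of (p / two ζ ^ n) = (2 ^ m : ℤ) • of (p / two ζ ^ (n + m)) := by
  rw [← of_two_pow_mul, pow_add, mul_comm (two ζ ^ n), ← div_div, ← mul_div_assoc,
    mul_div_cancel₀ _ (pow_ne_zero _ two_ne_zero')]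

theorem of_mul_zeta_sq (p : SixthTwo ζ) :
    of (p * zeta hζ ^ 2) = of (p * zeta hζ) - of p := by
  refine eq_sub_of_add_eq (of_eq_add (mem_padd_iff.2 ?_)).symm
  simp only [map_mul, map_pow, val_zeta]
  linear_combination -val p * sq_eq_sub_one_of_isPrimitiveRoot hζ

theorem exists_pow_eq_and_of_mul_zeta_pow (j : ℕ) : ∃ a b : ℤ, ζ ^ j = a + b * ζ ∧
    ∀ p, of (p * zeta hζ ^ j) = a • of p + b • of (p * zeta hζ) := by
  induction j with
  | zero => exact ⟨1, 0, by simp, by simp⟩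
  | succ j ih =>
    obtain ⟨a, b, hj, hof⟩ := ih
    refine ⟨-b, a + b, ?_, fun p => ?_⟩
    · push_cast
      linear_combination ζ * hj + b * sq_eq_sub_one_of_isPrimitiveRoot hζ
    · rw [pow_succ', ← mul_assoc, hof, mul_assoc, ← sq, of_mul_zeta_sq]
      module

/-- The graph of the homomorphism of additive groups from `ℤ[1/2, ζ]` to `SumGroup 𝕐` that extends
the generators `SumGroup.of`. -/
def sumGraph : AddSubgroup (ℂ × SumGroup (SixthTwo ζ)) where
  carrier := {x | ∃ (n : ℕ) (a b : ℤ), 2 ^ n * x.1 = a + b * ζ ∧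
    x.2 = a • of (1 / two ζ ^ n) + b • of (zeta hζ / two ζ ^ n)}
  zero_mem' := ⟨0, 0, 0, by simp, by simp⟩
  add_mem' := by
    rintro x y ⟨n, a, b, hx₁, hx₂⟩ ⟨m, c, d, hy₁, hy₂⟩
    refine ⟨n + m, 2 ^ m * a + 2 ^ n * c, 2 ^ m * b + 2 ^ n * d, ?_, ?_⟩
    · push_cast
      rw [Prod.fst_add]
      linear_combination 2 ^ m * hx₁ + 2 ^ n * hy₁
    · rw [Prod.snd_add, hx₂, hy₂, of_div_two_pow n m, of_div_two_pow n m, of_div_two_pow m n,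
        of_div_two_pow m n, add_comm m n]
      module
  neg_mem' := by
    rintro x ⟨n, a, b, hx₁, hx₂⟩
    refine ⟨n, -a, -b, ?_, ?_⟩
    · push_cast
      rw [Prod.fst_neg]
      linear_combination -hx₁
    · rw [Prod.snd_neg, hx₂]
      module

theorem eq_zero_of_mem_sumGraph {y : SumGroup (SixthTwo ζ)} (h : (0, y) ∈ sumGraph hζ) :
    y = 0 := by
  obtain ⟨n, a, b, h₁, rfl⟩ := h
  rw [mul_zero] at h₁
  obtain ⟨rfl, rfl⟩ :=
    eq_zero_of_intCast_add_mul_eq_zero (sq_eq_sub_one_of_isPrimitiveRoot hζ) h₁.symm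
  simp

theorem val_of_mem_sumGraph (p : SixthTwo ζ) : (val p, of p) ∈ sumGraph hζ := by
  obtain rfl | ⟨k, j, rfl⟩ := eq_zero_or_eq_two_zpow_mul hζ p
  · rw [map_zero, of_zero]
    exact zero_mem _
  obtain ⟨a, b, hj, hof⟩ := exists_pow_eq_and_of_mul_zeta_pow hζ j
  obtain ⟨n, t, rfl⟩ : ∃ n t : ℕ, k = t - n := ⟨(-k).toNat, k.toNat, by omega⟩
  have hpow : two ζ ^ ((t : ℤ) - n) * zeta hζ ^ j = two ζ ^ t * (1 / two ζ ^ n * zeta hζ ^ j) := by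
    rw [zpow_sub₀ two_ne_zero', zpow_natCast, zpow_natCast, div_eq_mul_one_div, mul_assoc]
  refine ⟨n, 2 ^ t * a, 2 ^ t * b, ?_, ?_⟩
  · simp only [hpow, map_mul, map_div₀, map_one, map_pow, val_two, val_zeta, hj]
    push_cast
    field_simp
  · rw [hpow, of_two_pow_mul, hof, one_div_mul_eq_div _ (zeta hζ)]
    module

include hζ

theorem isSum_of_sum_eq {S : Multiset (SixthTwo ζ)} {r : SixthTwo ζ}
    (h : (S.map val).sum = val r) : IsSum S r := by
  have sum_mem : ((S.map val).sum, (S.map of).sum) ∈ sumGraph hζ := by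
    clear h
    induction S using Multiset.induction_on with
    | empty => exact zero_mem _
    | cons p S ih =>
      simp only [Multiset.map_cons, Multiset.sum_cons]
      exact add_mem (val_of_mem_sumGraph hζ p) ih
  have sub_mem := sub_mem sum_mem (val_of_mem_sumGraph hζ r)
  rw [Prod.mk_sub_mk, h, sub_self] at sub_mem
  exact isSum_of_sum_map_of_eq (sub_eq_zero.1 (eq_zero_of_mem_sumGraph hζ sub_mem))

theorem hasDet_iff {n : Type*} [Fintype n] [DecidableEq n] {A : Matrix n n (SixthTwo ζ)}
    {d : SixthTwo ζ} : HasDet A d ↔ val d = (A.map val).det := by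
  refine ⟨fun hd => hasDet_iff_eq_det.1 (isHom_val.hasDet_map hd), fun hd => isSum_of_sum_eq hζ ?_⟩
  rw [← isHom_val.detTerms_map, hd]
  exact (isSum_iff_eq_sum.1 (hasDet_iff_eq_det.2 rfl)).symm

end Sums

end SixthTwo

section UnitRepresents

variable {α : Type v} {M : Matroid α} {r : ℕ}

/-- The analogue of `Represents` for a matrix over a ring: all minors of `A` are zero or units, and
the bases of `M` are the sets of `r` columns with nonzero determinant. -/
def UnitRepresents {R : Type*} [CommRing R] (A : Matrix (Fin r) M.E R) : Prop :=
  HasUnitMinors A ∧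
    ∀ B : Set α, M.IsBase B ↔
      ∃ g : Fin r ↪ M.E, Set.range (fun i => (g i : α)) = B ∧ (A.submatrix id g).det ≠ 0

theorem UnitRepresents.of_map {R S : Type*} [CommRing R] [CommRing S] [Nontrivial S] {φ : R →+* S}
    {A : Matrix (Fin r) M.E R} (hA : HasUnitMinors A) (h : UnitRepresents (A.map φ)) :
    UnitRepresents A := by
  refine ⟨hA, fun B => (h.2 B).trans (exists_congr fun g => and_congr_right fun _ => not_congr ?_)⟩
  rw [← (hA.isZeroOrUnit_det id g).map_eq_zero_iff φ, RingHom.map_det]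
  rfl

theorem Represents.ncard_isBase {P : Type u} [PartialField P] {A : Matrix (Fin r) M.E P}
    (h : Represents A) {B : Set α} (hB : M.IsBase B) : B.ncard = r := by
  obtain ⟨g, rfl, -⟩ := (h.2 B).1 hB
  exact (Set.ncard_range_of_injective (Subtype.val_injective.comp g.injective)).trans
    (Nat.card_fin r)

theorem det_prod {n R S : Type*} [CommRing R] [CommRing S] [Fintype n] [DecidableEq n]
    (A : Matrix n n R) (B : Matrix n n S) :
    (Matrix.of fun i j => (A i j, B i j)).det = (A.det, B.det) :=
  Prod.ext (RingHom.map_det (RingHom.fst R S) _) (RingHom.map_det (RingHom.snd R S) _)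

theorem isZeroOrUnit_prodMk_iff {F₁ F₂ : Type*} [Field F₁] [Field F₂] {x : F₁} {y : F₂} :
    IsZeroOrUnit (x, y) ↔ (x = 0 ↔ y = 0) := by
  rw [IsZeroOrUnit, Prod.isUnit_iff, isUnit_iff_ne_zero, isUnit_iff_ne_zero, Prod.mk_eq_zero]
  exact iff_iff_and_or_not_and_not.symm

theorem exists_unitRepresents_prod {F₁ F₂ : Type*} [Field F₁] [Field F₂]
    (h₁ : Representable F₁ M) (h₂ : Representable F₂ M) :
    ∃ (r : ℕ) (A : Matrix (Fin r) M.E (F₁ × F₂)), UnitRepresents A := by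
  obtain ⟨r, A₁, hA₁⟩ := h₁
  obtain ⟨r', A₂, hA₂⟩ := h₂
  obtain ⟨B, hB⟩ := M.exists_isBase
  obtain rfl : r = r' := (hA₁.ncard_isBase hB).symm.trans (hA₂.ncard_isBase hB)
  obtain ⟨g, rfl, -⟩ := (hA₁.2 B).1 hB
  obtain ⟨N₁, hg₁, hN₁⟩ := hA₁.exists_standard hB
  obtain ⟨N₂, hg₂, hN₂⟩ := hA₂.exists_standard hB
  let N : Matrix (Fin r) M.E (F₁ × F₂) := Matrix.of fun i e => (N₁ i e, N₂ i e)
  have det_N (f : Fin r → M.E) :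
      (N.submatrix id f).det = ((N₁.submatrix id f).det, (N₂.submatrix id f).det) := det_prod _ _
  have N_eq_one : N.submatrix id g = 1 := by
    ext i j
    · refine (congrFun₂ hg₁ i j).trans ?_
      rw [Matrix.one_apply, Matrix.one_apply]
      split_ifs <;> rfl
    · refine (congrFun₂ hg₂ i j).trans ?_
      rw [Matrix.one_apply, Matrix.one_apply]
      split_ifs <;> rfl
  refine ⟨r, N, HasUnitMinors.of_maximal_minors g N_eq_one fun f => ?_, fun B => ⟨fun hB => ?_, ?_⟩⟩
  · by_cases hf : Function.Injective f
    · rw [det_N, isZeroOrUnit_prodMk_iff]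
      exact not_iff_not.1 ((hN₁ ⟨f, hf⟩).trans (hN₂ ⟨f, hf⟩).symm)
    · obtain ⟨i, j, hij, hne⟩ := Function.not_injective_iff.1 hf
      exact Or.inl (Matrix.det_zero_of_column_eq hne (by simp [hij]))
  · obtain ⟨f, rfl, -⟩ := (hA₁.2 B).1 hB
    refine ⟨f, rfl, fun h0 => (hN₁ f).2 hB ?_⟩
    rw [det_N, Prod.mk_eq_zero] at h0
    exact h0.1
  · rintro ⟨f, rfl, hf⟩
    rw [det_N, Ne, Prod.mk_eq_zero, not_and_or] at hf
    exact hf.elim (hN₁ f).1 (hN₂ f).1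

end UnitRepresents

section Lift

variable {ζ : ℂ} (hζ : IsPrimitiveRoot ζ 6) {α : Type v} {M : Matroid α}

include hζ

theorem Representable.of_unitRepresents {F : Type*} [CommRing F] {z : F} {hz : z ^ 2 = z - 1}
    (h2 : IsUnit (2 : F)) {r : ℕ}
    {L : Matrix (Fin r) M.E (eisensteinGraph (sq_eq_sub_one_of_isPrimitiveRoot hζ) hz)}
    (hL : UnitRepresents L) : Representable (SixthTwo ζ) M := by
  have exists_val (i : Fin r) (e : M.E) :=
    SixthTwo.exists_val_eq_fst hζ hz h2 (hL.1.isZeroOrUnit_apply i e)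
  choose A hA using exists_val
  have hasDet_iff {k : ℕ} (f : Fin k → Fin r) (g : Fin k → M.E) (d : SixthTwo ζ) :
      HasDet (Matrix.submatrix A f g) d ↔
        OfRing.val d = eisensteinGraph.fst _ hz (L.submatrix f g).det := by
    rw [SixthTwo.hasDet_iff hζ, RingHom.map_det]
    have : (Matrix.submatrix A f g).map OfRing.val =
        (eisensteinGraph.fst _ hz).mapMatrix (L.submatrix f g) := Matrix.ext fun i j => hA _ _
    rw [this]
  have hasDet_ne_zero (g : Fin r → M.E) : (∃ d, HasDet (Matrix.submatrix A id g) d ∧ d ≠ 0) ↔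
      (L.submatrix id g).det ≠ 0 := by
    have hdet := hL.1.isZeroOrUnit_det id g
    obtain ⟨d, hd⟩ := SixthTwo.exists_val_eq_fst hζ hz h2 hdet
    have hd_zero : d = 0 ↔ (L.submatrix id g).det = 0 := by
      rw [← map_eq_zero (OfRing.val), hd, hdet.map_eq_zero_iff]
    refine ⟨?_, fun h => ⟨d, (hasDet_iff id g d).2 hd, hd_zero.not.2 h⟩⟩
    rintro ⟨d', hd', h_ne⟩
    obtain rfl : d' = d := OfRing.val_injective (((hasDet_iff id g d').1 hd').trans hd.symm)
    exact hd_zero.not.1 h_ne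
  refine ⟨r, A, fun k f g => ?_, fun B => ?_⟩
  · obtain ⟨d, hd⟩ := SixthTwo.exists_val_eq_fst hζ hz h2 (hL.1 k f g)
    exact ⟨d, (hasDet_iff f g d).2 hd⟩
  · rw [hL.2 B]
    exact exists_congr fun g => and_congr_right fun _ => (hasDet_ne_zero g).symm

theorem representable_sixthTwo [M.Finite] (h₃ : Representable (ZMod 3) M)
    (h₇ : Representable (ZMod 7) M) : Representable (SixthTwo ζ) M := by
  have : Finite M.E := M.ground_finite.to_subtype
  obtain ⟨r, N, hN⟩ := exists_unitRepresents_prod h₃ h₇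
  obtain ⟨L, hL, rfl⟩ :=
    (eisensteinGraph.isLifting_snd (sq_eq_sub_one_of_isPrimitiveRoot hζ)).hasUnitLift hN.1
  exact .of_unitRepresents hζ isUnit_two_zmod_prod (.of_map hL hN)

end Lift

section Roots

theorem exists_sq_eq_sub_one_of_three_dvd {F : Type*} [Field F] [Finite F]
    (h : 3 ∣ Nat.card Fˣ) : ∃ z : F, z ^ 2 = z - 1 := by
  have : Fact (Nat.Prime 3) := ⟨Nat.prime_three⟩
  obtain ⟨g, hg⟩ := exists_prime_orderOf_dvd_card' 3 h
  have hprim : IsPrimitiveRoot (g : F) 3 := IsPrimitiveRoot.coe_units_iff.2 (hg ▸ .orderOf g)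
  have factors : ((g : F) - 1) * (g ^ 2 + g + 1) = 0 := by linear_combination hprim.pow_eq_one
  have root : (g : F) ^ 2 + g + 1 = 0 :=
    (mul_eq_zero.1 factors).resolve_left (sub_ne_zero.2 (hprim.ne_one (by norm_num)))
  exact ⟨-g, by linear_combination root⟩

theorem exists_sq_eq_sub_one_zmod {p : ℕ} [hp : Fact p.Prime] (h : p ≡ 1 [MOD 3]) :
    ∃ z : ZMod p, z ^ 2 = z - 1 := by
  refine exists_sq_eq_sub_one_of_three_dvd ?_
  rw [Nat.card_eq_fintype_card, ZMod.card_units]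
  exact (Nat.modEq_iff_dvd' hp.out.one_le).1 h.symm

theorem exists_sq_eq_sub_one_galoisField (p : ℕ) [hp : Fact p.Prime] :
    ∃ z : GaloisField p 2, z ^ 2 = z - 1 := by
  obtain rfl | h3 := eq_or_ne p 3
  · have : ((3 : ℕ) : GaloisField 3 2) = 0 := CharP.cast_eq_zero _ 3
    push_cast at this
    exact ⟨-1, by linear_combination this⟩
  · refine exists_sq_eq_sub_one_of_three_dvd ?_
    rw [Nat.card_units, GaloisField.card p 2 two_ne_zero]
    have not_dvd : ¬ 3 ∣ p := fun h =>
      h3 ((Nat.prime_dvd_prime_iff_eq Nat.prime_three hp.out).1 h).symm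
    have mod_three : p % 3 = 1 ∨ p % 3 = 2 := by lia
    have sq_modEq : p ^ 2 ≡ 1 [MOD 3] := by
      obtain h | h := mod_three <;> simp [Nat.ModEq, Nat.pow_mod, h]
    exact (Nat.modEq_iff_dvd' (Nat.one_le_pow _ _ hp.out.pos)).1 sq_modEq.symm

theorem two_ne_zero_of_charP {R : Type*} [Ring R] (p : ℕ) [CharP R p] (h : 2 < p) :
    (2 : R) ≠ 0 := by
  have := (CharP.cast_eq_zero_iff R p 2).not.2 (Nat.not_dvd_of_pos_of_lt two_pos h)
  simpa using this

theorem two_lt_of_modEq_one {p : ℕ} (hp : p.Prime) (h : p ≡ 1 [MOD 3]) : 2 < p := by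
  refine lt_of_le_of_ne hp.two_le ?_
  rintro rfl
  exact absurd h (by decide)

end Roots

end PartialField

theorem mainTheorem10 {α : Type*} (M : Matroid α) [M.Finite] (ζ : ℂ) (hζ : IsPrimitiveRoot ζ 6) :
    List.TFAE
      [PartialField.Representable (PartialField.DirectProduct (ZMod 3) (ZMod 7)) M,
       PartialField.Representable
        (PartialField.OfRing ℂ {g : ℂˣ | (g : ℂ) = 2 ∨ (g : ℂ) = ζ}) M,
       PartialField.Representable (ZMod 3) M ∧
        (∀ (p : ℕ) [Fact p.Prime], 2 < p → PartialField.Representable (GaloisField p 2) M) ∧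
        (∀ (p : ℕ) [Fact p.Prime], p ≡ 1 [MOD 3] → PartialField.Representable (ZMod p) M)] := by
  open PartialField PartialField.SixthTwo in
  have root₃ : (2 : ZMod 3) ^ 2 = 2 - 1 := by decide
  have root₇ : (3 : ZMod 7) ^ 2 = 3 - 1 := by decide
  have hom₃ := isHom_toField hζ root₃ (by decide)
  have hom₇ := isHom_toField hζ root₇ (by decide)
  tfae_have 1 → 2 := fun h =>
    representable_sixthTwo hζ (h.map DirectProduct.isHom_fst) (h.map DirectProduct.isHom_snd)
  tfae_have 2 → 1 := fun h => h.map (DirectProduct.isHom_prod hom₃ hom₇)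
  tfae_have 2 → 3 := fun h => by
    refine ⟨h.map hom₃, fun p _ hp => ?_, fun p hp hp1 => ?_⟩
    · obtain ⟨z, hz⟩ := exists_sq_eq_sub_one_galoisField p
      exact h.map (isHom_toField hζ hz (two_ne_zero_of_charP p hp))
    · obtain ⟨z, hz⟩ := exists_sq_eq_sub_one_zmod hp1
      exact h.map (isHom_toField hζ hz (two_ne_zero_of_charP p (two_lt_of_modEq_one hp.out hp1)))
  tfae_have 3 → 2 := fun ⟨h₃, _, h⟩ => representable_sixthTwo hζ h₃ (h 7 rfl)
  tfae_finish
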